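/- **Setting.** A polygonal curve $P$ of complexity $n\ge 2$ in $\mathbb R^d$ has vertices $p_1,\dots,p_n$ and vertex parameters $0=t_1<\dots<t_n=1$; $P:[0,1]\to\mathbb R^d$ interpolates linearly between the values $P(t_i)=p_i$. The edge $\overline{p\,q}$ is the curve $t\mapsto(1-t)p+tq$. A single point $p$ is viewed as the curve with the two vertices $p,p$. $P[a,b]$ is the subcurve from $P(a)$ to $P(b)$, and $d_F$ is the (continuous, Euclidean) Fréchet distance. $\mathbb X^d_2=\mathbb R^d\times\mathbb R^d$ is the set of edges in $\mathbb R^d$. For $C\subseteq\mathbb X^d_2$ and $\Delta>0$: * $C$ is a *$\Delta$-covering* of $P$ if every $s\in[0,1]$ lies in some $[t,t']\subseteq[0,1]$ with $d_F(P[t,t'],q)\le\Delta$ for some $q\in C$. * $C$ is a *structured $\Delta$-covering* of a polygonal curve $S$ with vertex parameters $t_1<\dots<t_m$ if every $s\in[0,1]$ lies in some $[t,t']$ with $d_F(S[t,t'],q)\le\Delta$ for some $q\in C$, where $t_i\le t\le t_{i+1}$ and $t_{j-1}\le t'\le t_j$ for some $1\le i<j\le m$ with $1\le j-i\le 4$.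 * A polygonal curve $S$ with vertices $p_{i_1},\dots,p_{i_r}$, where $1\le i_1<\dots<i_r\le n$, is a *$\Delta$-good simplification* of $P$ if (i) $\|p_{i_j}-p_{i_{j+1}}\|\ge\Delta/3$ for $1\le j<r$; (ii) $d_F(P[t_{i_j},t_{i_{j+1}}],\overline{p_{i_j}p_{i_{j+1}}})\le3\Delta$ for $1\le j<r$; (iii) $d_F(P[t_1,t_{i_1}],\overline{p_{i_1}p_{i_1}})\le3\Delta$ and $d_F(P[t_{i_r},t_n],\overline{p_{i_r}p_{i_r}})\le3\Delta$; (iv) $d_F(P[t_{i_j},t_{i_{j+2}}],\overline{p_{i_j}p_{i_{j+2}}})>2\Delta$ for $1\le j<r-1$. * The *candidate space* $\mathbb X_{E(S)}$ of $S$ is the set of all triples $(i,s,t)$ where $e_i$ is an edge of $S$ and $s,t\in[0,1]$; the triple is identified with the subedge $\overline{e_i(s)\,e_i(t)}\in\mathbb X^d_2$. **Theorem.** Fix the dimension $d$. There is a real-RAM algorithm (operations $+,-,\times,/,\sqrt{\ }$ and comparisons of real numbers at unit cost) and a constant $K$, both depending only on $d$, with the following property. Let $P$ be a polygonal curve of complexity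 $n$ in $\mathbb R^d$, let $\Delta>0$, and let $S$ be a $\Delta$-good simplification of $P$. Given $S$ and $\Delta$, the algorithm computes, in at most $Kn^3$ time and $Kn^3$ space, a finite set of candidates $B\subset\mathbb X_{E(S)}$ with $|B|\le Kn^3$ such that, for every $k$ for which $P$ has a $\Delta$-covering $C\subset\mathbb X^d_2$ of cardinality $k$, there is a set $C_B\subseteq B$ of size at most $12k$ that is a structured $8\Delta$-covering of $S$ and an $11\Delta$-covering of $P$. -/

import Mathlib

namespace TrajCover

/-! Curves, subcurves and the Fréchet distance. -/

/-- The Euclidean space `ℝ^d`. -/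
abbrev Pt (d : ℕ) : Type := EuclideanSpace ℝ (Fin d)

/-- A parametrized curve `[0,1] → ℝ^d`. -/
abbrev Curve (d : ℕ) : Type := unitInterval → Pt d

/-- A polygonal curve in `ℝ^d` with `m` edges and `m + 1` vertices, together with its vertex
parameters `0 = t_0 < t_1 < ⋯ < t_m = 1`; the conditions force `1 ≤ m`. A curve with only one
vertex `p` is represented, as usual, by the edge of length zero from `p` to `p`. -/
structure PolyCurve (d m : ℕ) where
  vertex : Fin (m + 1) → Pt d
  param : Fin (m + 1) → ℝ
  param_strictMono : StrictMono param
  param_zero : param 0 = 0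
  param_last : param (Fin.last m) = 1

/-- The complexity of a polygonal curve: its number of vertices. -/
def PolyCurve.complexity {d m : ℕ} (_P : PolyCurve d m) : ℕ := m + 1

/-- The point `P(t)`, by linear interpolation: each edge contributes the part of it that has been
traversed at time `t`. See `PolyCurve.eval_eq_lineMap` for the usual edge-by-edge formula. -/
noncomputable def PolyCurve.eval {d m : ℕ} (P : PolyCurve d m) (t : ℝ) : Pt d :=
  P.vertex 0 + ∑ i : Fin m,
    max 0 (min 1 ((t - P.param i.castSucc) / (P.param i.succ - P.param i.castSucc))) •
      (P.vertex i.succ - P.vertex i.castSucc)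

/-- The curve `t ↦ (1 - t) q.1 + t q.2`: `q` is an element of the set of two-vertex curves,
which are represented by pairs of points. -/
noncomputable def edgeCurve {d : ℕ} (q : Pt d × Pt d) : Curve d :=
  fun t => AffineMap.lineMap q.1 q.2 (t : ℝ)

/-- The subcurve `P[a,b]`. -/
noncomputable def PolyCurve.sub {d m : ℕ} (P : PolyCurve d m) (a b : ℝ) : Curve d :=
  fun t => P.eval ((1 - (t : ℝ)) * a + (t : ℝ) * b)

/-- The functions `[0,1] → [0,1]` that form traversals: monotone, surjective and continuous. -/
def IsReparam (α : unitInterval → unitInterval) : Prop :=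
  Monotone α ∧ Function.Surjective α ∧ Continuous α

/-- The Fréchet distance, with values in `[0,∞]`. -/
noncomputable def frechetDist {d : ℕ} (f g : Curve d) : ENNReal :=
  ⨅ (α : unitInterval → unitInterval) (β : unitInterval → unitInterval)
    (_ : IsReparam α ∧ IsReparam β), ⨆ t : unitInterval, edist (f (α t)) (g (β t))

/-! Coverage. -/

/-- The `Δ`-coverage of a set `C` of edges on the curve `P`. -/
def coverage {d m : ℕ} (Δ : ℝ) (P : PolyCurve d m) (C : Set (Pt d × Pt d)) : Set ℝ :=
  {s | ∃ q ∈ C, ∃ t t' : ℝ, 0 ≤ t ∧ t ≤ t' ∧ t' ≤ 1 ∧ s ∈ Set.Icc t t' ∧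
    frechetDist (P.sub t t') (edgeCurve q) ≤ ENNReal.ofReal Δ}

/-- `C` is a `Δ`-covering of `P`. -/
def IsCovering {d m : ℕ} (Δ : ℝ) (P : PolyCurve d m) (C : Set (Pt d × Pt d)) : Prop :=
  coverage Δ P C = Set.Icc 0 1

/-- The part of `S` covered by `q` through subcurves that start on the `i`-th edge of `S` and end
on the `j`-th edge of `S`. -/
def coverageOn {d m : ℕ} (Δ : ℝ) (S : PolyCurve d m) (i j : Fin m) (q : Pt d × Pt d) : Set ℝ :=
  {s | ∃ t t' : ℝ, s ∈ Set.Icc t t' ∧ t ∈ Set.Icc (S.param i.castSucc) (S.param i.succ) ∧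
    t ≤ t' ∧ t' ∈ Set.Icc (S.param j.castSucc) (S.param j.succ) ∧
    frechetDist (S.sub t t') (edgeCurve q) ≤ ENNReal.ofReal Δ}

/-- The structured `Δ`-coverage. Edge `j` ends at vertex `j + 1`, so that the condition on the
vertex indices, `1 ≤ (j + 1) - i ≤ 4`, reads `i ≤ j ≤ i + 3`. -/
def structuredCoverage {d m : ℕ} (Δ : ℝ) (S : PolyCurve d m) (C : Set (Pt d × Pt d)) : Set ℝ :=
  {s | ∃ q ∈ C, ∃ i j : Fin m, (i : ℕ) ≤ (j : ℕ) ∧ (j : ℕ) ≤ (i : ℕ) + 3 ∧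
    s ∈ coverageOn Δ S i j q}

/-- `C` is a structured `Δ`-covering of `S`. -/
def IsStructuredCovering {d m : ℕ} (Δ : ℝ) (S : PolyCurve d m) (C : Set (Pt d × Pt d)) : Prop :=
  structuredCoverage Δ S C = Set.Icc 0 1

/-! Simplifications. -/

/-- `S` is the simplification of `P` defined by the vertices `P.vertex (idx 0), …,
P.vertex (idx k)` with `idx` strictly increasing. If `k = 0`, then `S` is the one-vertex curve,
that is, an edge of length zero. The vertex parameters of `S` are arbitrary. -/
def IsSimplification {d p m k : ℕ} (P : PolyCurve d p) (S : PolyCurve d m)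
    (idx : Fin (k + 1) → Fin (p + 1)) : Prop :=
  StrictMono idx ∧ m = max k 1 ∧
    ∀ j : Fin (m + 1), S.vertex j = P.vertex (idx ⟨min (j : ℕ) k, by omega⟩)

/-- The four conditions on the index sequence `idx` of a `Δ`-good simplification of `P`. -/
structure IsGoodIndex {d p k : ℕ} (Δ : ℝ) (P : PolyCurve d p)
    (idx : Fin (k + 1) → Fin (p + 1)) : Prop where
  long_edges : ∀ j : Fin k,
    Δ / 3 ≤ dist (P.vertex (idx j.castSucc)) (P.vertex (idx j.succ))
  close : ∀ j : Fin k,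
    frechetDist (P.sub (P.param (idx j.castSucc)) (P.param (idx j.succ)))
      (edgeCurve (P.vertex (idx j.castSucc), P.vertex (idx j.succ))) ≤ ENNReal.ofReal (3 * Δ)
  close_start :
    frechetDist (P.sub (P.param 0) (P.param (idx 0)))
      (edgeCurve (P.vertex (idx 0), P.vertex (idx 0))) ≤ ENNReal.ofReal (3 * Δ)
  close_end :
    frechetDist (P.sub (P.param (idx (Fin.last k))) (P.param (Fin.last p)))
      (edgeCurve (P.vertex (idx (Fin.last k)), P.vertex (idx (Fin.last k)))) ≤
        ENNReal.ofReal (3 * Δ)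
  maximal : ∀ (j : ℕ) (hj : j + 2 < k + 1),
    ENNReal.ofReal (2 * Δ) <
      frechetDist (P.sub (P.param (idx ⟨j, by omega⟩)) (P.param (idx ⟨j + 2, hj⟩)))
        (edgeCurve (P.vertex (idx ⟨j, by omega⟩), P.vertex (idx ⟨j + 2, hj⟩)))

/-- `S` is a `Δ`-good simplification of `P`. -/
def IsGoodSimplification {d p m : ℕ} (Δ : ℝ) (P : PolyCurve d p) (S : PolyCurve d m) : Prop :=
  ∃ (k : ℕ) (idx : Fin (k + 1) → Fin (p + 1)), IsSimplification P S idx ∧ IsGoodIndex Δ P idx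

/-! The candidate space of the edges of a curve. -/

/-- The candidate `(i, s, t)` stands for the subedge from `e_i(s)` to `e_i(t)` of the `i`-th edge
of a curve with `m` edges; `t < s` is allowed. -/
abbrev Candidate (m : ℕ) : Type := Fin m × unitInterval × unitInterval

/-- The two-vertex curve that is associated with a candidate. -/
noncomputable def PolyCurve.subedge {d m : ℕ} (S : PolyCurve d m) (c : Candidate m) :
    Pt d × Pt d :=
  (edgeCurve (S.vertex c.1.castSucc, S.vertex c.1.succ) c.2.1,
    edgeCurve (S.vertex c.1.castSucc, S.vertex c.1.succ) c.2.2)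

/-! The real RAM: an array of natural numbers (used for counters and addresses) and an array of
real numbers, both with indirect addressing. Programs are structured programs. Every literal,
memory access, arithmetic operation, comparison, logical operation, assignment and branch takes
one unit of time. The arrays have a limited number `M` of cells each; a program that accesses any
other cell, divides by zero, or takes the root of a negative number has no successful run. There
is no conversion between real numbers and natural numbers and no multiplication of the latter. -/

/-- Memory contents. -/
structure State where
  int : ℕ → ℕ
  real : ℕ → ℝ

/-- Integer expressions. -/
inductive IExp where
  | lit (n : ℕ)
  | cell (a : IExp)
  | add (a b : IExp)
  | sub (a b : IExp)

/-- Real expressions; `cell a` is the real number at the address given by `a`. -/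
inductive RExp where
  | lit (z : ℤ)
  | cell (a : IExp)
  | add (x y : RExp)
  | sub (x y : RExp)
  | mul (x y : RExp)
  | div (x y : RExp)
  | sqrt (x : RExp)

/-- Tests. -/
inductive BExp where
  | ieq (a b : IExp)
  | ilt (a b : IExp)
  | req (x y : RExp)
  | rlt (x y : RExp)
  | not (u : BExp)
  | and (u v : BExp)
  | or (u v : BExp)

/-- Programs; `iset a e` and `rset a e` write the value of `e` to the address given by `a`. -/
inductive Cmd where
  | skip
  | iset (a : IExp) (e : IExp)
  | rset (a : IExp) (e : RExp)
  | seq (c₁ c₂ : Cmd)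
  | ite (u : BExp) (c₁ c₂ : Cmd)
  | loop (u : BExp) (c : Cmd)

/-- The value of an integer expression, `none` in the case of an illegal memory access. -/
def IExp.eval (M : ℕ) (σ : State) : IExp → Option ℕ
  | .lit n => some n
  | .cell a => (a.eval M σ).bind fun i => if i < M then some (σ.int i) else none
  | .add a b => (a.eval M σ).bind fun i => (b.eval M σ).bind fun j => some (i + j)
  | .sub a b => (a.eval M σ).bind fun i => (b.eval M σ).bind fun j => some (i - j)

open Classical in
/-- The value of a real expression, `none` in the case of an illegal operation. -/
noncomputable def RExp.eval (M : ℕ) (σ : State) : RExp → Option ℝ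
  | .lit z => some (z : ℝ)
  | .cell a => (a.eval M σ).bind fun i => if i < M then some (σ.real i) else none
  | .add x y => (x.eval M σ).bind fun r => (y.eval M σ).bind fun s => some (r + s)
  | .sub x y => (x.eval M σ).bind fun r => (y.eval M σ).bind fun s => some (r - s)
  | .mul x y => (x.eval M σ).bind fun r => (y.eval M σ).bind fun s => some (r * s)
  | .div x y => (x.eval M σ).bind fun r => (y.eval M σ).bind fun s =>
      if s = 0 then none else some (r / s)
  | .sqrt x => (x.eval M σ).bind fun r => if r < 0 then none else some (Real.sqrt r)

open Classical in
/-- The value of a test, `none` in the case of an illegal operation. -/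
noncomputable def BExp.eval (M : ℕ) (σ : State) : BExp → Option Bool
  | .ieq a b => (a.eval M σ).bind fun i => (b.eval M σ).bind fun j => some (decide (i = j))
  | .ilt a b => (a.eval M σ).bind fun i => (b.eval M σ).bind fun j => some (decide (i < j))
  | .req x y => (x.eval M σ).bind fun r => (y.eval M σ).bind fun s => some (decide (r = s))
  | .rlt x y => (x.eval M σ).bind fun r => (y.eval M σ).bind fun s => some (decide (r < s))
  | .not u => (u.eval M σ).bind fun p => some (!p)
  | .and u v => (u.eval M σ).bind fun p => (v.eval M σ).bind fun q => some (p && q)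
  | .or u v => (u.eval M σ).bind fun p => (v.eval M σ).bind fun q => some (p || q)

/-- The time to evaluate an integer expression. -/
def IExp.cost : IExp → ℕ
  | .lit _ => 1
  | .cell a => a.cost + 1
  | .add a b => a.cost + b.cost + 1
  | .sub a b => a.cost + b.cost + 1

/-- The time to evaluate a real expression. -/
def RExp.cost : RExp → ℕ
  | .lit _ => 1
  | .cell a => a.cost + 1
  | .add x y => x.cost + y.cost + 1
  | .sub x y => x.cost + y.cost + 1
  | .mul x y => x.cost + y.cost + 1
  | .div x y => x.cost + y.cost + 1
  | .sqrt x => x.cost + 1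

/-- The time to evaluate a test. -/
def BExp.cost : BExp → ℕ
  | .ieq a b => a.cost + b.cost + 1
  | .ilt a b => a.cost + b.cost + 1
  | .req x y => x.cost + y.cost + 1
  | .rlt x y => x.cost + y.cost + 1
  | .not u => u.cost + 1
  | .and u v => u.cost + v.cost + 1
  | .or u v => u.cost + v.cost + 1

/-- `Exec M c σ T σ'`: started with memory contents `σ` on a machine whose two arrays have `M`
cells each, the program `c` halts after exactly `T` units of time with memory contents `σ'`,
without any illegal operation. -/
inductive Exec (M : ℕ) : Cmd → State → ℕ → State → Prop where
  | skip (σ : State) : Exec M .skip σ 1 σ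
  | iset {a e : IExp} {σ : State} {i v : ℕ} (ha : a.eval M σ = some i) (hi : i < M)
      (he : e.eval M σ = some v) :
      Exec M (.iset a e) σ (a.cost + e.cost + 1) { σ with int := Function.update σ.int i v }
  | rset {a : IExp} {e : RExp} {σ : State} {i : ℕ} {v : ℝ} (ha : a.eval M σ = some i)
      (hi : i < M) (he : e.eval M σ = some v) :
      Exec M (.rset a e) σ (a.cost + e.cost + 1) { σ with real := Function.update σ.real i v }
  | seq {c₁ c₂ : Cmd} {σ σ' σ'' : State} {T₁ T₂ : ℕ} (h₁ : Exec M c₁ σ T₁ σ')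
      (h₂ : Exec M c₂ σ' T₂ σ'') : Exec M (.seq c₁ c₂) σ (T₁ + T₂) σ''
  | ite_true {u : BExp} {c₁ c₂ : Cmd} {σ σ' : State} {T : ℕ} (hu : u.eval M σ = some true)
      (h : Exec M c₁ σ T σ') : Exec M (.ite u c₁ c₂) σ (u.cost + 1 + T) σ'
  | ite_false {u : BExp} {c₁ c₂ : Cmd} {σ σ' : State} {T : ℕ} (hu : u.eval M σ = some false)
      (h : Exec M c₂ σ T σ') : Exec M (.ite u c₁ c₂) σ (u.cost + 1 + T) σ'
  | loop_false {u : BExp} {c : Cmd} {σ : State} (hu : u.eval M σ = some false) :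
      Exec M (.loop u c) σ (u.cost + 1) σ
  | loop_true {u : BExp} {c : Cmd} {σ σ' σ'' : State} {T₁ T₂ : ℕ}
      (hu : u.eval M σ = some true) (h₁ : Exec M c σ T₁ σ')
      (h₂ : Exec M (.loop u c) σ' T₂ σ'') :
      Exec M (.loop u c) σ (u.cost + 1 + T₁ + T₂) σ''

/-- The input `(S, Δ)` in memory: integer cell `0` holds the number of vertices of `S`, real cell
`0` holds `Δ`, and real cell `1 + j * d + c` holds the coordinate `c` of vertex `j`. All other
cells hold zero. -/
noncomputable def inputState {d m : ℕ} (S : PolyCurve d m) (Δ : ℝ) : State where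
  int := fun a => if a = 0 then m + 1 else 0
  real := fun a =>
    if a = 0 then Δ
    else if h : a - 1 < d * (m + 1) then
      S.vertex ⟨(a - 1) / d, Nat.div_lt_of_lt_mul h⟩
        ⟨(a - 1) % d, Nat.mod_lt _ (Nat.pos_of_mul_pos_right (Nat.zero_lt_of_lt h))⟩
    else 0

/-- Entry `r` of the output arrays, which start at integer address `a` and real address `b`,
is the candidate `c`. -/
def State.HoldsAt {m : ℕ} (σ : State) (a b r : ℕ) (c : Candidate m) : Prop :=
  σ.int (a + r) = (c.1 : ℕ) ∧ σ.real (b + 2 * r) = (c.2.1 : ℝ) ∧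
    σ.real (b + 2 * r + 1) = (c.2.2 : ℝ)

/-- The set `B` as output: integer cells `0`, `1`, `2` hold a number `N` and the addresses `a` and
`b` of two arrays inside the memory of size `M`, which list the elements of `B` (possibly with
repetitions) in `N` entries. -/
def State.Outputs {m : ℕ} (M : ℕ) (σ : State) (B : Finset (Candidate m)) : Prop :=
  σ.int 1 + σ.int 0 ≤ M ∧ σ.int 2 + 2 * σ.int 0 ≤ M ∧
    (∀ r < σ.int 0, ∃ c ∈ B, σ.HoldsAt (σ.int 1) (σ.int 2) r c) ∧
    (∀ c ∈ B, ∃ r < σ.int 0, σ.HoldsAt (σ.int 1) (σ.int 2) r c)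

/-- On input `(S, Δ)` the program computes `B` in time `T` with `M` cells in each array. -/
def Computes {d m : ℕ} (prog : Cmd) (S : PolyCurve d m) (Δ : ℝ) (T M : ℕ)
    (B : Finset (Candidate m)) : Prop :=
  ∃ σ : State, Exec M prog (inputState S Δ) T σ ∧ σ.Outputs M B

/-! Two checks of the definitions above. -/

/-- On the `i`-th edge, `P` is the usual linear interpolation. -/
theorem PolyCurve.eval_eq_lineMap {d m : ℕ} (P : PolyCurve d m) (i : Fin m) {t : ℝ}
    (ht : t ∈ Set.Icc (P.param i.castSucc) (P.param i.succ)) :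
    P.eval t = AffineMap.lineMap (P.vertex i.castSucc) (P.vertex i.succ)
      ((t - P.param i.castSucc) / (P.param i.succ - P.param i.castSucc)) := by
  have hpos : 0 < P.param i.succ - P.param i.castSucc :=
    sub_pos.2 (P.param_strictMono Fin.castSucc_lt_succ)
  set r := (t - P.param i.castSucc) / (P.param i.succ - P.param i.castSucc) with hr
  have hr0 : 0 ≤ r := div_nonneg (sub_nonneg.2 ht.1) hpos.le
  have hr1 : r ≤ 1 := (div_le_one hpos).2 (by linarith [ht.2])
  let w : ℕ → Pt d := fun n => P.vertex ⟨min n m, by omega⟩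
  have hw : ∀ j : Fin (m + 1), P.vertex j = w j := fun j => by
    have h : min (j : ℕ) m = j := min_eq_left (by omega)
    simp only [w, h]
  have key : ∀ k : Fin m,
      max 0 (min 1 ((t - P.param k.castSucc) / (P.param k.succ - P.param k.castSucc))) •
        (P.vertex k.succ - P.vertex k.castSucc) =
      (if (k : ℕ) < i then w (k + 1) - w k else 0) +
        (if k = i then r • (P.vertex i.succ - P.vertex i.castSucc) else 0) := by
    intro k
    have hk : 0 < P.param k.succ - P.param k.castSucc :=
      sub_pos.2 (P.param_strictMono Fin.castSucc_lt_succ)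
    rcases lt_trichotomy k i with h | h | h
    · have h1 : P.param k.succ ≤ P.param i.castSucc :=
        P.param_strictMono.monotone (by rw [Fin.le_def]; simpa using h)
      have h2 : 1 ≤ (t - P.param k.castSucc) / (P.param k.succ - P.param k.castSucc) :=
        (one_le_div hk).2 (by linarith [ht.1])
      have h3 : (k : ℕ) < i := h
      rw [min_eq_left h2, if_pos h3, if_neg h.ne, hw, hw]
      simp
    · subst h
      rw [if_neg (lt_irrefl _), if_pos rfl, ← hr, min_eq_right hr1, max_eq_right hr0, zero_add]
    · have h1 : P.param i.succ ≤ P.param k.castSucc :=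
        P.param_strictMono.monotone (by rw [Fin.le_def]; simpa using h)
      have h2 : (t - P.param k.castSucc) / (P.param k.succ - P.param k.castSucc) ≤ 0 :=
        div_nonpos_of_nonpos_of_nonneg (by linarith [ht.2]) hk.le
      have h3 : ¬ (k : ℕ) < i := not_lt.2 (le_of_lt h)
      rw [max_eq_left ((min_le_right _ _).trans h2), if_neg h3, if_neg h.ne']
      simp
  have tel : ∑ k : Fin m, (if (k : ℕ) < i then w (k + 1) - w k else 0) = w i - w 0 := by
    rw [Fin.sum_univ_eq_sum_range (fun k => if k < (i : ℕ) then w (k + 1) - w k else 0) m,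
      ← Finset.sum_filter, ← Finset.sum_range_sub]
    congr 1
    ext k
    simp only [Finset.mem_filter, Finset.mem_range]
    omega
  have h0 : P.vertex 0 = w 0 := hw 0
  have hi : P.vertex i.castSucc = w i := hw _
  unfold PolyCurve.eval
  rw [Finset.sum_congr rfl (fun k _ => key k), Finset.sum_add_distrib, tel,
    Finset.sum_ite_eq' Finset.univ i, if_pos (Finset.mem_univ i), h0, AffineMap.lineMap_apply,
    ← hi, vsub_eq_sub, vadd_eq_add]
  abel

/-- The coordinates of the vertices are where the input convention says. -/
theorem inputState_real {d m : ℕ} (S : PolyCurve d m) (Δ : ℝ) (j : Fin (m + 1)) (c : Fin d) :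
    (inputState S Δ).real (1 + (j : ℕ) * d + (c : ℕ)) = S.vertex j c := by
  have hd : 0 < d := Nat.zero_lt_of_lt c.2
  have hlt : (j : ℕ) * d + c < d * (m + 1) := by
    have h1 : ((j : ℕ) + 1) * d ≤ (m + 1) * d := Nat.mul_le_mul_right d j.2
    have h2 := c.2
    nlinarith
  have e0 : 1 + (j : ℕ) * d + (c : ℕ) ≠ 0 := by omega
  have e1 : 1 + (j : ℕ) * d + (c : ℕ) - 1 = (c : ℕ) + d * j := by
    rw [Nat.mul_comm d]; omega
  have e2 : ((c : ℕ) + d * j) / d = j := by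
    rw [Nat.add_mul_div_left _ _ hd, Nat.div_eq_of_lt c.2, Nat.zero_add]
  have e3 : ((c : ℕ) + d * j) % d = c := by
    rw [Nat.add_mul_mod_self_left, Nat.mod_eq_of_lt c.2]
  have hlt' : (c : ℕ) + d * j < d * (m + 1) := by rw [Nat.mul_comm d (j : ℕ)]; omega
  simp only [inputState, if_neg e0, e1, dif_pos hlt', e2, e3]

end TrajCover

/-! Fréchet distance at most `r` is expressed by a matching: a chain in the product of two parameter
intervals that projects onto both and whose pairs are at distance at most `r` (`Leash`). Matchings
can be restricted, concatenated, reversed and composed, while reparametrizations make these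
operations awkward. `frechetDist_sub_le_iff` translates between the two; it includes the fact that
the infimum is attained.

A good simplification `S` has a matching with `P` at distance `3Δ` that aligns the chosen vertices
(`IsGoodIndex.exists_matching`). Let `q` belong to a `Δ`-covering and serve a subcurve of `P`. The
matched subcurve of `S` is within `4Δ` of `q`, and it touches at most three consecutive edges of
`S`: otherwise the subcurve of `P` would contain three consecutive chosen vertices, against
condition (iv) (`IsGoodIndex.not_three`, `IsGoodIndex.spans`). Fix one such subcurve of `S` for each
`q` and cut it into three pieces, each on a single edge of `S`; this also cuts `q` into three. Any
other subcurve of `S` served by `q` is cut at the same points of `q`, and its pieces are within `4Δ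
+ 4Δ = 8Δ` of the fixed pieces, which are subedges of `S`.

It remains to replace an arbitrary subedge of an edge `e` by finitely many candidates. The critical
parameters of `e` are its two ends, the parameters at distance `8Δ` from a vertex of `S`, and those
where the region of points within `8Δ` of another edge is extremal in the direction of that edge.
Each end of the subedge is moved to one of its two critical neighbours, and the subcurve is extended
within its first and last edge to stay close (`CellConvex.round`). The two ends may pass each other,
so reversed subedges are needed. There are four combinations, and they depend on the subedge alone
(`PolyCurve.exists_four_candidates`), so that `3 · 4 = 12` candidates replace `q`. Returning to `P`
costs another `3Δ`, hence `11Δ`.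

An edge has `O(m)` critical parameters, which gives `O(m³)` candidates. For fixed `d` each is a
closed expression of constant size in the input, and three nested loops write them down
(`run_candidateProg`). -/

namespace TrajCover

/-! Monotone matchings of two intervals. -/

/-- `R` is a chain in `[a,b] × [c,d]` that projects onto both intervals. -/
structure IsMatching (R : Set (ℝ × ℝ)) (a b c d : ℝ) : Prop where
  le_left : a ≤ b
  le_right : c ≤ d
  subset : R ⊆ Set.Icc (a, c) (b, d)
  chain : ∀ x ∈ R, ∀ y ∈ R, x ≤ y ∨ y ≤ x
  left : ∀ x ∈ Set.Icc a b, ∃ y, (x, y) ∈ R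
  right : ∀ y ∈ Set.Icc c d, ∃ x, (x, y) ∈ R

namespace IsMatching

variable {R R' : Set (ℝ × ℝ)} {a b c d e f : ℝ}

theorem bot_mem (h : IsMatching R a b c d) : (a, c) ∈ R := by
  obtain ⟨y, hy⟩ := h.left a ⟨le_rfl, h.le_left⟩
  obtain ⟨x, hx⟩ := h.right c ⟨le_rfl, h.le_right⟩
  have h1 := h.subset hy
  have h2 := h.subset hx
  simp only [Set.mem_Icc, Prod.mk_le_mk] at h1 h2
  rcases h.chain _ hy _ hx with h3 | h3
  · rw [Prod.mk_le_mk] at h3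
    rwa [le_antisymm h3.2 h1.1.2] at hy
  · rw [Prod.mk_le_mk] at h3
    rwa [le_antisymm h3.1 h2.1.1] at hx

theorem top_mem (h : IsMatching R a b c d) : (b, d) ∈ R := by
  obtain ⟨y, hy⟩ := h.left b ⟨h.le_left, le_rfl⟩
  obtain ⟨x, hx⟩ := h.right d ⟨h.le_right, le_rfl⟩
  have h1 := h.subset hy
  have h2 := h.subset hx
  simp only [Set.mem_Icc, Prod.mk_le_mk] at h1 h2
  rcases h.chain _ hy _ hx with h3 | h3
  · rw [Prod.mk_le_mk] at h3
    rwa [le_antisymm h2.2.1 h3.1] at hx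
  · rw [Prod.mk_le_mk] at h3
    rwa [le_antisymm h1.2.2 h3.2] at hy

theorem swap (h : IsMatching R a b c d) : IsMatching (Prod.swap ⁻¹' R) c d a b where
  le_left := h.le_right
  le_right := h.le_left
  subset := by
    rintro ⟨x, y⟩ hx
    have := h.subset hx
    simp only [Prod.swap_prod_mk, Set.mem_Icc, Prod.mk_le_mk] at this ⊢
    tauto
  chain := by
    rintro ⟨x, y⟩ hx ⟨x', y'⟩ hx'
    have := h.chain _ hx _ hx'
    simp only [Prod.swap_prod_mk, Prod.mk_le_mk] at this ⊢
    tauto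
  left := h.right
  right := h.left

/-- Reversing both parameters lets every statement about the end of a subcurve be deduced from the
one about its start. -/
theorem neg (h : IsMatching R a b c d) : IsMatching (Neg.neg ⁻¹' R) (-b) (-a) (-d) (-c) where
  le_left := neg_le_neg h.le_left
  le_right := neg_le_neg h.le_right
  subset := by
    rintro ⟨x, y⟩ hx
    have := h.subset hx
    simp only [Prod.neg_mk, Set.mem_Icc, Prod.mk_le_mk] at this ⊢
    refine ⟨⟨?_, ?_⟩, ?_, ?_⟩ <;> linarith [this.1.1, this.1.2, this.2.1, this.2.2]
  chain := fun x hx y hy => (h.chain _ hx _ hy).symm.imp neg_le_neg_iff.1 neg_le_neg_iff.1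
  left := fun x hx => by
    obtain ⟨y, hy⟩ := h.left (-x) ⟨by linarith [hx.2], by linarith [hx.1]⟩
    exact ⟨-y, by simpa using hy⟩
  right := fun x hx => by
    obtain ⟨y, hy⟩ := h.right (-x) ⟨by linarith [hx.2], by linarith [hx.1]⟩
    exact ⟨-y, by simpa using hy⟩

/-- The part of a matching between two of its elements. -/
theorem restrict (h : IsMatching R a b c d) {x y x' y' : ℝ} (hx : (x, y) ∈ R)
    (hx' : (x', y') ∈ R) (hle : (x, y) ≤ (x', y')) :
    IsMatching (R ∩ Set.Icc (x, y) (x', y')) x x' y y' where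
  le_left := hle.1
  le_right := hle.2
  subset := Set.inter_subset_right
  chain := fun p hp q hq => h.chain p hp.1 q hq.1
  left := by
    intro z hz
    have h1 := h.subset hx
    have h2 := h.subset hx'
    simp only [Set.mem_Icc, Prod.mk_le_mk] at h1 h2
    rcases hz.1.eq_or_lt with rfl | hz1
    · exact ⟨y, hx, le_rfl, hle⟩
    rcases hz.2.eq_or_lt with rfl | hz2
    · exact ⟨y', hx', hle, le_rfl⟩
    obtain ⟨w, hw⟩ := h.left z ⟨h1.1.1.trans hz.1, hz.2.trans h2.2.1⟩
    refine ⟨w, hw, ?_, ?_⟩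
    · exact (h.chain _ hx _ hw).resolve_right fun h3 => absurd h3.1 (not_le.2 hz1)
    · exact (h.chain _ hw _ hx').resolve_right fun h3 => absurd h3.1 (not_le.2 hz2)
  right := by
    intro z hz
    have h1 := h.subset hx
    have h2 := h.subset hx'
    simp only [Set.mem_Icc, Prod.mk_le_mk] at h1 h2
    rcases hz.1.eq_or_lt with rfl | hz1
    · exact ⟨x, hx, le_rfl, hle⟩
    rcases hz.2.eq_or_lt with rfl | hz2
    · exact ⟨x', hx', hle, le_rfl⟩
    obtain ⟨w, hw⟩ := h.right z ⟨h1.1.2.trans hz.1, hz.2.trans h2.2.2⟩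
    refine ⟨w, hw, ?_, ?_⟩
    · exact (h.chain _ hx _ hw).resolve_right fun h3 => absurd h3.2 (not_le.2 hz1)
    · exact (h.chain _ hw _ hx').resolve_right fun h3 => absurd h3.2 (not_le.2 hz2)

/-- Projection alone may return a partner above `y` when `x' = x`; restricting to the part below
`(x, y)` excludes this. -/
theorem exists_left_le (h : IsMatching R a b c d) {x y x' : ℝ} (hx : (x, y) ∈ R)
    (ha : a ≤ x') (hle : x' ≤ x) : ∃ y' ≤ y, (x', y') ∈ R := by
  have h1 := h.subset hx
  simp only [Set.mem_Icc, Prod.mk_le_mk] at h1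
  obtain ⟨y', h2⟩ := (h.restrict h.bot_mem hx h1.1).left x' ⟨ha, hle⟩
  exact ⟨y', h2.2.2.2, h2.1⟩

theorem exists_left_ge (h : IsMatching R a b c d) {x y x' : ℝ} (hx : (x, y) ∈ R)
    (hb : x' ≤ b) (hle : x ≤ x') : ∃ y', y ≤ y' ∧ (x', y') ∈ R := by
  have h1 := h.subset hx
  simp only [Set.mem_Icc, Prod.mk_le_mk] at h1
  obtain ⟨y', h2⟩ := (h.restrict hx h.top_mem h1.2).left x' ⟨hle, hb⟩
  exact ⟨y', h2.2.1.2, h2.1⟩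

theorem concat (h : IsMatching R a b c d) (h' : IsMatching R' b e d f) :
    IsMatching (R ∪ R') a e c f where
  le_left := h.le_left.trans h'.le_left
  le_right := h.le_right.trans h'.le_right
  subset := by
    rintro x (hx | hx)
    · exact ⟨(h.subset hx).1, (h.subset hx).2.trans ⟨h'.le_left, h'.le_right⟩⟩
    · exact ⟨le_trans ⟨h.le_left, h.le_right⟩ (h'.subset hx).1, (h'.subset hx).2⟩
  chain := by
    rintro x (hx | hx) y (hy | hy)
    · exact h.chain x hx y hy
    · exact Or.inl ((h.subset hx).2.trans (h'.subset hy).1)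
    · exact Or.inr ((h.subset hy).2.trans (h'.subset hx).1)
    · exact h'.chain x hx y hy
  left := by
    intro x hx
    rcases le_total x b with h1 | h1
    · obtain ⟨y, hy⟩ := h.left x ⟨hx.1, h1⟩
      exact ⟨y, Or.inl hy⟩
    · obtain ⟨y, hy⟩ := h'.left x ⟨h1, hx.2⟩
      exact ⟨y, Or.inr hy⟩
  right := by
    intro x hx
    rcases le_total x d with h1 | h1
    · obtain ⟨y, hy⟩ := h.right x ⟨hx.1, h1⟩
      exact ⟨y, Or.inl hy⟩
    · obtain ⟨y, hy⟩ := h'.right x ⟨h1, hx.2⟩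
      exact ⟨y, Or.inr hy⟩

/-- Comparability is a closed condition on pairs of points, so it survives passage to the closure.
Closed matchings are compact, which composition and traversal rely on. -/
theorem closure (h : IsMatching R a b c d) : IsMatching (closure R) a b c d where
  le_left := h.le_left
  le_right := h.le_right
  subset := closure_minimal h.subset isClosed_Icc
  chain := by
    have hcl : IsClosed {p : (ℝ × ℝ) × (ℝ × ℝ) | p.1 ≤ p.2 ∨ p.2 ≤ p.1} :=
      (isClosed_le continuous_fst continuous_snd).union
        (isClosed_le continuous_snd continuous_fst)
    have h1 : _root_.closure (R ×ˢ R) ⊆ {p : (ℝ × ℝ) × (ℝ × ℝ) | p.1 ≤ p.2 ∨ p.2 ≤ p.1} :=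
      closure_minimal (fun p hp => h.chain _ hp.1 _ hp.2) hcl
    rw [closure_prod_eq] at h1
    exact fun x hx y hy => h1 (Set.mk_mem_prod hx hy)
  left := fun x hx => (h.left x hx).imp fun _ hy => subset_closure hy
  right := fun x hx => (h.right x hx).imp fun _ hy => subset_closure hy

theorem isCompact (h : IsMatching R a b c d) (hR : IsClosed R) : IsCompact R :=
  isCompact_Icc.of_isClosed_subset hR h.subset

/-- The composition of two closed matchings. Pairs that agree in the middle coordinate form a
rectangle, of which only the lower and the right side are kept. -/
theorem comp (h : IsMatching R a b c d) (hR : IsClosed R) (h' : IsMatching R' c d e f)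
    (hR' : IsClosed R') :
    IsMatching {p : ℝ × ℝ | ∃ y, (p.1, y) ∈ R ∧ (y, p.2) ∈ R' ∧
      ((∀ z, (y, z) ∈ R' → p.2 ≤ z) ∨ ∀ x, (x, y) ∈ R → x ≤ p.1)} a b e f where
  le_left := h.le_left
  le_right := h'.le_right
  subset := by
    rintro ⟨x, z⟩ ⟨y, h1, h2, -⟩
    exact ⟨⟨(h.subset h1).1.1, (h'.subset h2).1.2⟩, (h.subset h1).2.1, (h'.subset h2).2.2⟩
  chain := by
    rintro ⟨x, z⟩ ⟨y, h1, h2, h3⟩ ⟨x', z'⟩ ⟨y', h1', h2', h3'⟩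
    dsimp only at *
    rcases lt_trichotomy y y' with hy | rfl | hy
    · have e1 := (h.chain _ h1 _ h1').resolve_right fun h4 => absurd h4.2 (not_le.2 hy)
      have e2 := (h'.chain _ h2 _ h2').resolve_right fun h4 => absurd h4.1 (not_le.2 hy)
      exact Or.inl ⟨e1.1, e2.2⟩
    -- Both pairs lie over the same middle point. Each is on the lower or the right side of the
    -- rectangle, and these two sides together form a chain.
    · simp only [Prod.mk_le_mk]
      have t1 := le_total x x'
      have t2 := le_total z z'
      rcases h3 with h3 | h3 <;> rcases h3' with h3' | h3'
      · have := h3 _ h2'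
        have := h3' _ h2
        tauto
      · have := h3 _ h2'
        have := h3' _ h1
        tauto
      · have := h3 _ h1'
        have := h3' _ h2
        tauto
      · have := h3 _ h1'
        have := h3' _ h1
        tauto
    · have e1 := (h.chain _ h1' _ h1).resolve_right fun h4 => absurd h4.2 (not_le.2 hy)
      have e2 := (h'.chain _ h2' _ h2).resolve_right fun h4 => absurd h4.1 (not_le.2 hy)
      exact Or.inr ⟨e1.1, e2.2⟩
  left := by
    intro x hx
    obtain ⟨y, hy⟩ := h.left x hx
    have hy' : y ∈ Set.Icc c d := ⟨(h.subset hy).1.2, (h.subset hy).2.2⟩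
    have hc : IsCompact (R' ∩ {p | p.1 = y}) :=
      (h'.isCompact hR').inter_right (isClosed_eq continuous_fst continuous_const)
    obtain ⟨z₀, hz₀⟩ := h'.left y hy'
    obtain ⟨⟨y₁, z⟩, ⟨hz, hz1⟩, hmin⟩ :=
      hc.exists_isMinOn ⟨(y, z₀), hz₀, rfl⟩ continuous_snd.continuousOn
    obtain rfl : y₁ = y := hz1
    exact ⟨z, y₁, hy, hz, Or.inl fun z' hz' => hmin ⟨hz', rfl⟩⟩
  right := by
    intro z hz
    obtain ⟨y, hy⟩ := h'.right z hz
    have hy' : y ∈ Set.Icc c d := ⟨(h'.subset hy).1.1, (h'.subset hy).2.1⟩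
    have hc : IsCompact (R ∩ {p | p.2 = y}) :=
      (h.isCompact hR).inter_right (isClosed_eq continuous_snd continuous_const)
    obtain ⟨x₀, hx₀⟩ := h.right y hy'
    obtain ⟨⟨x, y₁⟩, ⟨hx, hx1⟩, hmax⟩ :=
      hc.exists_isMaxOn ⟨(x₀, y), hx₀, rfl⟩ continuous_fst.continuousOn
    obtain rfl : y₁ = y := hx1
    exact ⟨x, y₁, hx, hy, Or.inr fun x' hx' => hmax ⟨hx', rfl⟩⟩

/-- A closed matching contains a point on every antidiagonal. -/
theorem exists_add_eq (h : IsMatching R a b c d) (hR : IsClosed R) {s : ℝ}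
    (hs : s ∈ Set.Icc (a + c) (b + d)) : ∃ p ∈ R, p.1 + p.2 = s := by
  have hcont : Continuous fun p : ℝ × ℝ => p.1 + p.2 := continuous_fst.add continuous_snd
  obtain ⟨p, ⟨hp, hps⟩, hpmax⟩ :=
    ((h.isCompact hR).inter_right (isClosed_le hcont continuous_const)).exists_isMaxOn
      (⟨(a, c), h.bot_mem, hs.1⟩ : (R ∩ {p : ℝ × ℝ | p.1 + p.2 ≤ s}).Nonempty) hcont.continuousOn
  obtain ⟨q, ⟨hq, hqs⟩, hqmin⟩ :=
    ((h.isCompact hR).inter_right (isClosed_le continuous_const hcont)).exists_isMinOn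
      (⟨(b, d), h.top_mem, hs.2⟩ : (R ∩ {p : ℝ × ℝ | s ≤ p.1 + p.2}).Nonempty) hcont.continuousOn
  by_contra hcon
  push Not at hcon
  have hps' : p.1 + p.2 < s := lt_of_le_of_ne hps (hcon p hp)
  have hqs' : s < q.1 + q.2 := lt_of_le_of_ne hqs (Ne.symm (hcon q hq))
  have hpq : p ≤ q := (h.chain p hp q hq).resolve_right fun h1 => by
    have := h1.1; have := h1.2; linarith
  -- By the choice of `p` and `q` no element of `R` has a coordinate strictly between theirs, so one
  -- of the projections would miss an interval.
  have key : ∀ x ∈ R, (p.1 < x.1 ∧ x.1 < q.1) ∨ (p.2 < x.2 ∧ x.2 < q.2) → False := by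
    intro x hx h1
    have hpx : p ≤ x := (h.chain p hp x hx).resolve_right fun h2 => by
      rcases h1 with h1 | h1
      · exact absurd h2.1 (not_le.2 h1.1)
      · exact absurd h2.2 (not_le.2 h1.1)
    have hxq : x ≤ q := (h.chain x hx q hq).resolve_right fun h2 => by
      rcases h1 with h1 | h1
      · exact absurd h2.1 (not_le.2 h1.2)
      · exact absurd h2.2 (not_le.2 h1.2)
    have := hpx.1; have := hpx.2; have := hxq.1; have := hxq.2
    rcases le_total (x.1 + x.2) s with h2 | h2
    · have : x.1 + x.2 ≤ p.1 + p.2 := hpmax ⟨hx, h2⟩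
      rcases h1 with h1 | h1 <;> linarith [h1.1]
    · have : q.1 + q.2 ≤ x.1 + x.2 := hqmin ⟨hx, h2⟩
      rcases h1 with h1 | h1 <;> linarith [h1.2]
  have hp1 := h.subset hp
  have hq1 := h.subset hq
  rcases hpq.1.lt_or_eq with h1 | h1
  · obtain ⟨z, hz1, hz2⟩ := exists_between h1
    obtain ⟨y, hy⟩ := h.left z ⟨hp1.1.1.trans hz1.le, hz2.le.trans hq1.2.1⟩
    exact key _ hy (Or.inl ⟨hz1, hz2⟩)
  · obtain ⟨z, hz1, hz2⟩ := exists_between (show p.2 < q.2 by linarith)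
    obtain ⟨y, hy⟩ := h.right z ⟨hp1.1.2.trans hz1.le, hz2.le.trans hq1.2.2⟩
    exact key _ hy (Or.inr ⟨hz1, hz2⟩)

theorem le_of_add_le (h : IsMatching R a b c d) {p q : ℝ × ℝ} (hp : p ∈ R) (hq : q ∈ R)
    (hle : p.1 + p.2 ≤ q.1 + q.2) : p ≤ q := by
  rcases h.chain p hp q hq with h1 | h1
  · exact h1
  · have := h1.1; have := h1.2
    exact ⟨by linarith, by linarith⟩

/-- The graph of a monotone function with a full image is a matching. -/
theorem graph {σ : ℝ → ℝ} (hab : a ≤ b) (hσ : MonotoneOn σ (Set.Icc a b))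
    (himg : σ '' Set.Icc a b = Set.Icc c d) :
    IsMatching ((fun x => (x, σ x)) '' Set.Icc a b) a b c d := by
  have hmem : ∀ x ∈ Set.Icc a b, σ x ∈ Set.Icc c d := fun x hx =>
    himg ▸ Set.mem_image_of_mem σ hx
  refine ⟨hab, ?_, ?_, ?_, fun x hx => ⟨σ x, x, hx, rfl⟩, ?_⟩
  · have := hmem a ⟨le_rfl, hab⟩
    exact this.1.trans this.2
  · rintro _ ⟨x, hx, rfl⟩
    exact ⟨⟨hx.1, (hmem x hx).1⟩, hx.2, (hmem x hx).2⟩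
  · rintro _ ⟨x, hx, rfl⟩ _ ⟨y, hy, rfl⟩
    exact (le_total x y).imp (fun h => ⟨h, hσ hx hy h⟩) fun h => ⟨h, hσ hy hx h⟩
  · intro y hy
    rw [← himg] at hy
    obtain ⟨x, hx, rfl⟩ := hy
    exact ⟨x, x, hx, rfl⟩

end IsMatching

/-! Curves within Fréchet distance `r`, in terms of matchings. -/

section Leash

variable {E : Type*} [PseudoMetricSpace E]

/-- The subcurves `F[a,b]` and `G[c,d]` can be traversed simultaneously at distance at most `r`. -/
def Leash (r : ℝ) (F : ℝ → E) (a b : ℝ) (G : ℝ → E) (c d : ℝ) : Prop :=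
  ∃ R, IsMatching R a b c d ∧ ∀ p ∈ R, dist (F p.1) (G p.2) ≤ r

namespace Leash

variable {r r' : ℝ} {F G H : ℝ → E} {a b c d e f : ℝ}

theorem dist_left (h : Leash r F a b G c d) : dist (F a) (G c) ≤ r :=
  let ⟨_, h1, h2⟩ := h
  h2 _ h1.bot_mem

theorem dist_right (h : Leash r F a b G c d) : dist (F b) (G d) ≤ r :=
  let ⟨_, h1, h2⟩ := h
  h2 _ h1.top_mem

theorem le_left (h : Leash r F a b G c d) : a ≤ b := let ⟨_, h1, _⟩ := h; h1.le_left

theorem le_right (h : Leash r F a b G c d) : c ≤ d := let ⟨_, h1, _⟩ := h; h1.le_right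

theorem symm (h : Leash r F a b G c d) : Leash r G c d F a b := by
  obtain ⟨R, h1, h2⟩ := h
  exact ⟨_, h1.swap, fun p hp => by rw [dist_comm]; exact h2 _ hp⟩

theorem neg (h : Leash r F a b G c d) :
    Leash r (fun x => F (-x)) (-b) (-a) (fun x => G (-x)) (-d) (-c) := by
  obtain ⟨R, h1, h2⟩ := h
  exact ⟨_, h1.neg, fun p hp => h2 _ hp⟩

theorem concat (h : Leash r F a b G c d) (h' : Leash r F b e G d f) : Leash r F a e G c f := by
  obtain ⟨R, h1, h2⟩ := h
  obtain ⟨R', h1', h2'⟩ := h'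
  exact ⟨_, h1.concat h1', fun p hp => hp.elim (h2 p) (h2' p)⟩

theorem split (h : Leash r F a b G c d) {x : ℝ} (hx : x ∈ Set.Icc a b) :
    ∃ y ∈ Set.Icc c d, Leash r F a x G c y ∧ Leash r F x b G y d := by
  obtain ⟨R, h1, h2⟩ := h
  obtain ⟨y, hy⟩ := h1.left x hx
  have h3 := h1.subset hy
  exact ⟨y, ⟨h3.1.2, h3.2.2⟩, ⟨_, h1.restrict h1.bot_mem hy h3.1, fun p hp => h2 p hp.1⟩,
    ⟨_, h1.restrict hy h1.top_mem h3.2, fun p hp => h2 p hp.1⟩⟩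

theorem exists_closed (h : Leash r F a b G c d) (hF : Continuous F) (hG : Continuous G) :
    ∃ R, IsClosed R ∧ IsMatching R a b c d ∧ ∀ p ∈ R, dist (F p.1) (G p.2) ≤ r := by
  obtain ⟨R, h1, h2⟩ := h
  refine ⟨_, isClosed_closure, h1.closure, ?_⟩
  have hcl : IsClosed {p : ℝ × ℝ | dist (F p.1) (G p.2) ≤ r} :=
    isClosed_le ((hF.comp continuous_fst).dist (hG.comp continuous_snd)) continuous_const
  exact fun p hp => closure_minimal (fun q hq => h2 q hq) hcl hp

theorem trans (h : Leash r F a b G c d) (h' : Leash r' G c d H e f) (hF : Continuous F)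
    (hG : Continuous G) (hH : Continuous H) : Leash (r + r') F a b H e f := by
  obtain ⟨R, h0, h1, h2⟩ := h.exists_closed hF hG
  obtain ⟨R', h0', h1', h2'⟩ := h'.exists_closed hG hH
  refine ⟨_, h1.comp h0 h1' h0', ?_⟩
  rintro ⟨x, z⟩ ⟨y, h3, h4, -⟩
  exact (dist_triangle _ (G y) _).trans (add_le_add (h2 _ h3) (h2' _ h4))

theorem const_right (hab : a ≤ b) (h : ∀ x ∈ Set.Icc a b, dist (F x) (G c) ≤ r) :
    Leash r F a b G c c := by
  refine ⟨_, IsMatching.graph (σ := fun _ => c) hab monotoneOn_const ?_, ?_⟩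
  · rw [Set.Nonempty.image_const (Set.nonempty_Icc.2 hab), Set.Icc_self]
  · rintro _ ⟨x, hx, rfl⟩
    exact h x hx

theorem const_left (hcd : c ≤ d) (h : ∀ y ∈ Set.Icc c d, dist (F a) (G y) ≤ r) :
    Leash r F a a G c d :=
  (const_right hcd fun x hx => by rw [dist_comm]; exact h x hx).symm

/-- Change of parameter by a monotone affine map. -/
theorem affine {k l : ℝ} (hk : 0 ≤ k) (hab : a ≤ b) (hr : 0 ≤ r)
    (hF : ∀ x ∈ Set.Icc a b, F x = G (k * x + l)) :
    Leash r F a b G (k * a + l) (k * b + l) := by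
  have hmono : Monotone fun x => k * x + l := fun x y hxy => by
    have := mul_le_mul_of_nonneg_left hxy hk
    dsimp only
    linarith
  refine ⟨_, IsMatching.graph (σ := fun x => k * x + l) hab (hmono.monotoneOn _) ?_, ?_⟩
  · refine Set.Subset.antisymm ?_ ?_
    · rintro _ ⟨x, hx, rfl⟩
      exact ⟨hmono hx.1, hmono hx.2⟩
    · exact intermediate_value_Icc (f := fun x => k * x + l) hab (by fun_prop)
  · rintro _ ⟨x, hx, rfl⟩
    simpa [hF x hx] using hr

theorem reparam_left {F' : ℝ → E} {a' b' k l : ℝ} (h : Leash r F a b G c d) (hk : 0 ≤ k)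
    (hab : a' ≤ b') (hF' : ∀ x, F' x = F (k * x + l)) (ha : k * a' + l = a)
    (hb : k * b' + l = b) (hF : Continuous F) (hG : Continuous G) : Leash r F' a' b' G c d := by
  have h1 : Leash 0 F' a' b' F (k * a' + l) (k * b' + l) :=
    affine hk hab le_rfl fun x _ => hF' x
  rw [ha, hb] at h1
  have hc : Continuous F' := by
    rw [funext hF']
    fun_prop
  simpa using h1.trans h hc hF hG

theorem reparam_left_iff {F' : ℝ → E} {a' b' k l : ℝ} (hk : 0 ≤ k)
    (hab : a' ≤ b') (hF' : ∀ x, F' x = F (k * x + l)) (ha : k * a' + l = a)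
    (hb : k * b' + l = b) (hF : Continuous F) (hG : Continuous G) :
    Leash r F' a' b' G c d ↔ Leash r F a b G c d := by
  refine ⟨fun h => ?_, fun h => h.reparam_left hk hab hF' ha hb hF hG⟩
  have h1 : Leash 0 F' a' b' F (k * a' + l) (k * b' + l) :=
    affine hk hab le_rfl fun x _ => hF' x
  rw [ha, hb] at h1
  have hc : Continuous F' := by
    rw [funext hF']
    fun_prop
  simpa using h1.symm.trans h hF hc hG

end Leash

end Leash

/-! ### Attainment of the Fréchet distance by a matching. -/

section Frechet

open Filter Topology

/-- Matchings `R n` for `r + 1 / (n + 1)` have a limit: the set of all limits, along a nonprincipal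
ultrafilter, of sequences with `q n ∈ R n`. Compactness provides the limits, and since an
ultrafilter decides between `q n ≤ q' n` and `q' n ≤ q n`, the limits form a chain. -/
theorem Leash.of_forall_pos {E : Type*} [PseudoMetricSpace E] {r a b c d : ℝ} {F G : ℝ → E}
    (hF : Continuous F) (hG : Continuous G) (h : ∀ ε > 0, Leash (r + ε) F a b G c d) :
    Leash r F a b G c d := by
  have h0 := fun n : ℕ => h (1 / ((n : ℝ) + 1)) (by positivity)
  choose R hR hRd using h0
  let U : Filter ℕ := hyperfilter ℕ
  have hlim : Tendsto (fun n : ℕ => r + 1 / ((n : ℝ) + 1)) U (𝓝 r) := by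
    have h1 : Tendsto (fun n : ℕ => 1 / ((n : ℝ) + 1)) atTop (𝓝 0) :=
      tendsto_one_div_add_atTop_nhds_zero_nat
    have h2 := (tendsto_const_nhds (x := r)).add (h1.mono_left (Nat.hyperfilter_le_atTop))
    simpa using h2
  have hcomp : ∀ q : ℕ → ℝ × ℝ, (∀ n, q n ∈ R n) → ∃ p, Tendsto q U (𝓝 p) := by
    intro q hq
    have h1 : ((hyperfilter ℕ).map q : Filter (ℝ × ℝ)) ≤ 𝓟 (Set.Icc (a, c) (b, d)) := by
      rw [le_principal_iff]
      exact mem_map.2 (univ_mem' fun n => (hR n).subset (hq n))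
    obtain ⟨p, -, hp⟩ := isCompact_Icc.ultrafilter_le_nhds _ h1
    exact ⟨p, hp⟩
  refine ⟨{p | ∃ q : ℕ → ℝ × ℝ, (∀ n, q n ∈ R n) ∧ Tendsto q U (𝓝 p)},
    ⟨(hR 0).le_left, (hR 0).le_right, ?_, ?_, ?_, ?_⟩, ?_⟩
  · rintro p ⟨q, hq, hqp⟩
    exact isClosed_Icc.mem_of_tendsto hqp (Eventually.of_forall fun n => (hR n).subset (hq n))
  · rintro p ⟨q, hq, hqp⟩ p' ⟨q', hq', hqp'⟩
    have h1 : ∀ᶠ n in U, q n ≤ q' n ∨ q' n ≤ q n :=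
      Eventually.of_forall fun n => (hR n).chain _ (hq n) _ (hq' n)
    exact (Ultrafilter.eventually_or.1 h1).imp (fun h2 => le_of_tendsto_of_tendsto hqp hqp' h2)
      fun h2 => le_of_tendsto_of_tendsto hqp' hqp h2
  · intro x hx
    choose y hy using fun n => (hR n).left x hx
    obtain ⟨p, hp⟩ := hcomp _ hy
    have h1 : p.1 = x :=
      tendsto_nhds_unique (continuous_fst.continuousAt.tendsto.comp hp) tendsto_const_nhds
    exact ⟨p.2, _, hy, by rwa [show (x, p.2) = p from Prod.ext h1.symm rfl]⟩
  · intro x hx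
    choose y hy using fun n => (hR n).right x hx
    obtain ⟨p, hp⟩ := hcomp _ hy
    have h1 : p.2 = x :=
      tendsto_nhds_unique (continuous_snd.continuousAt.tendsto.comp hp) tendsto_const_nhds
    exact ⟨p.1, _, hy, by rwa [show (p.1, x) = p from Prod.ext rfl h1.symm]⟩
  · rintro p ⟨q, hq, hqp⟩
    have hc : Continuous fun p : ℝ × ℝ => dist (F p.1) (G p.2) :=
      (hF.comp continuous_fst).dist (hG.comp continuous_snd)
    exact le_of_tendsto_of_tendsto (hc.continuousAt.tendsto.comp hqp) hlim
      (Eventually.of_forall fun n => hRd n _ (hq n))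

theorem IsReparam.isMatching {α β : unitInterval → unitInterval} (hα : IsReparam α)
    (hβ : IsReparam β) :
    IsMatching (Set.range fun t => ((α t : ℝ), (β t : ℝ))) 0 1 0 1 where
  le_left := zero_le_one
  le_right := zero_le_one
  subset := by
    rintro _ ⟨t, rfl⟩
    exact ⟨⟨(α t).2.1, (β t).2.1⟩, (α t).2.2, (β t).2.2⟩
  chain := by
    rintro _ ⟨t, rfl⟩ _ ⟨t', rfl⟩
    exact (le_total t t').imp (fun h => ⟨hα.1 h, hβ.1 h⟩) fun h => ⟨hα.1 h, hβ.1 h⟩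
  left := by
    intro x hx
    obtain ⟨t, ht⟩ := hα.2.1 ⟨x, hx⟩
    exact ⟨β t, t, by simp [ht]⟩
  right := by
    intro x hx
    obtain ⟨t, ht⟩ := hβ.2.1 ⟨x, hx⟩
    exact ⟨α t, t, by simp [ht]⟩

/-- A closed matching of the unit interval with itself is traversed by its coordinate sum. -/
theorem IsMatching.exists_isReparam {R : Set (ℝ × ℝ)} (h : IsMatching R 0 1 0 1)
    (hR : IsClosed R) : ∃ α β : unitInterval → unitInterval, IsReparam α ∧ IsReparam β ∧
      ∀ t, ((α t : ℝ), (β t : ℝ)) ∈ R := by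
  have h1 : ∀ t : unitInterval, ∃ p ∈ R, p.1 + p.2 = 2 * (t : ℝ) := fun t =>
    h.exists_add_eq hR ⟨by linarith [t.2.1], by linarith [t.2.2]⟩
  choose p hp hps using h1
  have hmono : Monotone p := fun t t' htt' => h.le_of_add_le (hp t) (hp t') (by
    have : (t : ℝ) ≤ t' := htt'
    rw [hps, hps]
    linarith)
  -- Both coordinates are monotone with sum `2 t`, so neither grows faster than `2 t`; this yields
  -- continuity of the reparametrizations.
  have hlip : ∀ t t', t ≤ t' → (p t').1 - (p t).1 ≤ 2 * ((t' : ℝ) - t) ∧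
      (p t').2 - (p t).2 ≤ 2 * ((t' : ℝ) - t) := by
    intro t t' htt'
    have h2 := hmono htt'
    have := h2.1; have := h2.2; have := hps t; have := hps t'
    constructor <;> linarith
  have huniq : ∀ q ∈ R, ∃ t, p t = q := by
    intro q hq
    have h2 := h.subset hq
    have e1 := h2.1.1; have e2 := h2.1.2; have e3 := h2.2.1; have e4 := h2.2.2
    dsimp only at e1 e2 e3 e4
    let t : unitInterval := ⟨(q.1 + q.2) / 2, by constructor <;> linarith⟩
    have ht : (p t).1 + (p t).2 = q.1 + q.2 := by
      rw [hps]
      change 2 * ((q.1 + q.2) / 2) = _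
      ring
    exact ⟨t, le_antisymm (h.le_of_add_le (hp t) hq ht.le) (h.le_of_add_le hq (hp t) ht.ge)⟩
  have hmem : ∀ t, (p t).1 ∈ Set.Icc (0 : ℝ) 1 ∧ (p t).2 ∈ Set.Icc (0 : ℝ) 1 := fun t =>
    let h2 := h.subset (hp t)
    ⟨⟨h2.1.1, h2.2.1⟩, h2.1.2, h2.2.2⟩
  have hcont : ∀ f : unitInterval → ℝ, (∀ t t', t ≤ t' → f t ≤ f t' ∧
      f t' - f t ≤ 2 * ((t' : ℝ) - t)) → Continuous f := by
    intro f hf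
    refine (LipschitzWith.of_dist_le_mul (K := 2) fun t t' => ?_).continuous
    rw [Subtype.dist_eq, Real.dist_eq, Real.dist_eq, NNReal.coe_ofNat]
    rcases le_total t t' with htt | htt
    · have h2 := hf t t' htt
      have h3 : (t : ℝ) ≤ t' := htt
      rw [abs_sub_comm, abs_sub_comm (t : ℝ), abs_of_nonneg (sub_nonneg.2 h2.1),
        abs_of_nonneg (sub_nonneg.2 h3)]
      exact h2.2
    · have h2 := hf t' t htt
      have h3 : (t' : ℝ) ≤ t := htt
      rw [abs_of_nonneg (sub_nonneg.2 h2.1), abs_of_nonneg (sub_nonneg.2 h3)]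
      exact h2.2
  refine ⟨fun t => ⟨(p t).1, (hmem t).1⟩, fun t => ⟨(p t).2, (hmem t).2⟩,
    ⟨fun t t' htt => (hmono htt).1, fun x => ?_, ?_⟩,
    ⟨fun t t' htt => (hmono htt).2, fun x => ?_, ?_⟩, hp⟩
  · obtain ⟨y, hy⟩ := h.left x x.2
    obtain ⟨t, ht⟩ := huniq _ hy
    exact ⟨t, Subtype.ext (by simp [ht])⟩
  · exact Continuous.subtype_mk
      (hcont _ fun t t' htt => ⟨(hmono htt).1, (hlip t t' htt).1⟩) _
  · obtain ⟨y, hy⟩ := h.right x x.2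
    obtain ⟨t, ht⟩ := huniq _ hy
    exact ⟨t, Subtype.ext (by simp [ht])⟩
  · exact Continuous.subtype_mk
      (hcont _ fun t t' htt => ⟨(hmono htt).2, (hlip t t' htt).2⟩) _

/-- Near-optimal reparametrizations trace matchings for every `r + ε`, and these have a limit.
Conversely, a closed matching is traversed by its coordinate sum. -/
theorem frechetDist_le_iff {d : ℕ} {F G : ℝ → Pt d} (hF : Continuous F) (hG : Continuous G)
    {r : ℝ} (hr : 0 ≤ r) :
    frechetDist (fun t => F (t : ℝ)) (fun t => G (t : ℝ)) ≤ ENNReal.ofReal r ↔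
      Leash r F 0 1 G 0 1 := by
  constructor
  · intro h
    refine Leash.of_forall_pos hF hG fun ε hε => ?_
    have h1 : frechetDist (fun t => F (t : ℝ)) (fun t => G (t : ℝ)) <
        ENNReal.ofReal (r + ε) :=
      h.trans_lt ((ENNReal.ofReal_lt_ofReal_iff (by linarith)).2 (by linarith))
    unfold frechetDist at h1
    simp only [iInf_lt_iff] at h1
    obtain ⟨α, β, ⟨hα, hβ⟩, h2⟩ := h1
    refine ⟨_, hα.isMatching hβ, ?_⟩
    rintro _ ⟨t, rfl⟩
    have h3 := (le_iSup (fun t => edist (F (α t)) (G (β t))) t).trans h2.le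
    rwa [edist_dist, ENNReal.ofReal_le_ofReal_iff (by linarith)] at h3
  · intro h
    obtain ⟨R, hR, h1, h2⟩ := h.exists_closed hF hG
    obtain ⟨α, β, hα, hβ, h3⟩ := h1.exists_isReparam hR
    have h4 : ⨆ t : unitInterval, edist (F (α t)) (G (β t)) ≤ ENNReal.ofReal r := by
      refine iSup_le fun t => ?_
      rw [edist_dist]
      exact ENNReal.ofReal_le_ofReal (h2 (α t, β t) (h3 t))
    unfold frechetDist
    exact iInf_le_of_le α (iInf_le_of_le β (iInf_le_of_le ⟨hα, hβ⟩ h4))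

theorem PolyCurve.continuous_eval {d m : ℕ} (P : PolyCurve d m) : Continuous P.eval := by
  unfold PolyCurve.eval
  fun_prop

theorem PolyCurve.pos {d m : ℕ} (P : PolyCurve d m) : 0 < m := by
  rcases Nat.eq_zero_or_pos m with rfl | h
  · have h1 := P.param_zero
    have h2 := P.param_last
    rw [show Fin.last 0 = 0 from rfl, h1] at h2
    exact absurd h2 zero_ne_one
  · exact h

theorem PolyCurve.param_lt {d m : ℕ} (P : PolyCurve d m) (i : Fin m) :
    P.param i.castSucc < P.param i.succ :=
  P.param_strictMono Fin.castSucc_lt_succ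

theorem PolyCurve.param_mem {d m : ℕ} (P : PolyCurve d m) (i : Fin (m + 1)) :
    P.param i ∈ Set.Icc (0 : ℝ) 1 := by
  rw [← P.param_zero, ← P.param_last]
  exact ⟨P.param_strictMono.monotone (Fin.zero_le _), P.param_strictMono.monotone (Fin.le_last _)⟩

theorem PolyCurve.eval_param {d m : ℕ} (P : PolyCurve d m) (i : Fin (m + 1)) :
    P.eval (P.param i) = P.vertex i := by
  refine Fin.lastCases ?_ (fun j => ?_) i
  · obtain ⟨n, rfl⟩ := Nat.exists_eq_succ_of_ne_zero P.pos.ne'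
    have h := P.param_lt (Fin.last n)
    rw [← Fin.succ_last, P.eval_eq_lineMap (Fin.last n) ⟨h.le, le_rfl⟩,
      div_self (sub_pos.2 h).ne', AffineMap.lineMap_apply_one]
  · have h := P.param_lt j
    rw [P.eval_eq_lineMap j ⟨le_rfl, h.le⟩, sub_self, zero_div, AffineMap.lineMap_apply_zero]

/-- The line through the two points of `q`. -/
noncomputable def line {d : ℕ} (q : Pt d × Pt d) (t : ℝ) : Pt d := AffineMap.lineMap q.1 q.2 t

theorem continuous_line {d : ℕ} (q : Pt d × Pt d) : Continuous (line q) :=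
  AffineMap.lineMap_continuous

/-- The Fréchet distance of a subcurve and an edge. -/
theorem frechetDist_sub_le_iff {d m : ℕ} (P : PolyCurve d m) {a b r : ℝ} (hab : a ≤ b)
    (q : Pt d × Pt d) (hr : 0 ≤ r) :
    frechetDist (P.sub a b) (edgeCurve q) ≤ ENNReal.ofReal r ↔
      Leash r P.eval a b (line q) 0 1 := by
  have hc : Continuous fun t : ℝ => P.eval ((1 - t) * a + t * b) :=
    P.continuous_eval.comp (by fun_prop)
  have h1 := frechetDist_le_iff hc (continuous_line q) hr
  have h2 : Leash r (fun t : ℝ => P.eval ((1 - t) * a + t * b)) 0 1 (line q) 0 1 ↔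
      Leash r P.eval a b (line q) 0 1 :=
    Leash.reparam_left_iff (k := b - a) (l := a) (sub_nonneg.2 hab) zero_le_one
      (fun x => by ring_nf) (by ring) (by ring) P.continuous_eval (continuous_line q)
  exact h1.trans h2

end Frechet

/-! Critical parameters of the free space of two segments. -/

section Critical

open scoped RealInnerProductSpace

variable {E : Type*} [NormedAddCommGroup E] [InnerProductSpace ℝ E]

/-- The positive part, as an expression without case distinctions. -/
noncomputable def posPart (x : ℝ) : ℝ := (x + √(x * x)) / 2

theorem posPart_eq_max (x : ℝ) : posPart x = max x 0 := by
  rw [posPart, Real.sqrt_mul_self_eq_abs]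
  rcases le_total 0 x with h | h
  · rw [abs_of_nonneg h, max_eq_left h]
    ring
  · rw [abs_of_nonpos h, max_eq_right h]
    ring

/-- The projection to the unit interval. -/
noncomputable def clamp (x : ℝ) : ℝ := posPart x - posPart (x - 1)

theorem clamp_mem (x : ℝ) : clamp x ∈ Set.Icc (0 : ℝ) 1 := by
  rw [clamp, posPart_eq_max, posPart_eq_max]
  rcases le_total x 0 with h | h <;> rcases le_total x 1 with h' | h' <;>
    simp [h, h']
  linarith

theorem clamp_of_mem {x : ℝ} (h : x ∈ Set.Icc (0 : ℝ) 1) : clamp x = x := by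
  rw [clamp, posPart_eq_max, posPart_eq_max, max_eq_left h.1,
    max_eq_right (sub_nonpos.2 h.2), sub_zero]

/-- The solutions of `a x² + 2 b x + c = 0`, with sign `e`. -/
noncomputable def quadRoot (e a b c : ℝ) : ℝ := (e * √(posPart (b * b - a * c)) - b) / a

/-- At a solution the discriminant equals `(a x + b)²`, so taking its positive part changes nothing;
the positive part only keeps the root legal when there is no solution. -/
theorem eq_quadRoot {a b c x : ℝ} (ha : a ≠ 0) (h : a * x ^ 2 + 2 * b * x + c = 0) :
    x = quadRoot 1 a b c ∨ x = quadRoot (-1) a b c := by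
  have h1 : b * b - a * c = (a * x + b) ^ 2 := by linear_combination (-a) * h
  unfold quadRoot
  rw [h1, posPart_eq_max, max_eq_left (sq_nonneg _), Real.sqrt_sq_eq_abs]
  rcases abs_choice (a * x + b) with h2 | h2
  · left
    rw [h2]
    field_simp
    ring
  · right
    rw [h2]
    field_simp
    ring

/-- The parameters at which the line `s ↦ u + s v` meets the sphere of radius `√ρ`. -/
noncomputable def vertexCrit (e ρ : ℝ) (u v : E) : ℝ :=
  if ⟪v, v⟫ = 0 then 0 else clamp (quadRoot e ⟪v, v⟫ ⟪u, v⟫ (⟪u, u⟫ - ρ))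

/-- The Gram determinant. -/
noncomputable def gram (v w : E) : ℝ := ⟪v, v⟫ * ⟪w, w⟫ - ⟪v, w⟫ * ⟪v, w⟫

/-- The parameters of the points on the line `s ↦ u + s v` that have distance `√ρ` from the line
`x ↦ x w`, where the connecting segment is perpendicular to `v`. -/
noncomputable def edgeCrit (e ρ : ℝ) (u v w : E) : ℝ :=
  if ⟪v, v⟫ * gram v w = 0 then 0 else
    clamp ((quadRoot e (gram v w) (⟪v, w⟫ * ⟪u, v⟫ - ⟪v, v⟫ * ⟪u, w⟫)
      (⟪v, v⟫ * ⟪u, u⟫ - ⟪u, v⟫ * ⟪u, v⟫ - ⟪v, v⟫ * ρ) * ⟪v, w⟫ - ⟪u, v⟫) / ⟪v, v⟫)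

/-- The squared norm is a quadratic polynomial in `s`, and `clamp` fixes `s` because it lies in the
unit interval. -/
theorem eq_vertexCrit {ρ s : ℝ} {u v : E} (hs : s ∈ Set.Icc (0 : ℝ) 1) (hv : v ≠ 0)
    (h : ‖u + s • v‖ ^ 2 = ρ) : s = vertexCrit 1 ρ u v ∨ s = vertexCrit (-1) ρ u v := by
  have ha : ⟪v, v⟫ ≠ 0 := inner_self_ne_zero.2 hv
  have h1 : ⟪v, v⟫ * s ^ 2 + 2 * ⟪u, v⟫ * s + (⟪u, u⟫ - ρ) = 0 := by
    rw [← h, ← real_inner_self_eq_norm_sq]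
    simp only [inner_add_left, inner_add_right, real_inner_smul_left, real_inner_smul_right,
      real_inner_comm u v]
    ring
  unfold vertexCrit
  rw [if_neg ha, if_neg ha]
  rcases eq_quadRoot ha h1 with h2 | h2
  · left
    rw [← h2, clamp_of_mem hs]
  · right
    rw [← h2, clamp_of_mem hs]

/-- Perpendicularity expresses `s` linearly in `x`. Eliminating `s` from the norm equation leaves a
quadratic in `x` with the Gram determinant as leading coefficient; `x` is solved for first and `s`
recovered from it. -/
theorem eq_edgeCrit {ρ s x : ℝ} {u v w : E} (hs : s ∈ Set.Icc (0 : ℝ) 1) (hg : gram v w ≠ 0)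
    (h : ‖u + s • v - x • w‖ ^ 2 = ρ) (hperp : ⟪v, u + s • v - x • w⟫ = 0) :
    s = edgeCrit 1 ρ u v w ∨ s = edgeCrit (-1) ρ u v w := by
  have hv : v ≠ 0 := by
    rintro rfl
    simp [gram] at hg
  have ha : ⟪v, v⟫ ≠ 0 := inner_self_ne_zero.2 hv
  have hs1 : ⟪v, v⟫ * s = x * ⟪v, w⟫ - ⟪u, v⟫ := by
    simp only [inner_add_right, inner_sub_right, real_inner_smul_right,
      real_inner_comm u v] at hperp
    linarith
  have hs2 : s = (x * ⟪v, w⟫ - ⟪u, v⟫) / ⟪v, v⟫ := by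
    rw [← hs1]
    field_simp
  have h1 : gram v w * x ^ 2 + 2 * (⟪v, w⟫ * ⟪u, v⟫ - ⟪v, v⟫ * ⟪u, w⟫) * x +
      (⟪v, v⟫ * ⟪u, u⟫ - ⟪u, v⟫ * ⟪u, v⟫ - ⟪v, v⟫ * ρ) = 0 := by
    rw [← h, ← real_inner_self_eq_norm_sq]
    simp only [gram, inner_add_left, inner_add_right, inner_sub_left, inner_sub_right,
      real_inner_smul_left, real_inner_smul_right, real_inner_comm u v, real_inner_comm u w,
      real_inner_comm v w]
    linear_combination (-⟪v, v⟫ * s - ⟪u, v⟫ + x * ⟪v, w⟫) * hs1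
  have hne : ⟪v, v⟫ * gram v w ≠ 0 := mul_ne_zero ha hg
  unfold edgeCrit
  rw [if_neg hne, if_neg hne]
  rcases eq_quadRoot hg h1 with h2 | h2
  · left
    rw [← h2, ← hs2, clamp_of_mem hs]
  · right
    rw [← h2, ← hs2, clamp_of_mem hs]

theorem vertexCrit_mem (e ρ : ℝ) (u v : E) : vertexCrit e ρ u v ∈ Set.Icc (0 : ℝ) 1 := by
  unfold vertexCrit
  split_ifs
  · exact ⟨le_rfl, zero_le_one⟩
  · exact clamp_mem _

theorem edgeCrit_mem (e ρ : ℝ) (u v w : E) : edgeCrit e ρ u v w ∈ Set.Icc (0 : ℝ) 1 := by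
  unfold edgeCrit
  split_ifs
  · exact ⟨le_rfl, zero_le_one⟩
  · exact clamp_mem _

/-- The equality case of Cauchy–Schwarz: the difference of `w` and its projection to `v` has norm
zero. -/
theorem exists_smul_eq_of_gram_eq_zero {v w : E} (hv : v ≠ 0) (h : gram v w = 0) :
    ∃ l : ℝ, w = l • v := by
  have ha : ⟪v, v⟫ ≠ 0 := inner_self_ne_zero.2 hv
  refine ⟨⟪v, w⟫ / ⟪v, v⟫, ?_⟩
  rw [← sub_eq_zero, ← inner_self_eq_zero (𝕜 := ℝ)]
  simp only [inner_sub_left, inner_sub_right, real_inner_smul_left, real_inner_smul_right,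
    real_inner_comm v w]
  unfold gram at h
  field_simp
  linear_combination h

variable {u v w : E} {r c₁ c₂ : ℝ}

/-- Between critical parameters, a point of the line is either always or never close to `0`. -/
theorem norm_le_of_no_vertexCrit
    (hvert : ∀ s ∈ Set.Ioo c₁ c₂, ‖u + s • v‖ = r → v = 0) {s₀ : ℝ} (hs₀ : s₀ ∈ Set.Ioo c₁ c₂)
    (h₀ : ‖u + s₀ • v‖ ≤ r) {s : ℝ} (hs : s ∈ Set.Icc c₁ c₂) : ‖u + s • v‖ ≤ r := by
  rcases eq_or_ne v 0 with rfl | hv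
  · simpa using h₀
  have hc : Continuous fun s : ℝ => ‖u + s • v‖ := by fun_prop
  have hint : ∀ s ∈ Set.Ioo c₁ c₂, ‖u + s • v‖ ≤ r := by
    intro s hs
    by_contra! h1
    have h2 := intermediate_value_uIcc (a := s₀) (b := s) hc.continuousOn
    obtain ⟨t, ht, ht'⟩ := h2 (Set.mem_uIcc.2 (Or.inl ⟨h₀, h1.le⟩))
    exact hv (hvert t (Set.ordConnected_Ioo.uIcc_subset hs₀ hs ht) ht')
  have h2 : closure (Set.Ioo c₁ c₂) ⊆ {s : ℝ | ‖u + s • v‖ ≤ r} :=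
    closure_minimal hint (isClosed_le hc continuous_const)
  rw [closure_Ioo (hs₀.1.trans hs₀.2).ne] at h2
  exact h2 hs

/-- A smallest free parameter on the line `x ↦ x w` is attained at critical parameters. -/
theorem exists_free_le
    (hvert : ∀ s ∈ Set.Ioo c₁ c₂, ‖u + s • v‖ = r → v = 0)
    (hedge : ∀ s ∈ Set.Ioo c₁ c₂, ∀ x : ℝ, ‖u + s • v - x • w‖ = r →
      ⟪v, u + s • v - x • w⟫ = 0 → gram v w = 0)
    {s₀ x₀ : ℝ} (hs₀ : s₀ ∈ Set.Icc c₁ c₂) (hx₀ : 0 ≤ x₀) (h₀ : ‖u + s₀ • v - x₀ • w‖ ≤ r) :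
    ∃ x ∈ Set.Icc 0 x₀, ‖u + c₁ • v - x • w‖ ≤ r ∨ ‖u + c₂ • v - x • w‖ ≤ r := by
  have hcont : Continuous fun p : ℝ × ℝ => ‖u + p.1 • v - p.2 • w‖ := by fun_prop
  have hK : IsCompact (Set.Icc (c₁, (0 : ℝ)) (c₂, x₀) ∩ {p | ‖u + p.1 • v - p.2 • w‖ ≤ r}) :=
    isCompact_Icc.inter_right (isClosed_le hcont continuous_const)
  -- A free point with the smallest `x`. If its `s` is strictly between `c₁` and `c₂`, then `x = 0`
  -- and `v = 0` are harmless and everything else is contradictory.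
  obtain ⟨⟨s, x⟩, ⟨hsx, hfree⟩, hmin⟩ := hK.exists_isMinOn
    ⟨(s₀, x₀), ⟨⟨hs₀.1, hx₀⟩, hs₀.2, le_rfl⟩, h₀⟩ continuous_snd.continuousOn
  have hmin' : ∀ s' x', s' ∈ Set.Icc c₁ c₂ → 0 ≤ x' → ‖u + s' • v - x' • w‖ ≤ r → x ≤ x' := by
    intro s' x' hs' hx' h1
    rcases le_total x' x₀ with h2 | h2
    · exact hmin (show (s', x') ∈ _ from ⟨⟨⟨hs'.1, hx'⟩, hs'.2, h2⟩, h1⟩)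
    · exact hsx.2.2.trans h2
  have hs : s ∈ Set.Icc c₁ c₂ := ⟨hsx.1.1, hsx.2.1⟩
  have hx0 : 0 ≤ x := hsx.1.2
  have hxx : x ≤ x₀ := hsx.2.2
  replace hfree : ‖u + s • v - x • w‖ ≤ r := hfree
  rcases hs.1.eq_or_lt with rfl | hs1
  · exact ⟨x, ⟨hx0, hxx⟩, Or.inl hfree⟩
  rcases hs.2.eq_or_lt with rfl | hs2
  · exact ⟨x, ⟨hx0, hxx⟩, Or.inr hfree⟩
  have hsI : s ∈ Set.Ioo c₁ c₂ := ⟨hs1, hs2⟩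
  rcases hx0.eq_or_lt with rfl | hx0'
  · refine ⟨0, ⟨le_rfl, hxx⟩, Or.inl ?_⟩
    rw [zero_smul, sub_zero] at hfree ⊢
    exact norm_le_of_no_vertexCrit hvert hsI hfree ⟨le_rfl, hs.1.trans hs.2⟩
  by_cases hv : v = 0
  · refine ⟨x, ⟨hx0, hxx⟩, Or.inl ?_⟩
    simpa [hv] using hfree
  exfalso
  -- on the horizontal line through the minimum, the distance is at least `r`
  have hge : ∀ s' ∈ Set.Icc c₁ c₂, r ≤ ‖u + s' • v - x • w‖ := by
    intro s' hs'
    have hc : Continuous fun x' : ℝ => ‖u + s' • v - x' • w‖ := by fun_prop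
    have h2 : closure (Set.Ioo 0 x) ⊆ {x' : ℝ | r ≤ ‖u + s' • v - x' • w‖} :=
      closure_minimal (fun x' hx' => by
        by_contra! h3
        exact absurd (hmin' s' x' hs' hx'.1.le (le_of_not_ge h3)) (not_le.2 hx'.2))
        (isClosed_le continuous_const hc)
    rw [closure_Ioo hx0'.ne] at h2
    exact h2 ⟨hx0, le_rfl⟩
  have heq : ‖u + s • v - x • w‖ = r := le_antisymm hfree (hge s hs)
  have hr : 0 ≤ r := heq ▸ norm_nonneg _
  -- The parameter `s` minimizes the distance along this line, so the derivative in the direction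
  -- `v` vanishes.
  have hperp : ⟪v, u + s • v - x • w⟫ = 0 := by
    set z := u + s • v - x • w with hz
    have hexp : ∀ h : ℝ, ‖u + (s + h) • v - x • w‖ ^ 2 = r ^ 2 + 2 * h * ⟪v, z⟫ + h ^ 2 * ⟪v, v⟫ := by
      intro h
      rw [show u + (s + h) • v - x • w = z + h • v by rw [hz, add_smul]; abel, norm_add_sq_real,
        heq, real_inner_smul_right, norm_smul, mul_pow, ← real_inner_self_eq_norm_sq v,
        real_inner_comm z v, Real.norm_eq_abs, sq_abs]
      ring
    have hder : HasDerivAt (fun h : ℝ => r ^ 2 + 2 * h * ⟪v, z⟫ + h ^ 2 * ⟪v, v⟫) (2 * ⟪v, z⟫) 0 := by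
      have h1 := ((hasDerivAt_id (0 : ℝ)).const_mul 2).mul_const ⟪v, z⟫
      have h2 := (hasDerivAt_pow 2 (0 : ℝ)).mul_const ⟪v, v⟫
      have h3 := (h1.const_add (r ^ 2)).add h2
      refine h3.congr_deriv ?_
      simp
    have hloc : IsLocalMin (fun h : ℝ => r ^ 2 + 2 * h * ⟪v, z⟫ + h ^ 2 * ⟪v, v⟫) 0 := by
      have h1 : ∀ᶠ h in nhds (0 : ℝ), s + h ∈ Set.Ioo c₁ c₂ := by
        have h2 : Continuous fun h : ℝ => s + h := by fun_prop
        exact h2.continuousAt.eventually_mem (isOpen_Ioo.mem_nhds (by simpa using hsI))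
      filter_upwards [h1] with h hh
      have h2 := hge _ ⟨hh.1.le, hh.2.le⟩
      have h3 : r ^ 2 ≤ ‖u + (s + h) • v - x • w‖ ^ 2 := by gcongr
      rw [hexp] at h3
      simpa using h3
    have := hloc.hasDerivAt_eq_zero hder
    linarith
  -- Only parallel directions remain. Then `(s - l h, x - h)` has the same distance as `(s, x)` and
  -- a smaller second coordinate.
  obtain ⟨l, rfl⟩ := exists_smul_eq_of_gram_eq_zero hv (hedge s hsI x heq hperp)
  have h1 : ∀ᶠ h in nhdsWithin (0 : ℝ) (Set.Ioi 0), s - l * h ∈ Set.Ioo c₁ c₂ ∧ h < x := by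
    have h2 : Continuous fun h : ℝ => s - l * h := by fun_prop
    exact nhdsWithin_le_nhds ((h2.continuousAt.eventually_mem (isOpen_Ioo.mem_nhds
      (by simpa using hsI))).and (gt_mem_nhds hx0'))
  obtain ⟨h, ⟨hh1, hh2⟩, hh3⟩ := (h1.and self_mem_nhdsWithin).exists
  have hh3 : 0 < h := hh3
  have h3 : ‖u + (s - l * h) • v - (x - h) • l • v‖ ≤ r := by
    rw [← heq]
    apply le_of_eq
    congr 1
    module
  have := hmin' _ _ ⟨hh1.1.le, hh1.2.le⟩ (sub_nonneg.2 hh2.le) h3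
  linarith

end Critical

/-! Moving the ends of a matched subsegment to critical parameters. -/

section Rounding

variable {E : Type*} [PseudoMetricSpace E]

/-- Both intervals are traversed proportionally. The matching is an image of the unit interval and
not a graph, so that either interval may be a single point. -/
theorem Leash.segment {r a b c d : ℝ} {F G : ℝ → E} (hab : a ≤ b) (hcd : c ≤ d)
    (h : ∀ l ∈ Set.Icc (0 : ℝ) 1, dist (F (a + l * (b - a))) (G (c + l * (d - c))) ≤ r) :
    Leash r F a b G c d := by
  have h0 : (0 : ℝ) ≤ 1 := zero_le_one
  have aux : ∀ {s t x : ℝ}, s ≤ t → x ∈ Set.Icc s t →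
      ∃ l ∈ Set.Icc (0 : ℝ) 1, s + l * (t - s) = x := by
    intro s t x hst hx
    have h1 := intermediate_value_Icc (f := fun l => s + l * (t - s)) h0 (by fun_prop)
    simpa using h1 (by simpa using hx)
  have mono : ∀ {s t l l' : ℝ}, s ≤ t → l ≤ l' → s + l * (t - s) ≤ s + l' * (t - s) := by
    intro s t l l' hst hl
    have := mul_le_mul_of_nonneg_right hl (sub_nonneg.2 hst)
    linarith
  refine ⟨(fun l => (a + l * (b - a), c + l * (d - c))) '' Set.Icc 0 1,
    ⟨hab, hcd, ?_, ?_, ?_, ?_⟩, ?_⟩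
  · rintro _ ⟨l, hl, rfl⟩
    have e1 := mono hab hl.1
    have e2 := mono hab hl.2
    have e3 := mono hcd hl.1
    have e4 := mono hcd hl.2
    refine ⟨⟨?_, ?_⟩, ?_, ?_⟩ <;> dsimp only <;> linarith
  · rintro _ ⟨l, hl, rfl⟩ _ ⟨l', hl', rfl⟩
    exact (le_total l l').imp (fun h => ⟨mono hab h, mono hcd h⟩)
      fun h => ⟨mono hab h, mono hcd h⟩
  · intro x hx
    obtain ⟨l, hl, rfl⟩ := aux hab hx
    exact ⟨_, l, hl, rfl⟩
  · intro x hx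
    obtain ⟨l, hl, rfl⟩ := aux hcd hx
    exact ⟨_, l, hl, rfl⟩
  · rintro _ ⟨l, hl, rfl⟩
    exact h l hl

/-- The free space of a curve `F` on `[A,B]` with breakpoints `T` and a line `G` is convex between
breakpoints. -/
structure CellConvex (r : ℝ) (F G : ℝ → E) (T : Set ℝ) (A B : ℝ) : Prop where
  finite : T.Finite
  convex : ∀ f ∈ Set.Icc A B, ∀ f' ∈ Set.Icc A B, f ≤ f' → (∀ t ∈ T, t ∉ Set.Ioo f f') →
    ∀ g g', dist (F f) (G g) ≤ r → dist (F f') (G g') ≤ r → ∀ l ∈ Set.Icc (0 : ℝ) 1,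
      dist (F (f + l * (f' - f))) (G (g + l * (g' - g))) ≤ r

/-- The free space does not change between `c₁` and `c₂` at any breakpoint. -/
def RowConst (r : ℝ) (F G : ℝ → E) (T : Set ℝ) (c₁ c₂ : ℝ) : Prop :=
  ∀ t ∈ T, ∀ g ∈ Set.Ioo c₁ c₂, dist (F t) (G g) ≤ r → ∀ g' ∈ Set.Icc c₁ c₂,
    dist (F t) (G g') ≤ r

variable {r A B c₁ c₂ d₁ d₂ x x' y y' s s' : ℝ} {F G : ℝ → E} {T : Set ℝ}

theorem CellConvex.neg (h : CellConvex r F G T A B) :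
    CellConvex r (fun x => F (-x)) (fun x => G (-x)) (Neg.neg ⁻¹' T) (-B) (-A) where
  finite := h.finite.preimage neg_injective.injOn
  convex := by
    intro f hf f' hf' hle hT g g' h1 h2 l hl
    have h3 := h.convex (-f') ⟨by linarith [hf'.2], by linarith [hf'.1]⟩ (-f)
      ⟨by linarith [hf.2], by linarith [hf.1]⟩ (by linarith)
      (fun t ht ht' => hT (-t) (by simpa using ht) ⟨by linarith [ht'.2], by linarith [ht'.1]⟩)
      (-g') (-g) h2 h1 (1 - l) ⟨by linarith [hl.2], by linarith [hl.1]⟩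
    convert h3 using 3 <;> ring

theorem RowConst.neg (h : RowConst r F G T c₁ c₂) :
    RowConst r (fun x => F (-x)) (fun x => G (-x)) (Neg.neg ⁻¹' T) (-c₂) (-c₁) :=
  fun t ht g hg h1 g' hg' => h (-t) ht (-g) ⟨by linarith [hg.2], by linarith [hg.1]⟩ h1 (-g')
    ⟨by linarith [hg'.2], by linarith [hg'.1]⟩

/-- A column of the free space is free if its ends and all breakpoints are. -/
theorem CellConvex.column (h : CellConvex r F G T A B) {c : ℝ} (hA : A ≤ y) (hB : x ≤ B)
    (hy : dist (F y) (G c) ≤ r) (hx : dist (F x) (G c) ≤ r)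
    (hT : ∀ t ∈ T, t ∈ Set.Ioo y x → dist (F t) (G c) ≤ r) {z : ℝ} (hz : z ∈ Set.Icc y x) :
    dist (F z) (G c) ≤ r := by
  have hyx := hz.1.trans hz.2
  have hT' : ∀ t ∈ T, t ∈ Set.Icc y x → dist (F t) (G c) ≤ r := by
    intro t ht ht'
    rcases ht'.1.eq_or_lt with rfl | h1
    · exact hy
    rcases ht'.2.eq_or_lt with rfl | h2
    · exact hx
    exact hT t ht ⟨h1, h2⟩
  -- `p` and `q` are the last known free point up to `z` and the first one from `z` on. No
  -- breakpoint lies between them, so convexity of the cell applies.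
  obtain ⟨p, hp, hpmax⟩ := Set.exists_max_image (insert y (T ∩ Set.Icc y z)) id
    ((h.finite.inter_of_left _).insert _) ⟨y, Set.mem_insert _ _⟩
  obtain ⟨q, hq, hqmin⟩ := Set.exists_min_image (insert x (T ∩ Set.Icc z x)) id
    ((h.finite.inter_of_left _).insert _) ⟨x, Set.mem_insert _ _⟩
  have hp1 : p ∈ Set.Icc y z ∧ dist (F p) (G c) ≤ r := by
    rcases hp with rfl | hp
    · exact ⟨⟨le_rfl, hz.1⟩, hy⟩
    · exact ⟨hp.2, hT' p hp.1 ⟨hp.2.1, hp.2.2.trans hz.2⟩⟩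
  have hq1 : q ∈ Set.Icc z x ∧ dist (F q) (G c) ≤ r := by
    rcases hq with rfl | hq
    · exact ⟨⟨hz.2, le_rfl⟩, hx⟩
    · exact ⟨hq.2, hT' q hq.1 ⟨hz.1.trans hq.2.1, hq.2.2⟩⟩
  have hpq : p ≤ q := hp1.1.2.trans hq1.1.1
  have h1 := h.convex p ⟨hA.trans hp1.1.1, hpq.trans (hq1.1.2.trans hB)⟩ q
    ⟨hA.trans (hp1.1.1.trans hpq), hq1.1.2.trans hB⟩ hpq (fun t ht ht' => by
      rcases le_total t z with h2 | h2
      · have := hpmax t (Or.inr ⟨ht, hp1.1.1.trans ht'.1.le, h2⟩)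
        exact absurd ht'.1 (not_lt.2 this)
      · have := hqmin t (Or.inr ⟨ht, h2, ht'.2.le.trans hq1.1.2⟩)
        exact absurd ht'.2 (not_lt.2 this)) c c hp1.2 hq1.2
  rcases hpq.eq_or_lt with rfl | hlt
  · rw [le_antisymm hq1.1.1 hp1.1.2]
    exact hp1.2
  · have h2 := h1 ((z - p) / (q - p)) ⟨div_nonneg (sub_nonneg.2 hp1.1.2) (sub_nonneg.2 hpq),
      (div_le_one (sub_pos.2 hlt)).2 (by linarith [hq1.1.1])⟩
    rw [div_mul_cancel₀ _ (sub_pos.2 hlt).ne'] at h2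
    simpa using h2

/-- Moving the start of the segment backwards. -/
theorem CellConvex.start_out (h : CellConvex r F G T A B) (hA : A ≤ y) (hB : x' ≤ B)
    (hl : Leash r F x x' G s s') (hyx : y ≤ x) (hT : ∀ t ∈ T, t ∉ Set.Ioo y x) {c : ℝ}
    (hc : c ≤ s) (hfree : dist (F y) (G c) ≤ r) : Leash r F y x' G c s' :=
  (Leash.segment hyx hc (h.convex y ⟨hA, hyx.trans (hl.le_left.trans hB)⟩ x
    ⟨hA.trans hyx, hl.le_left.trans hB⟩ hyx hT c s hfree hl.dist_left)).concat hl

/-- Moving the start of the segment forwards. -/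
theorem CellConvex.start_in (h : CellConvex r F G T A B) (hrow : RowConst r F G T c₁ c₂)
    (hA : A ≤ y) (hB : x' ≤ B) (hl : Leash r F x x' G s s') (hyx : y ≤ x)
    (hT : ∀ t ∈ T, t ∉ Set.Ioo y x) (hs : s ∈ Set.Ioo c₁ c₂) (hs' : c₂ ≤ s')
    (hfree : dist (F y) (G c₂) ≤ r) : Leash r F y x' G c₂ s' := by
  -- With `f` a partner of `c₂`, all of `F` from `y` to `f` is matched to the single point `G c₂`. A
  -- breakpoint on the way lies after `x`, hence has a partner between `s` and `c₂`, and `RowConst`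
  -- moves that partner to `c₂`.
  obtain ⟨f, hf, h1, h2⟩ := hl.symm.split ⟨hs.2.le, hs'⟩
  refine Leash.concat (Leash.const_right (hyx.trans hf.1) fun z hz => ?_) h2.symm
  refine h.column hA (hf.2.trans hB) hfree ?_ (fun t ht ht' => ?_) hz
  · rw [dist_comm]
    exact h1.dist_right
  · have htx : x ≤ t := by
      by_contra! h3
      exact hT t ht ⟨ht'.1, h3⟩
    obtain ⟨g, hg, h3, -⟩ := h1.symm.split ⟨htx, ht'.2.le⟩
    rcases hg.2.eq_or_lt with rfl | h4
    · exact h3.dist_right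
    · exact hrow t ht g ⟨hs.1.trans_le hg.1, h4⟩ h3.dist_right c₂
        ⟨(hs.1.trans hs.2).le, le_rfl⟩

/-- This and `end_in` are the mirror images of `start_out` and `start_in` under reversal of both
curves. -/
theorem CellConvex.end_out (h : CellConvex r F G T A B) (hA : A ≤ x) (hB : y' ≤ B)
    (hl : Leash r F x x' G s s') (hyx : x' ≤ y') (hT : ∀ t ∈ T, t ∉ Set.Ioo x' y') {c : ℝ}
    (hc : s' ≤ c) (hfree : dist (F y') (G c) ≤ r) : Leash r F x y' G s c := by
  have h1 := (h.neg.start_out (neg_le_neg hB) (neg_le_neg hA) hl.neg (neg_le_neg hyx)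
    (fun t ht ht' => hT (-t) ht ⟨by linarith [ht'.2], by linarith [ht'.1]⟩) (neg_le_neg hc)
    (by simpa using hfree)).neg
  simpa using h1

theorem CellConvex.end_in (h : CellConvex r F G T A B) (hrow : RowConst r F G T d₁ d₂)
    (hA : A ≤ x) (hB : y' ≤ B) (hl : Leash r F x x' G s s') (hyx : x' ≤ y')
    (hT : ∀ t ∈ T, t ∉ Set.Ioo x' y') (hs' : s' ∈ Set.Ioo d₁ d₂) (hs : s ≤ d₁)
    (hfree : dist (F y') (G d₁) ≤ r) : Leash r F x y' G s d₁ := by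
  have h1 := (h.neg.start_in hrow.neg (neg_le_neg hB) (neg_le_neg hA) hl.neg (neg_le_neg hyx)
    (fun t ht ht' => hT (-t) ht ⟨by linarith [ht'.2], by linarith [ht'.1]⟩)
    ⟨neg_lt_neg hs'.2, neg_lt_neg hs'.1⟩ (neg_le_neg hs) (by simpa using hfree)).neg
  simpa using h1

/-- Moving the start and the end of the segment past each other. -/
theorem CellConvex.cross (h : CellConvex r F G T A B) (hrow : RowConst r F G T c₁ c₂)
    (hA : A ≤ y) (hB : y' ≤ B) (hl : Leash r F x x' G s s') (hyx : y ≤ x) (hyx' : x' ≤ y')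
    (hT : ∀ t ∈ T, t ∉ Set.Ioo y x) (hT' : ∀ t ∈ T, t ∉ Set.Ioo x' y')
    (hs : s ∈ Set.Ioo c₁ c₂) (hs' : s' ∈ Set.Ioo c₁ c₂)
    (hfree : dist (F y) (G c₂) ≤ r) (hfree' : dist (F y') (G c₁) ≤ r) :
    Leash r F y y' (fun g => G (-g)) (-c₂) (-c₁) := by
  have hc : c₁ ≤ c₂ := (hs.1.trans hs.2).le
  have hxx := hl.le_left
  have hmem : ∀ t ∈ T, t ∈ Set.Ioo y y' → t ∈ Set.Icc x x' := by
    intro t ht h1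
    constructor
    · by_contra! h2
      exact hT t ht ⟨h1.1, h2⟩
    · by_contra! h2
      exact hT' t ht ⟨h2, h1.2⟩
  -- A breakpoint between `x` and `x'` has a partner between `s` and `s'`, inside the gap, so it is
  -- close to the whole segment from `c₁` to `c₂`.
  have hall : ∀ t ∈ T, t ∈ Set.Icc x x' → ∀ g ∈ Set.Icc c₁ c₂, dist (F t) (G g) ≤ r := by
    intro t ht h1
    obtain ⟨g, hg, h2, -⟩ := hl.split h1
    exact hrow t ht g ⟨hs.1.trans_le hg.1, hg.2.trans_lt hs'.2⟩ h2.dist_right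
  by_cases hne : ∃ t ∈ T, t ∈ Set.Icc x x'
  · obtain ⟨t, ht, htx⟩ := hne
    -- The backward traversal waits at `c₂` until `F` has reached `t`, runs from `c₂` to `c₁` while
    -- `F` stays at `t`, and then waits at `c₁`.
    have h1 : Leash r F y t (fun g => G (-g)) (-c₂) (-c₂) := by
      refine Leash.const_right (hyx.trans htx.1) fun z hz => ?_
      rw [neg_neg]
      refine h.column hA (htx.2.trans (hyx'.trans hB)) hfree (hall t ht htx c₂ ⟨hc, le_rfl⟩)
        (fun u hu hu' => hall u hu (hmem u hu ⟨hu'.1, hu'.2.trans_le (htx.2.trans hyx')⟩) c₂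
          ⟨hc, le_rfl⟩) hz
    have h2 : Leash r F t t (fun g => G (-g)) (-c₂) (-c₁) :=
      Leash.const_left (neg_le_neg hc) fun z hz =>
        hall t ht htx (-z) ⟨by linarith [hz.2], by linarith [hz.1]⟩
    have h3 : Leash r F t y' (fun g => G (-g)) (-c₁) (-c₁) := by
      refine Leash.const_right (htx.2.trans hyx') fun z hz => ?_
      rw [neg_neg]
      refine h.column (hA.trans (hyx.trans htx.1)) hB (hall t ht htx c₁ ⟨le_rfl, hc⟩) hfree'
        (fun u hu hu' => hall u hu (hmem u hu ⟨(hyx.trans htx.1).trans_lt hu'.1, hu'.2⟩) c₁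
          ⟨le_rfl, hc⟩) hz
    exact (h1.concat h2).concat h3
  -- Without such a breakpoint, the part of `F` from `y` to `y'` lies in one cell, and convexity
  -- gives the diagonal between the two free corners.
  · have hyy : y ≤ y' := hyx.trans (hxx.trans hyx')
    refine Leash.segment hyy (neg_le_neg hc) fun l hl => ?_
    have h1 := h.convex y ⟨hA, hyy.trans hB⟩ y' ⟨hA.trans hyy, hB⟩ hyy
      (fun t ht ht' => hne ⟨t, ht, hmem t ht ht'⟩) c₂ c₁ hfree hfree' l hl
    convert h1 using 3
    ring

/-- The ends of a matched subsegment can be rounded, each to one of its two neighbouring critical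
parameters. The rounded segment may be reversed. -/
theorem CellConvex.round (h : CellConvex r F G T A B) (hrow : RowConst r F G T c₁ c₂)
    (hrow' : RowConst r F G T d₁ d₂) (hA : A ≤ y) (hB : y' ≤ B) (hl : Leash r F x x' G s s')
    (hyx : y ≤ x) (hyx' : x' ≤ y') (hT : ∀ t ∈ T, t ∉ Set.Ioo y x)
    (hT' : ∀ t ∈ T, t ∉ Set.Ioo x' y') (hs : s ∈ Set.Icc c₁ c₂) (hs' : s' ∈ Set.Icc d₁ d₂)
    (hcd : c₂ ≤ d₁ ∨ c₁ = d₁ ∧ c₂ = d₂)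
    (hfree : ∃ z ∈ Set.Icc y x, dist (F z) (G c₁) ≤ r ∨ dist (F z) (G c₂) ≤ r)
    (hfree' : ∃ z ∈ Set.Icc x' y', dist (F z) (G d₁) ≤ r ∨ dist (F z) (G d₂) ≤ r) :
    ∃ c d, (c = c₁ ∨ c = c₂) ∧ (d = d₁ ∨ d = d₂) ∧ ∃ z ∈ Set.Icc y x, ∃ z' ∈ Set.Icc x' y',
      c ≤ d ∧ Leash r F z z' G c d ∨ d ≤ c ∧ Leash r F z z' (fun g => G (-g)) (-c) (-d) := by
  have hxx := hl.le_left
  have hss := hl.le_right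
  have hxB : x' ≤ B := hyx'.trans hB
  have hxA : A ≤ x := hA.trans hyx
  -- Either a critical parameter at or before `s` can be used and the segment grows, or `s` is
  -- inside the gap and the start moves forward to `c₂`. The end is treated symmetrically.
  have hS : (∃ c, (c = c₁ ∨ c = c₂) ∧ c ≤ s ∧ ∃ z ∈ Set.Icc y x, dist (F z) (G c) ≤ r) ∨
      (s ∈ Set.Ioo c₁ c₂ ∧ ∃ z ∈ Set.Icc y x, dist (F z) (G c₂) ≤ r) := by
    rcases hs.2.eq_or_lt with rfl | h2
    · exact Or.inl ⟨s, Or.inr rfl, le_rfl, x, ⟨hyx, le_rfl⟩, hl.dist_left⟩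
    rcases hs.1.eq_or_lt with rfl | h1
    · exact Or.inl ⟨c₁, Or.inl rfl, le_rfl, x, ⟨hyx, le_rfl⟩, hl.dist_left⟩
    obtain ⟨z, hz, h3 | h3⟩ := hfree
    · exact Or.inl ⟨c₁, Or.inl rfl, hs.1, z, hz, h3⟩
    · exact Or.inr ⟨⟨h1, h2⟩, z, hz, h3⟩
  have hE : (∃ c, (c = d₁ ∨ c = d₂) ∧ s' ≤ c ∧ ∃ z ∈ Set.Icc x' y', dist (F z) (G c) ≤ r) ∨
      (s' ∈ Set.Ioo d₁ d₂ ∧ ∃ z ∈ Set.Icc x' y', dist (F z) (G d₁) ≤ r) := by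
    rcases hs'.1.eq_or_lt with rfl | h1
    · exact Or.inl ⟨d₁, Or.inl rfl, le_rfl, x', ⟨le_rfl, hyx'⟩, hl.dist_right⟩
    rcases hs'.2.eq_or_lt with rfl | h2
    · exact Or.inl ⟨s', Or.inr rfl, le_rfl, x', ⟨le_rfl, hyx'⟩, hl.dist_right⟩
    obtain ⟨z, hz, h3 | h3⟩ := hfree'
    · exact Or.inr ⟨⟨h1, h2⟩, z, hz, h3⟩
    · exact Or.inl ⟨d₂, Or.inr rfl, hs'.2, z, hz, h3⟩
  have hTz : ∀ z ∈ Set.Icc y x, ∀ t ∈ T, t ∉ Set.Ioo z x := fun z hz t ht ht' =>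
    hT t ht ⟨hz.1.trans_lt ht'.1, ht'.2⟩
  have hTz' : ∀ z ∈ Set.Icc x' y', ∀ t ∈ T, t ∉ Set.Ioo x' z := fun z hz t ht ht' =>
    hT' t ht ⟨ht'.1, ht'.2.trans_le hz.2⟩
  rcases hS with ⟨c, hc, hcs, z, hz, hf⟩ | ⟨hsI, z, hz, hf⟩ <;>
    rcases hE with ⟨d, hd, hds, z', hz', hf'⟩ | ⟨hsI', z', hz', hf'⟩
  · refine ⟨c, d, hc, hd, z, hz, z', hz', Or.inl ⟨hcs.trans (hss.trans hds), ?_⟩⟩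
    exact h.end_out (hA.trans hz.1) (hz'.2.trans hB)
      (h.start_out (hA.trans hz.1) hxB hl hz.2 (hTz z hz) hcs hf) hz'.1 (hTz' z' hz') hds hf'
  -- If the two gaps coincide, `c` must be `c₁`: the alternative `c₂ ≤ s` contradicts `s ≤ s' < d₂ =
  -- c₂`.
  · have hcd1 : c ≤ d₁ := by
      rcases hcd with h1 | ⟨rfl, rfl⟩
      · rcases hc with rfl | rfl
        · exact (hs.1.trans hs.2).trans h1
        · exact h1
      · rcases hc with rfl | rfl
        · exact le_rfl
        · exact absurd hsI'.2 (not_lt.2 (hcs.trans hss))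
    refine ⟨c, d₁, hc, Or.inl rfl, z, hz, z', hz', Or.inl ⟨hcd1, ?_⟩⟩
    exact h.end_in hrow' (hA.trans hz.1) (hz'.2.trans hB)
      (h.start_out (hA.trans hz.1) hxB hl hz.2 (hTz z hz) hcs hf) hz'.1 (hTz' z' hz') hsI' hcd1 hf'
  · have hcd1 : c₂ ≤ d := by
      rcases hcd with h1 | ⟨rfl, rfl⟩
      · exact h1.trans (hs'.1.trans hds)
      · rcases hd with rfl | rfl
        · exact absurd hsI.1 (not_lt.2 (hss.trans hds))
        · exact le_rfl
    refine ⟨c₂, d, Or.inr rfl, hd, z, hz, z', hz', Or.inl ⟨hcd1, ?_⟩⟩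
    exact h.start_in hrow (hA.trans hz.1) (hz'.2.trans hB)
      (h.end_out hxA (hz'.2.trans hB) hl hz'.1 (hTz' z' hz') hds hf') hz.2 (hTz z hz) hsI hcd1 hf
  -- Both ends move inwards; within a common gap they pass each other and the segment is reversed.
  · refine ⟨c₂, d₁, Or.inr rfl, Or.inl rfl, z, hz, z', hz', ?_⟩
    rcases hcd with h1 | ⟨rfl, rfl⟩
    · refine Or.inl ⟨h1, ?_⟩
      exact h.end_in hrow' (hA.trans hz.1) (hz'.2.trans hB)
        (h.start_in hrow (hA.trans hz.1) hxB hl hz.2 (hTz z hz) hsI (h1.trans hs'.1) hf)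
        hz'.1 (hTz' z' hz') hsI' h1 hf'
    · exact Or.inr ⟨hs.1.trans hs.2, h.cross hrow (hA.trans hz.1) (hz'.2.trans hB) hl hz.2 hz'.1
        (hTz z hz) (hTz' z' hz') hsI hsI' hf hf'⟩

end Rounding

/-! The candidates. -/

section Candidates

open scoped RealInnerProductSpace

variable {d m : ℕ} (S : PolyCurve d m)

/-- The difference of two vertices. -/
noncomputable def PolyCurve.diff (i j : Fin (m + 1)) : Pt d := S.vertex i - S.vertex j

/-- The critical parameters of edge `i` with respect to edge `a`. -/
noncomputable def PolyCurve.critList (Δ : ℝ) (i a : Fin m) : List unitInterval :=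
  let ρ := (8 * Δ) * (8 * Δ)
  let u := S.diff i.castSucc a.castSucc
  let u' := S.diff i.castSucc a.succ
  let v := S.diff i.succ i.castSucc
  let w := S.diff a.succ a.castSucc
  [0, 1, ⟨_, vertexCrit_mem 1 ρ u v⟩, ⟨_, vertexCrit_mem (-1) ρ u v⟩,
    ⟨_, vertexCrit_mem 1 ρ u' v⟩, ⟨_, vertexCrit_mem (-1) ρ u' v⟩,
    ⟨_, edgeCrit_mem 1 ρ u v w⟩, ⟨_, edgeCrit_mem (-1) ρ u v w⟩]

/-- The subedges between any two critical parameters of an edge. -/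
noncomputable def PolyCurve.candidates (Δ : ℝ) : List (Candidate m) :=
  (List.finRange m).flatMap fun i => (List.finRange m).flatMap fun a =>
    (List.finRange m).flatMap fun b => (S.critList Δ i a).flatMap fun s =>
      (S.critList Δ i b).map fun t => (i, s, t)

/-- The critical parameters of edge `i`. -/
def PolyCurve.critSet (Δ : ℝ) (i : Fin m) : Set ℝ :=
  {x | ∃ a, ∃ t ∈ S.critList Δ i a, (t : ℝ) = x}

variable {S}

theorem PolyCurve.mem_candidates {Δ : ℝ} {i : Fin m} {s t : unitInterval}
    (hs : (s : ℝ) ∈ S.critSet Δ i) (ht : (t : ℝ) ∈ S.critSet Δ i) :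
    (i, s, t) ∈ S.candidates Δ := by
  obtain ⟨a, s', hs', hs''⟩ := hs
  obtain ⟨b, t', ht', ht''⟩ := ht
  obtain rfl := Subtype.ext hs''
  obtain rfl := Subtype.ext ht''
  simp only [PolyCurve.candidates, List.mem_flatMap, List.mem_finRange, List.mem_map, true_and]
  exact ⟨i, a, b, s', hs', t', ht', rfl⟩

theorem PolyCurve.length_candidates (Δ : ℝ) : (S.candidates Δ).length = 64 * m ^ 3 := by
  have h1 : ∀ i a, (S.critList Δ i a).length = 8 := fun _ _ => rfl
  simp only [PolyCurve.candidates, List.length_flatMap, List.length_map, h1, List.map_const',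
    List.sum_replicate, List.length_finRange, smul_eq_mul]
  ring

theorem PolyCurve.finite_critSet (Δ : ℝ) (i : Fin m) : (S.critSet Δ i).Finite := by
  have : S.critSet Δ i = ⋃ a, ((↑) : unitInterval → ℝ) '' {t | t ∈ S.critList Δ i a} := by
    ext x
    simp [PolyCurve.critSet]
  rw [this]
  exact Set.finite_iUnion fun a => (List.finite_toSet _).image _

theorem PolyCurve.zero_mem_critSet (Δ : ℝ) (i : Fin m) : (0 : ℝ) ∈ S.critSet Δ i :=
  ⟨i, 0, by simp [PolyCurve.critList], rfl⟩

theorem PolyCurve.one_mem_critSet (Δ : ℝ) (i : Fin m) : (1 : ℝ) ∈ S.critSet Δ i :=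
  ⟨i, 1, by simp [PolyCurve.critList], rfl⟩

theorem PolyCurve.critSet_subset (Δ : ℝ) (i : Fin m) : S.critSet Δ i ⊆ Set.Icc 0 1 := by
  rintro _ ⟨a, t, -, rfl⟩
  exact t.2

/-- The contrapositive of `eq_vertexCrit`, in the form that `norm_le_of_no_vertexCrit` needs. Every
vertex starts or ends some edge `a`, and `critList` contains the parameters for both ends of `a`. -/
theorem PolyCurve.eq_zero_of_dist_vertex {Δ s : ℝ} {i : Fin m} (j : Fin (m + 1))
    (hs : s ∈ Set.Icc (0 : ℝ) 1) (hcrit : s ∉ S.critSet Δ i)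
    (h : ‖S.diff i.castSucc j + s • S.diff i.succ i.castSucc‖ = 8 * Δ) :
    S.diff i.succ i.castSucc = 0 := by
  by_contra hv
  have hρ : ‖S.diff i.castSucc j + s • S.diff i.succ i.castSucc‖ ^ 2 = (8 * Δ) * (8 * Δ) := by
    rw [h]
    ring
  have h1 := eq_vertexCrit hs hv hρ
  obtain ⟨a, rfl | rfl⟩ : ∃ a : Fin m, j = a.castSucc ∨ j = a.succ := by
    refine Fin.lastCases ?_ (fun a => ⟨a, Or.inl rfl⟩) j
    obtain ⟨n, rfl⟩ := Nat.exists_eq_succ_of_ne_zero S.pos.ne'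
    exact ⟨Fin.last n, Or.inr (Fin.succ_last n).symm⟩
  · rcases h1 with h1 | h1 <;> refine hcrit ⟨a, ⟨_, vertexCrit_mem ..⟩, ?_, h1.symm⟩ <;>
      simp [PolyCurve.critList]
  · rcases h1 with h1 | h1 <;> refine hcrit ⟨a, ⟨_, vertexCrit_mem ..⟩, ?_, h1.symm⟩ <;>
      simp [PolyCurve.critList]

theorem PolyCurve.gram_eq_zero {Δ s x : ℝ} {i : Fin m} (a : Fin m)
    (hs : s ∈ Set.Icc (0 : ℝ) 1) (hcrit : s ∉ S.critSet Δ i)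
    (h : ‖S.diff i.castSucc a.castSucc + s • S.diff i.succ i.castSucc -
      x • S.diff a.succ a.castSucc‖ = 8 * Δ)
    (hperp : ⟪S.diff i.succ i.castSucc, S.diff i.castSucc a.castSucc +
      s • S.diff i.succ i.castSucc - x • S.diff a.succ a.castSucc⟫ = 0) :
    gram (S.diff i.succ i.castSucc) (S.diff a.succ a.castSucc) = 0 := by
  by_contra hg
  have hρ : ‖S.diff i.castSucc a.castSucc + s • S.diff i.succ i.castSucc -
      x • S.diff a.succ a.castSucc‖ ^ 2 = (8 * Δ) * (8 * Δ) := by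
    rw [h]
    ring
  rcases eq_edgeCrit hs hg hρ hperp with h1 | h1 <;> refine hcrit ⟨a, ⟨_, edgeCrit_mem ..⟩, ?_, h1.symm⟩ <;>
      simp [PolyCurve.critList]

/-! ### The free space of a curve and one of its edges. -/

/-- The `i`-th edge, as a pair of points. -/
noncomputable def PolyCurve.edge (S : PolyCurve d m) (i : Fin m) : Pt d × Pt d :=
  (S.vertex i.castSucc, S.vertex i.succ)

theorem line_eq (q : Pt d × Pt d) (t : ℝ) : line q t = q.1 + t • (q.2 - q.1) := by
  rw [line, AffineMap.lineMap_apply, vsub_eq_sub, vadd_eq_add, add_comm]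

/-- The last edge that starts at or before `x` is taken, so its end lies strictly after `x` unless
it is the final edge. `cellConvex` and `IsGoodIndex.spans` use this strictness. -/
theorem PolyCurve.exists_edge {x : ℝ} (hx : x ∈ Set.Icc (0 : ℝ) 1) :
    ∃ a : Fin m, S.param a.castSucc ≤ x ∧ x ≤ S.param a.succ ∧
      (x < S.param a.succ ∨ (a : ℕ) + 1 = m) := by
  obtain ⟨n, rfl⟩ := Nat.exists_eq_succ_of_ne_zero S.pos.ne'
  obtain ⟨a, ha, hmax⟩ := Set.exists_max_image {a : Fin (n + 1) | S.param a.castSucc ≤ x} id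
    (Set.toFinite _) ⟨0, by simpa [S.param_zero] using hx.1⟩
  refine ⟨a, ha, ?_⟩
  rcases Fin.eq_castSucc_or_eq_last a with ⟨b, rfl⟩ | rfl
  · have h1 : x < S.param b.castSucc.succ := by
      by_contra! h2
      have := hmax b.succ (by simpa using h2)
      exact absurd this (by simp)
    exact ⟨h1.le, Or.inl h1⟩
  · rw [Fin.succ_last, S.param_last]
    exact ⟨hx.2, Or.inr (by simp)⟩

theorem PolyCurve.eval_eq_on_edge (a : Fin m) {x : ℝ}
    (hx : x ∈ Set.Icc (S.param a.castSucc) (S.param a.succ)) :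
    S.eval x = S.vertex a.castSucc + ((x - S.param a.castSucc) /
      (S.param a.succ - S.param a.castSucc)) • S.diff a.succ a.castSucc := by
  rw [S.eval_eq_lineMap a hx]
  exact line_eq (S.edge a) _

/-- With no vertex strictly between them, `f` and `f'` lie on one edge. There the difference of the
two curves is affine in the pair of parameters, and its norm is convex. -/
theorem PolyCurve.cellConvex (r : ℝ) (q : Pt d × Pt d) :
    CellConvex r S.eval (line q) (Set.range S.param) 0 1 where
  finite := Set.finite_range _
  convex := by
    intro f hf f' hf' hle hT g g' h1 h2 l hl
    obtain ⟨a, ha1, ha2, ha3⟩ := S.exists_edge hf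
    have ha4 : f' ≤ S.param a.succ := by
      rcases ha3 with h3 | h3
      · by_contra! h4
        exact hT _ ⟨_, rfl⟩ ⟨h3, h4⟩
      · rw [show a.succ = Fin.last m from Fin.ext h3, S.param_last]
        exact hf'.2
    have e1 := mul_le_mul_of_nonneg_right hl.1 (sub_nonneg.2 hle)
    have e2 := mul_le_mul_of_nonneg_right hl.2 (sub_nonneg.2 hle)
    have e3 : S.eval (f + l * (f' - f)) - line q (g + l * (g' - g)) =
        (1 - l) • (S.eval f - line q g) + l • (S.eval f' - line q g') := by
      rw [S.eval_eq_on_edge a ⟨ha1, ha2⟩, S.eval_eq_on_edge a ⟨ha1.trans hle, ha4⟩,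
        S.eval_eq_on_edge a ⟨by linarith, by linarith⟩, line_eq, line_eq, line_eq]
      module
    rw [dist_eq_norm] at *
    rw [e3]
    refine (norm_add_le _ _).trans ?_
    rw [norm_smul, norm_smul, Real.norm_of_nonneg hl.1, Real.norm_of_nonneg (sub_nonneg.2 hl.2)]
    have := mul_le_mul_of_nonneg_left h1 (sub_nonneg.2 hl.2)
    have := mul_le_mul_of_nonneg_left h2 hl.1
    linarith

variable {Δ c₁ c₂ : ℝ} {i : Fin m}

theorem PolyCurve.rowConst (hc₁ : 0 ≤ c₁) (hc₂ : c₂ ≤ 1)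
    (hcrit : ∀ s ∈ Set.Ioo c₁ c₂, s ∉ S.critSet Δ i) :
    RowConst (8 * Δ) S.eval (line (S.edge i)) (Set.range S.param) c₁ c₂ := by
  rintro _ ⟨j, rfl⟩ g hg h1 g' hg'
  have e : ∀ t, dist (S.eval (S.param j)) (line (S.edge i) t) =
      ‖S.diff i.castSucc j + t • S.diff i.succ i.castSucc‖ := by
    intro t
    rw [dist_comm, dist_eq_norm, line_eq, S.eval_param, PolyCurve.edge, PolyCurve.diff,
      PolyCurve.diff]
    congr 1
    module
  rw [e] at h1 ⊢
  exact norm_le_of_no_vertexCrit (fun s hs => S.eq_zero_of_dist_vertex j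
    ⟨hc₁.trans hs.1.le, hs.2.le.trans hc₂⟩ (hcrit s hs)) hg h1 hg'

theorem PolyCurve.exists_free_start (hc₁ : 0 ≤ c₁) (hc₂ : c₂ ≤ 1)
    (hcrit : ∀ s ∈ Set.Ioo c₁ c₂, s ∉ S.critSet Δ i) (a : Fin m) {x s : ℝ}
    (hx : x ∈ Set.Icc (S.param a.castSucc) (S.param a.succ)) (hs : s ∈ Set.Icc c₁ c₂)
    (h : dist (S.eval x) (line (S.edge i) s) ≤ 8 * Δ) :
    ∃ z ∈ Set.Icc (S.param a.castSucc) x, dist (S.eval z) (line (S.edge i) c₁) ≤ 8 * Δ ∨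
      dist (S.eval z) (line (S.edge i) c₂) ≤ 8 * Δ := by
  have hlen := sub_pos.2 (S.param_lt a)
  have e : ∀ z t, z ∈ Set.Icc (S.param a.castSucc) (S.param a.succ) →
      dist (S.eval z) (line (S.edge i) t) = ‖S.diff i.castSucc a.castSucc +
        t • S.diff i.succ i.castSucc - ((z - S.param a.castSucc) /
          (S.param a.succ - S.param a.castSucc)) • S.diff a.succ a.castSucc‖ := by
    intro z t hz
    rw [dist_comm, dist_eq_norm, line_eq, S.eval_eq_on_edge a hz, PolyCurve.edge]
    congr 1
    simp only [PolyCurve.diff]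
    module
  rw [e x s hx] at h
  obtain ⟨x', hx', h'⟩ := exists_free_le (fun s hs => S.eq_zero_of_dist_vertex a.castSucc
    ⟨hc₁.trans hs.1.le, hs.2.le.trans hc₂⟩ (hcrit s hs)) (fun s hs x => S.gram_eq_zero a
    ⟨hc₁.trans hs.1.le, hs.2.le.trans hc₂⟩ (hcrit s hs)) hs
    (div_nonneg (sub_nonneg.2 hx.1) hlen.le) h
  have h1 := mul_nonneg hx'.1 hlen.le
  have h2 : x' * (S.param a.succ - S.param a.castSucc) ≤ x - S.param a.castSucc :=
    (le_div_iff₀ hlen).1 hx'.2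
  have h3 : (S.param a.castSucc + x' * (S.param a.succ - S.param a.castSucc) -
      S.param a.castSucc) / (S.param a.succ - S.param a.castSucc) = x' := by
    field_simp
    ring
  have h4 : S.param a.castSucc + x' * (S.param a.succ - S.param a.castSucc) ∈
      Set.Icc (S.param a.castSucc) (S.param a.succ) := ⟨by linarith, by linarith [hx.2]⟩
  refine ⟨_, ⟨h4.1, by linarith⟩, ?_⟩
  rwa [e _ _ h4, e _ _ h4, h3]

/-- This is `exists_free_le` for the edge `a` run backwards, with base at its end vertex and
direction negated. Replacing `x` by `1 - x` reduces its edge condition to that of the forward edge,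
so the same critical parameters serve both ends. -/
theorem PolyCurve.exists_free_end (hc₁ : 0 ≤ c₁) (hc₂ : c₂ ≤ 1)
    (hcrit : ∀ s ∈ Set.Ioo c₁ c₂, s ∉ S.critSet Δ i) (a : Fin m) {x s : ℝ}
    (hx : x ∈ Set.Icc (S.param a.castSucc) (S.param a.succ)) (hs : s ∈ Set.Icc c₁ c₂)
    (h : dist (S.eval x) (line (S.edge i) s) ≤ 8 * Δ) :
    ∃ z ∈ Set.Icc x (S.param a.succ), dist (S.eval z) (line (S.edge i) c₁) ≤ 8 * Δ ∨
      dist (S.eval z) (line (S.edge i) c₂) ≤ 8 * Δ := by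
  have hlen := sub_pos.2 (S.param_lt a)
  have hd : S.diff i.castSucc a.succ = S.diff i.castSucc a.castSucc -
      S.diff a.succ a.castSucc := by
    simp only [PolyCurve.diff]
    abel
  have e : ∀ z t, z ∈ Set.Icc (S.param a.castSucc) (S.param a.succ) →
      dist (S.eval z) (line (S.edge i) t) = ‖S.diff i.castSucc a.succ +
        t • S.diff i.succ i.castSucc - ((S.param a.succ - z) /
          (S.param a.succ - S.param a.castSucc)) • -S.diff a.succ a.castSucc‖ := by
    intro z t hz
    have h1 : (S.param a.succ - z) / (S.param a.succ - S.param a.castSucc) =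
        1 - (z - S.param a.castSucc) / (S.param a.succ - S.param a.castSucc) := by
      field_simp
      ring
    rw [dist_comm, dist_eq_norm, line_eq, S.eval_eq_on_edge a hz, PolyCurve.edge, h1]
    congr 1
    simp only [PolyCurve.diff]
    module
  rw [e x s hx] at h
  obtain ⟨x', hx', h'⟩ := exists_free_le (fun s hs => S.eq_zero_of_dist_vertex a.succ
    ⟨hc₁.trans hs.1.le, hs.2.le.trans hc₂⟩ (hcrit s hs)) (fun s hs x h1 h2 => by
      have h3 : S.diff i.castSucc a.succ + s • S.diff i.succ i.castSucc -
          x • -S.diff a.succ a.castSucc = S.diff i.castSucc a.castSucc +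
          s • S.diff i.succ i.castSucc - (1 - x) • S.diff a.succ a.castSucc := by
        rw [hd]
        module
      rw [h3] at h1 h2
      have h4 := S.gram_eq_zero a ⟨hc₁.trans hs.1.le, hs.2.le.trans hc₂⟩ (hcrit s hs) h1 h2
      simpa [gram] using h4) hs
    (div_nonneg (sub_nonneg.2 hx.2) hlen.le) h
  have h1 := mul_nonneg hx'.1 hlen.le
  have h2 : x' * (S.param a.succ - S.param a.castSucc) ≤ S.param a.succ - x :=
    (le_div_iff₀ hlen).1 hx'.2
  have h3 : (S.param a.succ - (S.param a.succ - x' * (S.param a.succ - S.param a.castSucc))) /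
      (S.param a.succ - S.param a.castSucc) = x' := by
    field_simp
    ring
  have h4 : S.param a.succ - x' * (S.param a.succ - S.param a.castSucc) ∈
      Set.Icc (S.param a.castSucc) (S.param a.succ) := ⟨by linarith [hx.1], by linarith⟩
  refine ⟨_, ⟨by linarith, h4.2⟩, ?_⟩
  rwa [e _ _ h4, e _ _ h4, h3]

/-- If `s` is critical, both neighbours equal `s` and the gap between them is empty. -/
theorem PolyCurve.exists_neighbours (Δ : ℝ) (i : Fin m) {s : ℝ} (hs : s ∈ Set.Icc (0 : ℝ) 1) :
    ∃ c₁ ∈ S.critSet Δ i, ∃ c₂ ∈ S.critSet Δ i, s ∈ Set.Icc c₁ c₂ ∧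
      ∀ t ∈ S.critSet Δ i, (t ≤ s → t ≤ c₁) ∧ (s ≤ t → c₂ ≤ t) := by
  obtain ⟨c₁, hc₁, h1⟩ := Set.exists_max_image (S.critSet Δ i ∩ Set.Iic s) id
    ((S.finite_critSet Δ i).inter_of_left _) ⟨0, S.zero_mem_critSet Δ i, hs.1⟩
  obtain ⟨c₂, hc₂, h2⟩ := Set.exists_min_image (S.critSet Δ i ∩ Set.Ici s) id
    ((S.finite_critSet Δ i).inter_of_left _) ⟨1, S.one_mem_critSet Δ i, hs.2⟩
  exact ⟨c₁, hc₁.1, c₂, hc₂.1, ⟨hc₁.2, hc₂.2⟩, fun t ht =>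
    ⟨fun h => h1 t ⟨ht, h⟩, fun h => h2 t ⟨ht, h⟩⟩⟩

theorem PolyCurve.line_subedge (c : Candidate m) (t : ℝ) :
    line (S.subedge c) t = line (S.edge c.1) (((c.2.2 : ℝ) - c.2.1) * t + c.2.1) := by
  have h : ∀ s : unitInterval, edgeCurve (S.vertex c.1.castSucc, S.vertex c.1.succ) s =
      line (S.edge c.1) s := fun _ => rfl
  simp only [PolyCurve.subedge, line_eq, h]
  module

theorem PolyCurve.mem_coverageOn {r : ℝ} (hr : 0 ≤ r) {a b : Fin m} {q : Pt d × Pt d} {s t t' : ℝ}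
    (hs : s ∈ Set.Icc t t') (ht : t ∈ Set.Icc (S.param a.castSucc) (S.param a.succ))
    (ht' : t' ∈ Set.Icc (S.param b.castSucc) (S.param b.succ))
    (h : Leash r S.eval t t' (line q) 0 1) : s ∈ coverageOn r S a b q :=
  ⟨t, t', hs, ht, h.le_left, ht', (frechetDist_sub_le_iff S h.le_left q hr).2 h⟩

/-- Four candidates cover at least as much as an arbitrary subedge. -/
theorem PolyCurve.exists_four_candidates (hΔ : 0 < Δ) (i : Fin m) {σ σ' : ℝ}
    (hσ : 0 ≤ σ) (hσσ : σ ≤ σ') (hσ' : σ' ≤ 1) :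
    ∃ N : Finset (Candidate m), N.card ≤ 4 ∧ (∀ c ∈ N, c ∈ S.candidates Δ) ∧
      ∀ (a b : Fin m) (x x' : ℝ), x ∈ Set.Icc (S.param a.castSucc) (S.param a.succ) →
        x' ∈ Set.Icc (S.param b.castSucc) (S.param b.succ) →
        Leash (8 * Δ) S.eval x x' (line (S.edge i)) σ σ' →
        ∀ s ∈ Set.Icc x x', ∃ c ∈ N, s ∈ coverageOn (8 * Δ) S a b (S.subedge c) := by
  classical
  obtain ⟨c₁, hc₁, c₂, hc₂, hσc, hc⟩ := S.exists_neighbours Δ i ⟨hσ, hσσ.trans hσ'⟩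
  obtain ⟨d₁, hd₁, d₂, hd₂, hσd, hd⟩ := S.exists_neighbours Δ i ⟨hσ.trans hσσ, hσ'⟩
  have hcI := S.critSet_subset Δ i hc₁
  have hcI' := S.critSet_subset Δ i hc₂
  have hdI := S.critSet_subset Δ i hd₁
  have hdI' := S.critSet_subset Δ i hd₂
  have hcc : ∀ s ∈ Set.Ioo c₁ c₂, s ∉ S.critSet Δ i := fun s hs h => by
    rcases le_total s σ with h1 | h1
    · exact absurd hs.1 (not_lt.2 ((hc s h).1 h1))
    · exact absurd hs.2 (not_lt.2 ((hc s h).2 h1))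
  have hdc : ∀ s ∈ Set.Ioo d₁ d₂, s ∉ S.critSet Δ i := fun s hs h => by
    rcases le_total s σ' with h1 | h1
    · exact absurd hs.1 (not_lt.2 ((hd s h).1 h1))
    · exact absurd hs.2 (not_lt.2 ((hd s h).2 h1))
  -- Either some critical parameter lies between `σ` and `σ'` and separates the gaps, or there is
  -- none and the gaps coincide.
  have hcd : c₂ ≤ d₁ ∨ c₁ = d₁ ∧ c₂ = d₂ := by
    rcases le_or_gt σ d₁ with h1 | h1
    · exact Or.inl ((hc d₁ hd₁).2 h1)
    rcases le_or_gt c₂ σ' with h2 | h2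
    · exact Or.inl ((hd c₂ hc₂).1 h2)
    · exact Or.inr ⟨le_antisymm ((hd c₁ hc₁).1 (hσc.1.trans hσσ)) ((hc d₁ hd₁).1 h1.le),
        le_antisymm ((hc d₂ hd₂).2 (hσσ.trans hσd.2)) ((hd c₂ hc₂).2 h2.le)⟩
  let C₁ : unitInterval := ⟨c₁, hcI⟩
  let C₂ : unitInterval := ⟨c₂, hcI'⟩
  let D₁ : unitInterval := ⟨d₁, hdI⟩
  let D₂ : unitInterval := ⟨d₂, hdI'⟩
  -- These depend on `σ` and `σ'` only, hence serve all subcurves of `S` at once; which of the four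
  -- is used varies with the subcurve.
  refine ⟨{(i, C₁, D₁), (i, C₁, D₂), (i, C₂, D₁), (i, C₂, D₂)}, Finset.card_le_four, ?_, ?_⟩
  · intro c hc'
    simp only [Finset.mem_insert, Finset.mem_singleton] at hc'
    rcases hc' with rfl | rfl | rfl | rfl <;> exact S.mem_candidates ‹_› ‹_›
  · intro a b x x' hx hx' hl s hs
    have hTa : ∀ t ∈ Set.range S.param, t ∉ Set.Ioo (S.param a.castSucc) x := by
      rintro _ ⟨j, rfl⟩ ⟨h1, h2⟩
      have h3 := S.param_strictMono.lt_iff_lt.1 h1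
      have h4 := S.param_strictMono.lt_iff_lt.1 (h2.trans_le hx.2)
      rw [Fin.lt_def] at h3 h4
      simp only [Fin.val_castSucc, Fin.val_succ] at h3 h4
      omega
    have hTb : ∀ t ∈ Set.range S.param, t ∉ Set.Ioo x' (S.param b.succ) := by
      rintro _ ⟨j, rfl⟩ ⟨h1, h2⟩
      have h3 := S.param_strictMono.lt_iff_lt.1 (hx'.1.trans_lt h1)
      have h4 := S.param_strictMono.lt_iff_lt.1 h2
      rw [Fin.lt_def] at h3 h4
      simp only [Fin.val_castSucc, Fin.val_succ] at h3 h4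
      omega
    obtain ⟨c, e, hc', he', z, hz, z', hz', hlz⟩ :=
      (S.cellConvex (8 * Δ) (S.edge i)).round (S.rowConst hcI.1 hcI'.2 hcc)
        (S.rowConst hdI.1 hdI'.2 hdc) (S.param_mem _).1 (S.param_mem _).2 hl hx.1 hx'.2 hTa hTb
        hσc hσd hcd (S.exists_free_start hcI.1 hcI'.2 hcc a hx hσc hl.dist_left)
        (S.exists_free_end hdI.1 hdI'.2 hdc b hx' hσd hl.dist_right)
    have hfin : ∀ C D : unitInterval, (C : ℝ) = c → (D : ℝ) = e →
        s ∈ coverageOn (8 * Δ) S a b (S.subedge (i, C, D)) := by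
      rintro C D rfl rfl
      refine S.mem_coverageOn (by positivity) ⟨hz.2.trans hs.1, hs.2.trans hz'.1⟩
        ⟨hz.1, hz.2.trans hx.2⟩ ⟨hx'.1.trans hz'.1, hz'.2⟩ ?_
      rcases hlz with ⟨h1, h2⟩ | ⟨h1, h2⟩
      · exact (h2.symm.reparam_left (k := (D : ℝ) - C) (l := C) (sub_nonneg.2 h1) zero_le_one
          (fun t => S.line_subedge (i, C, D) t) (by ring) (by ring) (continuous_line _)
          S.continuous_eval).symm
      -- Crossed ends: the candidate runs backwards from `C` to `D`, that is, along the reversed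
      -- line at parameter `(C - D) t - C`.
      · exact (h2.symm.reparam_left (k := (C : ℝ) - D) (l := -C) (sub_nonneg.2 h1) zero_le_one
          (fun t => (S.line_subedge (i, C, D) t).trans (congrArg _ (by dsimp only; ring)))
          (by ring) (by ring)
          ((continuous_line _).comp continuous_neg) S.continuous_eval).symm
    rcases hc' with rfl | rfl <;> rcases he' with rfl | rfl
    · exact ⟨(i, C₁, D₁), by simp, hfin C₁ D₁ rfl rfl⟩
    · exact ⟨(i, C₁, D₂), by simp, hfin C₁ D₂ rfl rfl⟩
    · exact ⟨(i, C₂, D₁), by simp, hfin C₂ D₁ rfl rfl⟩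
    · exact ⟨(i, C₂, D₂), by simp, hfin C₂ D₂ rfl rfl⟩

end Candidates

/-! Coverings by candidates. -/

section Covering

variable {d m : ℕ} {S : PolyCurve d m}

theorem PolyCurve.leash_edge (S : PolyCurve d m) (a : Fin m) {v v' : ℝ}
    (hv : S.param a.castSucc ≤ v) (hvv : v ≤ v') (hv' : v' ≤ S.param a.succ) :
    Leash 0 S.eval v v' (line (S.edge a))
      ((v - S.param a.castSucc) / (S.param a.succ - S.param a.castSucc))
      ((v' - S.param a.castSucc) / (S.param a.succ - S.param a.castSucc)) := by
  have hlen := sub_pos.2 (S.param_lt a)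
  have e : ∀ x, 1 / (S.param a.succ - S.param a.castSucc) * x +
      -S.param a.castSucc / (S.param a.succ - S.param a.castSucc) =
      (x - S.param a.castSucc) / (S.param a.succ - S.param a.castSucc) := fun x => by ring
  have h := Leash.affine (F := S.eval) (G := line (S.edge a)) (r := 0)
    (k := 1 / (S.param a.succ - S.param a.castSucc))
    (l := -S.param a.castSucc / (S.param a.succ - S.param a.castSucc)) (by positivity) hvv le_rfl
    (fun x hx => by
      rw [e, S.eval_eq_lineMap a ⟨hv.trans hx.1, hx.2.trans hv'⟩]
      rfl)
  rwa [e, e] at h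

theorem PolyCurve.param_succ_le (S : PolyCurve d m) {a b : Fin m} (h : a < b) :
    S.param a.succ ≤ S.param b.castSucc :=
  S.param_strictMono.monotone (by rw [Fin.le_def]; simpa using h)

theorem PolyCurve.exists_edge_between {a b : Fin m} (hab : a ≤ b) {y : ℝ}
    (hy : y ∈ Set.Icc (S.param a.castSucc) (S.param b.succ)) :
    ∃ i, a ≤ i ∧ i ≤ b ∧ y ∈ Set.Icc (S.param i.castSucc) (S.param i.succ) := by
  obtain ⟨i, h1, h2, -⟩ := S.exists_edge
    ⟨(S.param_mem _).1.trans hy.1, hy.2.trans (S.param_mem _).2⟩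
  rcases lt_or_ge i a with h3 | h3
  · have h4 := h2.trans (S.param_succ_le h3)
    exact ⟨a, le_rfl, hab, hy.1, h4.trans (S.param_lt a).le⟩
  rcases lt_or_ge b i with h4 | h4
  · have h5 := (S.param_succ_le h4).trans h1
    exact ⟨b, hab, le_rfl, (S.param_lt b).le.trans h5, hy.2⟩
  · exact ⟨i, h3, h4, h1, h2⟩

/-- `x` and `x'` are parameters on two edges of `S` with at most one edge between them. -/
def PolyCurve.Spans (S : PolyCurve d m) (x x' : ℝ) : Prop :=
  ∃ a b : Fin m, a ≤ b ∧ (b : ℕ) ≤ a + 2 ∧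
    x ∈ Set.Icc (S.param a.castSucc) (S.param a.succ) ∧
    x' ∈ Set.Icc (S.param b.castSucc) (S.param b.succ)

theorem PolyCurve.Spans.mono {x x' y y' : ℝ} (h : S.Spans x x') (hx : x ≤ y) (hy : y ≤ y')
    (hx' : y' ≤ x') : S.Spans y y' := by
  obtain ⟨a, b, hab, hba, h1, h2⟩ := h
  obtain ⟨i, hai, hib, hi⟩ :=
    S.exists_edge_between hab ⟨h1.1.trans hx, hy.trans (hx'.trans h2.2)⟩
  obtain ⟨j, hij, hjb, hj⟩ := S.exists_edge_between hib ⟨hi.1.trans hy, hx'.trans h2.2⟩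
  refine ⟨i, j, hij, ?_, hi, hj⟩
  have := Fin.le_def.1 hai
  have := Fin.le_def.1 hjb
  omega

/-- `s` is covered by `c` in the structured sense. -/
def PolyCurve.CoveredBy (S : PolyCurve d m) (r s : ℝ) (c : Candidate m) : Prop :=
  ∃ i j : Fin m, (i : ℕ) ≤ (j : ℕ) ∧ (j : ℕ) ≤ (i : ℕ) + 3 ∧
    s ∈ coverageOn r S i j (S.subedge c)

variable {Δ : ℝ}

/-- Four candidates stand in for a part of `q` that is close to a subcurve of a single edge. -/
theorem PolyCurve.exists_candidates_of_edge (hΔ : 0 < Δ) {q : Pt d × Pt d} (e : Fin m)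
    {v v' w w' : ℝ} (hv : S.param e.castSucc ≤ v) (hv' : v' ≤ S.param e.succ)
    (h : Leash (4 * Δ) S.eval v v' (line q) w w') :
    ∃ N : Finset (Candidate m), N.card ≤ 4 ∧ (∀ c ∈ N, c ∈ S.candidates Δ) ∧
      ∀ x x', S.Spans x x' → Leash (4 * Δ) S.eval x x' (line q) w w' →
        ∀ s ∈ Set.Icc x x', ∃ c ∈ N, S.CoveredBy (8 * Δ) s c := by
  have hlen := sub_pos.2 (S.param_lt e)
  have hvv := h.le_left
  obtain ⟨N, hN, hNc, hcov⟩ := S.exists_four_candidates hΔ e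
    (σ := (v - S.param e.castSucc) / (S.param e.succ - S.param e.castSucc))
    (σ' := (v' - S.param e.castSucc) / (S.param e.succ - S.param e.castSucc))
    (div_nonneg (sub_nonneg.2 hv) hlen.le)
    (div_le_div_of_nonneg_right (by linarith) hlen.le)
    ((div_le_one hlen).2 (by linarith))
  refine ⟨N, hN, hNc, fun x x' ⟨a, b, hab, hba, hx, hx'⟩ hl s hs => ?_⟩
  -- From `S[x, x']` to the part of `q` and on to the fixed piece `S[v, v']`, which is a subedge of
  -- `e`.
  have h1 := (hl.trans h.symm S.continuous_eval (continuous_line q) S.continuous_eval).trans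
    (S.leash_edge e hv hvv hv') S.continuous_eval S.continuous_eval (continuous_line _)
  rw [show 4 * Δ + 4 * Δ + 0 = 8 * Δ by ring] at h1
  obtain ⟨c, hc, h2⟩ := hcov a b x x' hx hx' h1 s hs
  exact ⟨c, hc, a, b, hab, by omega, h2⟩

/-- Always three pieces: if fewer edges are touched, the surplus pieces are single points at `x'`.
-/
theorem PolyCurve.Spans.exists_split {x x' : ℝ} (h : S.Spans x x') (hxx : x ≤ x') :
    ∃ (e₀ e₁ e₂ : Fin m) (v₁ v₂ : ℝ), x ≤ v₁ ∧ v₁ ≤ v₂ ∧ v₂ ≤ x' ∧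
      (S.param e₀.castSucc ≤ x ∧ v₁ ≤ S.param e₀.succ) ∧
      (S.param e₁.castSucc ≤ v₁ ∧ v₂ ≤ S.param e₁.succ) ∧
      (S.param e₂.castSucc ≤ v₂ ∧ x' ≤ S.param e₂.succ) := by
  obtain ⟨a, b, hab, hba, hx, hx'⟩ := h
  rcases hab.eq_or_lt with rfl | hlt
  · exact ⟨a, a, a, x', x', hxx, le_rfl, le_rfl, ⟨hx.1, hx'.2⟩, ⟨hx'.1, hx'.2⟩, hx'.1, hx'.2⟩
  have hlt' := Fin.lt_def.1 hlt
  rcases (show (b : ℕ) = a + 1 ∨ (b : ℕ) = a + 2 by omega) with hb | hb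
  · have e1 : a.succ = b.castSucc := Fin.ext (by simp [hb])
    refine ⟨a, b, b, S.param a.succ, x', hx.2, ?_, le_rfl, ⟨hx.1, le_rfl⟩, ⟨?_, hx'.2⟩, hx'.1,
      hx'.2⟩
    · rw [e1]
      exact hx'.1
    · rw [e1]
  · let e : Fin m := ⟨a + 1, by omega⟩
    have e1 : a.succ = e.castSucc := Fin.ext (by simp [e])
    have e2 : e.succ = b.castSucc := Fin.ext (by simp [e, hb])
    refine ⟨a, e, b, S.param e.castSucc, S.param e.succ, ?_, (S.param_lt e).le, ?_, ⟨hx.1, ?_⟩,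
      ⟨le_rfl, le_rfl⟩, ?_, hx'.2⟩
    · rw [← e1]
      exact hx.2
    · rw [e2]
      exact hx'.1
    · rw [e1]
    · rw [e2]

/-- Twelve candidates cover at least as much as an arbitrary edge. -/
theorem PolyCurve.exists_twelve_candidates (S : PolyCurve d m) (hΔ : 0 < Δ) (q : Pt d × Pt d) :
    ∃ N : Finset (Candidate m), N.card ≤ 12 ∧ (∀ c ∈ N, c ∈ S.candidates Δ) ∧
      ∀ x x', S.Spans x x' → Leash (4 * Δ) S.eval x x' (line q) 0 1 →
        ∀ s ∈ Set.Icc x x', ∃ c ∈ N, S.CoveredBy (8 * Δ) s c := by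
  classical
  by_cases hex : ∃ u u', S.Spans u u' ∧ Leash (4 * Δ) S.eval u u' (line q) 0 1
  swap
  · exact ⟨∅, by simp, by simp, fun x x' h1 h2 => absurd ⟨x, x', h1, h2⟩ hex⟩
  obtain ⟨u, u', hu, hl⟩ := hex
  -- One reference subcurve, cut along edges of `S`, fixes the cut parameters `w₁` and `w₂` of `q`.
  obtain ⟨e₀, e₁, e₂, v₁, v₂, h1, h2, h3, k0, k1, k2⟩ := hu.exists_split hl.le_left
  obtain ⟨w₁, hw₁, l0, l'⟩ := hl.split ⟨h1, h2.trans h3⟩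
  obtain ⟨w₂, hw₂, l1, l2⟩ := l'.split ⟨h2, h3⟩
  obtain ⟨N₀, c0, m0, g0⟩ := S.exists_candidates_of_edge hΔ e₀ k0.1 k0.2 l0
  obtain ⟨N₁, c1, m1, g1⟩ := S.exists_candidates_of_edge hΔ e₁ k1.1 k1.2 l1
  obtain ⟨N₂, c2, m2, g2⟩ := S.exists_candidates_of_edge hΔ e₂ k2.1 k2.2 l2
  refine ⟨N₀ ∪ (N₁ ∪ N₂), ?_, ?_, fun x x' hs hx s hsx => ?_⟩
  · have e1 := Finset.card_union_le N₀ (N₁ ∪ N₂)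
    have e2 := Finset.card_union_le N₁ N₂
    omega
  · intro c hc
    rcases Finset.mem_union.1 hc with hc | hc
    · exact m0 c hc
    rcases Finset.mem_union.1 hc with hc | hc
    · exact m1 c hc
    · exact m2 c hc
  -- An arbitrary subcurve near `q` is cut at partners of the same `w₁` and `w₂`; its pieces need
  -- not lie on single edges.
  · obtain ⟨y₁, hy₁, r0, r'⟩ := hx.symm.split hw₁
    obtain ⟨y₂, hy₂, r1, r2⟩ := r'.split hw₂
    rcases le_total s y₁ with hs1 | hs1
    · obtain ⟨c, hc, h4⟩ := g0 x y₁ (hs.mono le_rfl hy₁.1 hy₁.2) r0.symm s ⟨hsx.1, hs1⟩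
      exact ⟨c, Finset.mem_union_left _ hc, h4⟩
    rcases le_total s y₂ with hs2 | hs2
    · obtain ⟨c, hc, h4⟩ := g1 y₁ y₂ (hs.mono hy₁.1 hy₂.1 hy₂.2) r1.symm s ⟨hs1, hs2⟩
      exact ⟨c, Finset.mem_union_right _ (Finset.mem_union_left _ hc), h4⟩
    · obtain ⟨c, hc, h4⟩ := g2 y₂ x' (hs.mono (hy₁.1.trans hy₂.1) hy₂.2 le_rfl) r2.symm s
        ⟨hs2, hsx.2⟩
      exact ⟨c, Finset.mem_union_right _ (Finset.mem_union_right _ hc), h4⟩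

/-! ### A curve and its good simplification. -/

variable {p k : ℕ} {P : PolyCurve d p} {idx : Fin (k + 1) → Fin (p + 1)}

/-- `P` and `S` are within distance `3Δ`, by a matching that aligns the vertices. -/
theorem IsGoodIndex.exists_matching (hΔ : 0 < Δ) (hS : IsSimplification P S idx)
    (hg : IsGoodIndex Δ P idx) :
    ∃ R, IsMatching R 0 1 0 1 ∧ (∀ z ∈ R, dist (P.eval z.1) (S.eval z.2) ≤ 3 * Δ) ∧
      ∀ (l : ℕ) (hl : l < k + 1) (hl' : l < m + 1),
        (P.param (idx ⟨l, hl⟩), S.param ⟨l, hl'⟩) ∈ R := by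
  obtain ⟨hmono, hm, hvert⟩ := hS
  have hΔ3 : 0 ≤ 3 * Δ := by positivity
  have hPmono := P.param_strictMono.monotone
  have hvert' : ∀ (l : ℕ) (hl : l < k + 1) (hl' : l < m + 1),
      S.vertex ⟨l, hl'⟩ = P.vertex (idx ⟨l, hl⟩) := by
    intro l hl hl'
    rw [hvert]
    have h : (⟨min l k, by omega⟩ : Fin (k + 1)) = ⟨l, hl⟩ :=
      Fin.ext (min_eq_left (Nat.lt_succ_iff.1 hl))
    exact congrArg (fun x => P.vertex (idx x)) h
  have hconst : ∀ {a b : ℝ} {x : Pt d}, a ≤ b →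
      frechetDist (P.sub a b) (edgeCurve (x, x)) ≤ ENNReal.ofReal (3 * Δ) →
      ∀ z ∈ Set.Icc a b, dist (P.eval z) x ≤ 3 * Δ := by
    intro a b x hab h z hz
    obtain ⟨y, -, h1, -⟩ := ((frechetDist_sub_le_iff P hab _ hΔ3).1 h).split hz
    simpa [line] using h1.dist_right
  have key : ∀ (j : ℕ) (hj : j < k + 1) (hj' : j < m + 1),
      ∃ R, IsMatching R 0 (P.param (idx ⟨j, hj⟩)) 0 (S.param ⟨j, hj'⟩) ∧
        (∀ z ∈ R, dist (P.eval z.1) (S.eval z.2) ≤ 3 * Δ) ∧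
        ∀ (l : ℕ) (hl : l < k + 1) (hl' : l < m + 1), l ≤ j →
          (P.param (idx ⟨l, hl⟩), S.param ⟨l, hl'⟩) ∈ R := by
    intro j
    induction j with
    | zero =>
      intro hj hj'
      have h0 : (0 : ℝ) ≤ P.param (idx 0) := (P.param_mem _).1
      have h1 := hg.close_start
      rw [P.param_zero] at h1
      have h2 : Leash (3 * Δ) P.eval 0 (P.param (idx 0)) S.eval 0 0 := by
        refine Leash.const_right h0 fun x hx => ?_
        rw [← S.param_zero, S.eval_param, show (0 : Fin (m + 1)) = ⟨0, hj'⟩ from rfl,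
          hvert' 0 hj hj']
        exact hconst h0 h1 x hx
      obtain ⟨R, hR, hRd⟩ := h2
      have h3 : S.param ⟨0, hj'⟩ = 0 := S.param_zero
      refine ⟨R, by rw [h3]; exact hR, hRd, fun l hl hl' hle => ?_⟩
      obtain rfl : l = 0 := by omega
      rw [h3]
      exact hR.top_mem
    | succ j ih =>
      intro hj hj'
      obtain ⟨R, hR, hRd, hRv⟩ := ih (by omega) (by omega)
      have h1 := hg.close ⟨j, by omega⟩
      have hle : P.param (idx ⟨j, by omega⟩) ≤ P.param (idx ⟨j + 1, hj⟩) :=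
        hPmono (hmono.monotone (by simp))
      have h2 : Leash (3 * Δ) P.eval (P.param (idx ⟨j, by omega⟩)) (P.param (idx ⟨j + 1, hj⟩))
          (line (P.vertex (idx ⟨j, by omega⟩), P.vertex (idx ⟨j + 1, hj⟩))) 0 1 :=
        (frechetDist_sub_le_iff P hle _ hΔ3).1 h1
      let a : Fin m := ⟨j, by omega⟩
      have h3 := S.leash_edge a le_rfl (S.param_lt a).le le_rfl
      rw [sub_self, zero_div, div_self (sub_pos.2 (S.param_lt a)).ne'] at h3
      have h4 : S.edge a =
          (P.vertex (idx ⟨j, by omega⟩), P.vertex (idx ⟨j + 1, hj⟩)) :=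
        Prod.ext (hvert' j (by omega) (by omega)) (hvert' (j + 1) hj hj')
      rw [h4] at h3
      have h5 := h2.trans h3.symm P.continuous_eval (continuous_line _) S.continuous_eval
      rw [add_zero] at h5
      obtain ⟨R', hR', hRd'⟩ := h5
      refine ⟨R ∪ R', hR.concat hR', fun z hz => hz.elim (hRd z) (hRd' z), ?_⟩
      intro l hl hl' hle
      rcases hle.lt_or_eq with h6 | rfl
      · exact Or.inl (hRv l hl hl' (by omega))
      · exact Or.inr hR'.top_mem
  have hkm : k ≤ m := by omega
  obtain ⟨R, hR, hRd, hRv⟩ := key k (by omega) (by omega)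
  have h1 := hg.close_end
  rw [P.param_last] at h1
  have hk1 : P.param (idx (Fin.last k)) ≤ 1 := (P.param_mem _).2
  have hτ1 : S.param ⟨k, by omega⟩ ≤ 1 := (S.param_mem _).2
  -- After vertex `k` there is either a constant edge, if `k = 0`, or just the parameter `1`.
  have hend : ∀ z ∈ Set.Icc (S.param ⟨k, by omega⟩) 1,
      S.eval z = P.vertex (idx (Fin.last k)) := by
    intro z hz
    have hk : S.vertex ⟨k, by omega⟩ = P.vertex (idx (Fin.last k)) :=
      hvert' k (by omega) (by omega)
    rcases Nat.eq_zero_or_pos k with rfl | hk0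
    · obtain rfl : m = 1 := by omega
      have e1 : S.param (Fin.succ (0 : Fin 1)) = 1 := S.param_last
      rw [S.eval_eq_on_edge 0 ⟨hz.1, hz.2.trans e1.ge⟩]
      have e2 : S.diff (Fin.succ (0 : Fin 1)) (Fin.castSucc (0 : Fin 1)) = 0 := by
        rw [PolyCurve.diff, hvert, hvert, sub_eq_zero]
        rfl
      rw [e2, smul_zero, add_zero]
      exact hk
    · obtain rfl : m = k := by omega
      have e1 : S.param ⟨m, by omega⟩ = 1 := S.param_last
      rw [e1] at hz
      obtain rfl : z = 1 := le_antisymm hz.2 hz.1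
      rw [← hk, ← S.eval_param, e1]
  have h2 : Leash (3 * Δ) P.eval (P.param (idx (Fin.last k))) 1 S.eval
      (S.param ⟨k, by omega⟩) 1 := by
    refine Leash.concat (b := 1) (d := S.param ⟨k, by omega⟩)
      (Leash.const_right hk1 fun x hx => ?_) (Leash.const_left hτ1 fun y hy => ?_)
    · rw [hend _ ⟨le_rfl, hτ1⟩]
      exact hconst hk1 h1 x hx
    · rw [hend _ hy]
      exact hconst hk1 h1 1 ⟨hk1, le_rfl⟩
  obtain ⟨R', hR', hRd'⟩ := h2
  exact ⟨R ∪ R', hR.concat hR', fun z hz => hz.elim (hRd z) (hRd' z),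
    fun l hl hl' => Or.inl (hRv l hl hl' (by omega))⟩

/-- A subcurve of `P` that is close to an edge contains at most two consecutive vertices of the
simplification. -/
theorem IsGoodIndex.not_three (hΔ : 0 < Δ) (hmono : StrictMono idx) (hg : IsGoodIndex Δ P idx)
    {q : Pt d × Pt d} {t t' : ℝ} (h : Leash Δ P.eval t t' (line q) 0 1) {l : ℕ}
    (hl : l + 2 < k + 1) (h1 : t ≤ P.param (idx ⟨l, by omega⟩)) :
    t' < P.param (idx ⟨l + 2, hl⟩) := by
  by_contra! h2
  have hle : P.param (idx ⟨l, by omega⟩) ≤ P.param (idx ⟨l + 2, hl⟩) :=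
    P.param_strictMono.monotone (hmono.monotone (by simp))
  refine absurd (hg.maximal l hl) (not_lt.2 ?_)
  rw [frechetDist_sub_le_iff P hle _ (by positivity)]
  obtain ⟨w, hw, -, h3⟩ := h.split ⟨h1, hle.trans h2⟩
  obtain ⟨w', hw', h4, -⟩ := h3.split ⟨hle, h2⟩
  -- The part of `q` between `w` and `w'` and the shortcut edge are segments whose ends are within
  -- `Δ`, so the segments are too. Together with the distance `Δ` from `P` to `q` this contradicts
  -- `maximal`.
  have h5 : Leash Δ (line q) w w' (line (P.vertex (idx ⟨l, by omega⟩),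
      P.vertex (idx ⟨l + 2, hl⟩))) 0 1 := by
    refine Leash.segment hw'.1 zero_le_one fun c hc => ?_
    have e1 := h4.dist_left
    have e2 := h4.dist_right
    rw [P.eval_param, dist_comm, dist_eq_norm] at e1 e2
    rw [dist_eq_norm]
    have e3 : line q (w + c * (w' - w)) - line (P.vertex (idx ⟨l, by omega⟩),
        P.vertex (idx ⟨l + 2, hl⟩)) (0 + c * (1 - 0)) =
        (1 - c) • (line q w - P.vertex (idx ⟨l, by omega⟩)) +
        c • (line q w' - P.vertex (idx ⟨l + 2, hl⟩)) := by
      simp only [line_eq]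
      module
    rw [e3]
    refine (norm_add_le _ _).trans ?_
    rw [norm_smul, norm_smul, Real.norm_of_nonneg hc.1, Real.norm_of_nonneg (sub_nonneg.2 hc.2)]
    have := mul_le_mul_of_nonneg_left e1 (sub_nonneg.2 hc.2)
    have := mul_le_mul_of_nonneg_left e2 hc.1
    linarith
  have h6 := h4.trans h5 P.continuous_eval (continuous_line _) (continuous_line _)
  rwa [show Δ + Δ = 2 * Δ by ring] at h6

/-- Suppose that `s` is on edge `a` and `s'` lies beyond edge `a + 2`. Since the matching is a chain
through the aligned vertices, `t` is not after chosen vertex `a + 1` and `t'` not before chosen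
vertex `a + 3`, which `not_three` forbids. -/
theorem IsGoodIndex.spans (hΔ : 0 < Δ) (hS : IsSimplification P S idx) (hg : IsGoodIndex Δ P idx)
    {R : Set (ℝ × ℝ)} (hR : IsMatching R 0 1 0 1)
    (hRv : ∀ (l : ℕ) (hl : l < k + 1) (hl' : l < m + 1),
      (P.param (idx ⟨l, hl⟩), S.param ⟨l, hl'⟩) ∈ R)
    {q : Pt d × Pt d} {t t' s s' : ℝ} (h : Leash Δ P.eval t t' (line q) 0 1)
    (hts : (t, s) ∈ R) (hts' : (t', s') ∈ R) (hss : s ≤ s') : S.Spans s s' := by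
  have hm := hS.2.1
  have hs0 : s ∈ Set.Icc (0 : ℝ) 1 := ⟨(hR.subset hts).1.2, (hR.subset hts).2.2⟩
  have hs1 : s' ∈ Set.Icc (0 : ℝ) 1 := ⟨(hR.subset hts').1.2, (hR.subset hts').2.2⟩
  obtain ⟨a, ha1, ha2, ha3⟩ := S.exists_edge hs0
  have hlast : S.param (⟨m - 1, by have := S.pos; omega⟩ : Fin m).succ = 1 := by
    rw [← S.param_last]
    congr 1
    exact Fin.ext (by simp; have := S.pos; omega)
  by_cases h3 : (a : ℕ) + 3 < m + 1
  · let e : Fin m := ⟨a + 2, by omega⟩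
    have hs'e : s' ≤ S.param e.succ := by
      by_contra! h4
      have h5 : s < S.param a.succ := ha3.resolve_right (by omega)
      have h6 := hRv (a + 1) (by omega) (by omega)
      have h7 := hRv (a + 3) (by omega) (by omega)
      have h8 : t ≤ P.param (idx ⟨a + 1, by omega⟩) :=
        ((hR.chain _ hts _ h6).resolve_right fun h9 => absurd h9.2 (not_le.2 h5)).1
      have h9 : P.param (idx ⟨a + 3, by omega⟩) ≤ t' :=
        ((hR.chain _ h7 _ hts').resolve_right fun h9 => absurd h9.2 (not_le.2 h4)).1
      exact absurd (hg.not_three hΔ hS.1 h (l := a + 1) (by omega) h8) (not_lt.2 h9)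
    have hae : a ≤ e := Fin.le_def.2 (by simp [e])
    obtain ⟨j, hj1, hj2, hj⟩ := S.exists_edge_between hae ⟨ha1.trans hss, hs'e⟩
    exact ⟨a, j, hj1, Fin.le_def.1 hj2, ⟨ha1, ha2⟩, hj⟩
  · have hae : a ≤ ⟨m - 1, by have := S.pos; omega⟩ := Fin.le_def.2 (by simp; omega)
    obtain ⟨j, hj1, hj2, hj⟩ := S.exists_edge_between hae ⟨ha1.trans hss, hlast ▸ hs1.2⟩
    exact ⟨a, j, hj1, by omega, ⟨ha1, ha2⟩, hj⟩

/-- A parameter of `S` is carried to `P`, where some `q` serves it, and the served subcurve is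
carried back to `S`. The twelve candidates of `q` do not depend on the parameter, so their union
over `C` has at most `12 |C|` elements. -/
theorem IsGoodSimplification.exists_covering (hΔ : 0 < Δ) (h : IsGoodSimplification Δ P S)
    (C : Finset (Pt d × Pt d)) (hC : IsCovering Δ P (C : Set (Pt d × Pt d))) :
    ∃ CB : Finset (Candidate m), (∀ c ∈ CB, c ∈ S.candidates Δ) ∧ CB.card ≤ 12 * C.card ∧
      IsStructuredCovering (8 * Δ) S (S.subedge '' (CB : Set (Candidate m))) ∧
      IsCovering (11 * Δ) P (S.subedge '' (CB : Set (Candidate m))) := by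
  classical
  obtain ⟨k, idx, hS, hg⟩ := h
  obtain ⟨R, hR, hRd, hRv⟩ := hg.exists_matching hΔ hS
  choose N hN1 hN2 hN3 using fun q => S.exists_twelve_candidates hΔ q
  have hRI : ∀ z ∈ R, z.1 ∈ Set.Icc (0 : ℝ) 1 ∧ z.2 ∈ Set.Icc (0 : ℝ) 1 := fun z hz =>
    ⟨⟨(hR.subset hz).1.1, (hR.subset hz).2.1⟩, (hR.subset hz).1.2, (hR.subset hz).2.2⟩
  have hcov : ∀ s ∈ Set.Icc (0 : ℝ) 1, ∃ c ∈ C.biUnion N, S.CoveredBy (8 * Δ) s c := by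
    intro s hs
    obtain ⟨t, hts⟩ := hR.right s hs
    have ht : t ∈ coverage Δ P (C : Set (Pt d × Pt d)) := by
      rw [show coverage Δ P (C : Set (Pt d × Pt d)) = _ from hC]
      exact (hRI _ hts).1
    obtain ⟨q, hq, t₁, t₂, h0, h12, h1, ht12, hF⟩ := ht
    have hl := (frechetDist_sub_le_iff P h12 q hΔ.le).1 hF
    -- The partners of `t₁` and `t₂` are chosen on either side of `s`, so that `S[s₁, s₂]` still
    -- contains `s`.
    obtain ⟨s₁, hs₁, hR₁⟩ := hR.exists_left_le hts h0 ht12.1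
    obtain ⟨s₂, hs₂, hR₂⟩ := hR.exists_left_ge hts h1 ht12.2
    have hsp := hg.spans hΔ hS hR hRv hl hR₁ hR₂ (hs₁.trans hs₂)
    have hlS : Leash (3 * Δ) P.eval t₁ t₂ S.eval s₁ s₂ :=
      ⟨_, hR.restrict hR₁ hR₂ ⟨h12, hs₁.trans hs₂⟩, fun z hz => hRd z hz.1⟩
    have h4 := hlS.symm.trans hl S.continuous_eval P.continuous_eval (continuous_line q)
    rw [show 3 * Δ + Δ = 4 * Δ by ring] at h4
    obtain ⟨c, hc, h5⟩ := hN3 q s₁ s₂ hsp h4 s ⟨hs₁, hs₂⟩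
    exact ⟨c, Finset.mem_biUnion.2 ⟨q, hq, hc⟩, h5⟩
  refine ⟨C.biUnion N, ?_, ?_, ?_, ?_⟩
  · intro c hc
    obtain ⟨q, -, hq⟩ := Finset.mem_biUnion.1 hc
    exact hN2 q c hq
  · rw [mul_comm]
    exact Finset.card_biUnion_le_card_mul C N 12 fun q _ => hN1 q
  · refine Set.Subset.antisymm ?_ fun s hs => ?_
    · rintro s ⟨q, -, i, j, -, -, t, t', hs, ht, -, ht', -⟩
      exact ⟨(S.param_mem _).1.trans (ht.1.trans hs.1), hs.2.trans (ht'.2.trans (S.param_mem _).2)⟩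
    · obtain ⟨c, hc, i, j, h1, h2, h3⟩ := hcov s hs
      exact ⟨_, ⟨c, hc, rfl⟩, i, j, h1, h2, h3⟩
  · refine Set.Subset.antisymm ?_ fun s hs => ?_
    · rintro s ⟨q, -, t, t', h0, -, h1, hs, -⟩
      exact ⟨h0.trans hs.1, hs.2.trans h1⟩
    -- The covering of `S` is pulled back to `P` through the same matching.
    · obtain ⟨x, hx⟩ := hR.left s hs
      obtain ⟨c, hc, i, j, -, -, t, t', hxt, ht, htt, ht', hF⟩ := hcov x (hRI _ hx).2
      have hl := (frechetDist_sub_le_iff S htt _ (by positivity)).1 hF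
      obtain ⟨y, hy, hR₁⟩ := hR.swap.exists_left_le (x := x) (y := s) hx
        ((S.param_mem _).1.trans ht.1) hxt.1
      obtain ⟨y', hy', hR₂⟩ := hR.swap.exists_left_ge (x := x) (y := s) hx
        (ht'.2.trans (S.param_mem _).2) hxt.2
      have hyy : y ≤ y' := hy.trans hy'
      have hlS : Leash (3 * Δ) P.eval y y' S.eval t t' :=
        ⟨_, hR.restrict hR₁ hR₂ ⟨hyy, htt⟩, fun z hz => hRd z hz.1⟩
      have h4 := hlS.trans hl P.continuous_eval S.continuous_eval (continuous_line _)
      rw [show 3 * Δ + 8 * Δ = 11 * Δ by ring] at h4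
      exact ⟨_, ⟨c, hc, rfl⟩, y, y', (hRI _ hR₁).1.1, hyy, (hRI _ hR₂).1.2, ⟨hy, hy'⟩,
        (frechetDist_sub_le_iff P hyy _ (by positivity)).2 h4⟩

end Covering

/-! Running programs. -/

section Programs

/-- Started in `σ`, the program halts within time `T` in a state with property `Q`. -/
def Run (M : ℕ) (c : Cmd) (σ : State) (T : ℕ) (Q : State → Prop) : Prop :=
  ∃ T' ≤ T, ∃ σ', Exec M c σ T' σ' ∧ Q σ'

variable {M : ℕ} {σ : State} {T T₁ T₂ : ℕ} {Q Q₁ : State → Prop} {c c₁ c₂ : Cmd}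

theorem Run.mono (h : Run M c σ T₁ Q₁) (hT : T₁ ≤ T) (hQ : ∀ σ, Q₁ σ → Q σ) : Run M c σ T Q :=
  let ⟨T', hT', σ', h1, h2⟩ := h
  ⟨T', hT'.trans hT, σ', h1, hQ _ h2⟩

theorem Run.skip (h : Q σ) : Run M .skip σ 1 Q := ⟨1, le_rfl, σ, .skip σ, h⟩

theorem Run.seq (h₁ : Run M c₁ σ T₁ Q₁) (h₂ : ∀ σ', Q₁ σ' → Run M c₂ σ' T₂ Q) :
    Run M (.seq c₁ c₂) σ (T₁ + T₂) Q := by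
  obtain ⟨T₁', hT₁, σ', h3, h4⟩ := h₁
  obtain ⟨T₂', hT₂, σ'', h5, h6⟩ := h₂ σ' h4
  exact ⟨_, add_le_add hT₁ hT₂, σ'', .seq h3 h5, h6⟩

theorem Run.iset {a e : IExp} {i v : ℕ} (ha : a.eval M σ = some i) (hi : i < M)
    (he : e.eval M σ = some v) (hQ : Q { σ with int := Function.update σ.int i v }) :
    Run M (.iset a e) σ (a.cost + e.cost + 1) Q :=
  ⟨_, le_rfl, _, .iset ha hi he, hQ⟩

/-- The integer cell number `n`. -/
def icell (n : ℕ) : IExp := .cell (.lit n)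

theorem eval_icell {n v : ℕ} (hn : n < M) (h : σ.int n = v) :
    (icell n).eval M σ = some v := by
  simp [icell, IExp.eval, hn, h]

theorem IExp.eval_add {a b : IExp} {i j : ℕ} (ha : a.eval M σ = some i)
    (hb : b.eval M σ = some j) : (IExp.add a b).eval M σ = some (i + j) := by
  simp [IExp.eval, ha, hb]

theorem IExp.eval_lit (n : ℕ) : (IExp.lit n).eval M σ = some n := rfl

/-- For all `j` with `j + 1 < n`, where `n` is stored in cell `0`. -/
def forLoop (x : ℕ) (c : Cmd) : Cmd :=
  .seq (.iset (.lit x) (.lit 0))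
    (.loop (.ilt (.add (icell x) (.lit 1)) (icell 0))
      (.seq c (.iset (.lit x) (.add (icell x) (.lit 1)))))

/-- Integer cell `x` is overwritten. -/
def State.setInt (σ : State) (x v : ℕ) : State := { σ with int := Function.update σ.int x v }

/-- The invariant `J` is indexed by the number of completed passes. A pass costs `14` beyond its
body (test and branch `8`, increment `6`); the initialization costs `3` and the last test `8`. -/
theorem run_forLoop {x m Tc : ℕ} (hx : x < M) (hM : 0 < M) (J : ℕ → State → Prop)
    (hJ0 : ∀ j σ, J j σ → σ.int 0 = m + 1)
    (hJx : ∀ j σ v, J j σ → J j (σ.setInt x v))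
    (hc : ∀ j σ, j < m → J j σ → σ.int x = j →
      Run M c σ Tc fun σ' => J (j + 1) σ' ∧ σ'.int x = j)
    (h0 : J 0 σ) : Run M (forLoop x c) σ (m * (Tc + 14) + 11) (J m) := by
  have key : ∀ (l j : ℕ) (σ : State), j + l = m → J j σ → σ.int x = j →
      Run M (.loop (.ilt (.add (icell x) (.lit 1)) (icell 0))
        (.seq c (.iset (.lit x) (.add (icell x) (.lit 1))))) σ (l * (Tc + 14) + 8) (J m) := by
    intro l
    induction l with
    | zero =>
      intro j σ hj hJ hσ
      have hu : (BExp.ilt (.add (icell x) (.lit 1)) (icell 0)).eval M σ = some false := by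
        simp only [BExp.eval, IExp.eval_add (eval_icell hx hσ) (IExp.eval_lit 1),
          eval_icell hM (hJ0 _ _ hJ)]
        simp
        omega
      refine ⟨_, ?_, σ, .loop_false hu, by rwa [← show j = m by omega]⟩
      simp [BExp.cost, IExp.cost, icell]
    | succ l ih =>
      intro j σ hj hJ hσ
      have hu : (BExp.ilt (.add (icell x) (.lit 1)) (icell 0)).eval M σ = some true := by
        simp only [BExp.eval, IExp.eval_add (eval_icell hx hσ) (IExp.eval_lit 1),
          eval_icell hM (hJ0 _ _ hJ)]
        simp
        omega
      have hbody : Run M (.seq c (.iset (.lit x) (.add (icell x) (.lit 1)))) σ (Tc + 6)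
          fun σ' => J (j + 1) σ' ∧ σ'.int x = j + 1 := by
        refine Run.seq (hc j σ (by omega) hJ hσ) fun σ' hσ' => ?_
        refine (Run.iset (IExp.eval_lit x) hx
          (IExp.eval_add (eval_icell hx hσ'.2) (IExp.eval_lit 1)) ⟨hJx _ _ (j + 1) hσ'.1, ?_⟩).mono
          (by simp [IExp.cost, icell]) fun _ h => h
        simp
      obtain ⟨T₁, hT₁, σ₁, h1, h2, h3⟩ := hbody
      obtain ⟨T₂, hT₂, σ₂, h4, h5⟩ := ih (j + 1) σ₁ (by omega) h2 h3
      refine ⟨_, ?_, σ₂, .loop_true hu h1 h4, h5⟩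
      simp only [BExp.cost, IExp.cost, icell]
      rw [Nat.succ_mul]
      omega
  refine (Run.seq (Q₁ := fun σ' => J 0 σ' ∧ σ'.int x = 0) (T₁ := 3)
    (Run.iset (IExp.eval_lit x) hx (IExp.eval_lit 0) ⟨hJx _ _ 0 h0, ?_⟩)
    fun σ' hσ' => key m 0 σ' (by omega) hσ'.1 hσ'.2).mono (by omega) fun _ h => h
  simp

/-! Real expressions. -/

variable {x y : RExp} {r s : ℝ}

theorem RExp.eval_add (hx : x.eval M σ = some r) (hy : y.eval M σ = some s) :
    (RExp.add x y).eval M σ = some (r + s) := by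
  simp [RExp.eval, hx, hy]

theorem RExp.eval_sub (hx : x.eval M σ = some r) (hy : y.eval M σ = some s) :
    (RExp.sub x y).eval M σ = some (r - s) := by
  simp [RExp.eval, hx, hy]

theorem RExp.eval_mul (hx : x.eval M σ = some r) (hy : y.eval M σ = some s) :
    (RExp.mul x y).eval M σ = some (r * s) := by
  simp [RExp.eval, hx, hy]

theorem RExp.eval_div (hx : x.eval M σ = some r) (hy : y.eval M σ = some s) (hs : s ≠ 0) :
    (RExp.div x y).eval M σ = some (r / s) := by
  simp [RExp.eval, hx, hy, hs]

theorem RExp.eval_sqrt (hx : x.eval M σ = some r) (hr : 0 ≤ r) :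
    (RExp.sqrt x).eval M σ = some √r := by
  simp [RExp.eval, hx, not_lt.2 hr]

theorem RExp.eval_lit (z : ℤ) : (RExp.lit z).eval M σ = some (z : ℝ) := rfl

/-- The expression for `posPart`. -/
def posPartExp (x : RExp) : RExp := .div (.add x (.sqrt (.mul x x))) (.lit 2)

theorem eval_posPartExp (hx : x.eval M σ = some r) :
    (posPartExp x).eval M σ = some (posPart r) := by
  have h := RExp.eval_div (RExp.eval_add hx (RExp.eval_sqrt (RExp.eval_mul hx hx)
    (mul_self_nonneg r))) (RExp.eval_lit 2) (by norm_num)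
  simpa [posPart, posPartExp] using h

/-- The expression for `clamp`. -/
def clampExp (x : RExp) : RExp := .sub (posPartExp x) (posPartExp (.sub x (.lit 1)))

theorem eval_clampExp (hx : x.eval M σ = some r) :
    (clampExp x).eval M σ = some (clamp r) := by
  have h := RExp.eval_sub (eval_posPartExp hx)
    (eval_posPartExp (RExp.eval_sub hx (RExp.eval_lit 1)))
  simpa [clamp, clampExp] using h

/-- The expression for `quadRoot`. -/
def quadRootExp (e : ℤ) (a b c : RExp) : RExp :=
  .div (.sub (.mul (.lit e) (.sqrt (posPartExp (.sub (.mul b b) (.mul a c))))) b) a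

theorem eval_quadRootExp {e : ℤ} {a b c : RExp} {a' b' c' : ℝ} (ha : a.eval M σ = some a')
    (hb : b.eval M σ = some b') (hc : c.eval M σ = some c') (h : a' ≠ 0) :
    (quadRootExp e a b c).eval M σ = some (quadRoot e a' b' c') :=
  RExp.eval_div (RExp.eval_sub (RExp.eval_mul (RExp.eval_lit e) (RExp.eval_sqrt
    (eval_posPartExp (RExp.eval_sub (RExp.eval_mul hb hb) (RExp.eval_mul ha hc)))
    (by rw [posPart_eq_max]; exact le_max_right _ _))) hb) ha h

/-- A number that is given by `e.2`, but is zero if the denominator `e.1` is zero. -/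
def Val (M : ℕ) (σ : State) (e : RExp × RExp) (x : ℝ) : Prop :=
  ∃ D, e.1.eval M σ = some D ∧ (D = 0 → x = 0) ∧ (D ≠ 0 → e.2.eval M σ = some x)

/-- The number described by `e` is written to the address `a`. -/
def writeVal (a : IExp) (e : RExp × RExp) : Cmd :=
  .ite (.req e.1 (.lit 0)) (.rset a (.lit 0)) (.rset a e.2)

/-- A bound on the running time of `writeVal`. -/
def writeCost (a : IExp) (e : RExp × RExp) : ℕ := a.cost + e.1.cost + e.2.cost + 6

theorem run_writeVal {a : IExp} {e : RExp × RExp} {i : ℕ} {v : ℝ} (ha : a.eval M σ = some i)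
    (hi : i < M) (he : Val M σ e v) (hQ : Q { σ with real := Function.update σ.real i v }) :
    Run M (writeVal a e) σ (writeCost a e) Q := by
  obtain ⟨D, h1, h2, h3⟩ := he
  by_cases hD : D = 0
  · have hu : (BExp.req e.1 (.lit 0)).eval M σ = some true := by
      simp [BExp.eval, h1, RExp.eval_lit, hD]
    have hl : (RExp.lit 0).eval M σ = some v := by
      rw [RExp.eval_lit, h2 hD, Int.cast_zero]
    refine ⟨_, ?_, _, .ite_true hu (.rset ha hi hl), hQ⟩
    simp only [writeCost, BExp.cost, RExp.cost]
    omega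
  · have hu : (BExp.req e.1 (.lit 0)).eval M σ = some false := by
      simp [BExp.eval, h1, RExp.eval_lit, hD]
    refine ⟨_, ?_, _, .ite_false hu (.rset ha hi (h3 hD)), hQ⟩
    simp only [writeCost, BExp.cost, RExp.cost]
    omega

/-- The expressions for `vertexCrit`, in terms of `⟪v, v⟫`, `⟪u, v⟫`, `⟪u, u⟫`. -/
def vertexCritExp (e : ℤ) (ρ vv uv uu : RExp) : RExp × RExp :=
  (vv, clampExp (quadRootExp e vv uv (.sub uu ρ)))

/-- The expressions for `edgeCrit`. -/
def edgeCritExp (e : ℤ) (ρ vv uv uu vw uw ww : RExp) : RExp × RExp :=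
  let g : RExp := .sub (.mul vv ww) (.mul vw vw)
  (.mul vv g, clampExp (.div (.sub (.mul (quadRootExp e g (.sub (.mul vw uv) (.mul vv uw))
    (.sub (.sub (.mul vv uu) (.mul uv uv)) (.mul vv ρ))) vw) uv) vv))

open scoped RealInnerProductSpace

section

variable {E : Type*} [NormedAddCommGroup E] [InnerProductSpace ℝ E] {u v w : E}
  {ρ vv uv uu vw uw ww : RExp} {e : ℤ}

theorem val_vertexCrit (hρ : ρ.eval M σ = some r) (hvv : vv.eval M σ = some ⟪v, v⟫)
    (huv : uv.eval M σ = some ⟪u, v⟫) (huu : uu.eval M σ = some ⟪u, u⟫) :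
    Val M σ (vertexCritExp e ρ vv uv uu) (vertexCrit e r u v) := by
  refine ⟨_, hvv, fun h => by rw [vertexCrit, if_pos h], fun h => ?_⟩
  rw [vertexCrit, if_neg h]
  exact eval_clampExp (eval_quadRootExp hvv huv (RExp.eval_sub huu hρ) h)

/-- One test of the product guards both divisions, by the Gram determinant and by `⟪v, v⟫`. -/
theorem val_edgeCrit (hρ : ρ.eval M σ = some r) (hvv : vv.eval M σ = some ⟪v, v⟫)
    (huv : uv.eval M σ = some ⟪u, v⟫) (huu : uu.eval M σ = some ⟪u, u⟫)
    (hvw : vw.eval M σ = some ⟪v, w⟫) (huw : uw.eval M σ = some ⟪u, w⟫)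
    (hww : ww.eval M σ = some ⟪w, w⟫) :
    Val M σ (edgeCritExp e ρ vv uv uu vw uw ww) (edgeCrit e r u v w) := by
  have hg := RExp.eval_sub (RExp.eval_mul hvv hww) (RExp.eval_mul hvw hvw)
  refine ⟨_, RExp.eval_mul hvv hg, fun h => if_pos h, fun h => ?_⟩
  rw [edgeCrit, gram, if_neg h]
  exact eval_clampExp (RExp.eval_div (RExp.eval_sub (RExp.eval_mul (eval_quadRootExp hg
    (RExp.eval_sub (RExp.eval_mul hvw huv) (RExp.eval_mul hvv huw))
    (RExp.eval_sub (RExp.eval_sub (RExp.eval_mul hvv huu) (RExp.eval_mul huv huv))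
    (RExp.eval_mul hvv hρ)) (right_ne_zero_of_mul h)) hvw) huv) hvv (left_ne_zero_of_mul h))

end

/-- The expression for an inner product. -/
def dotExp {d : ℕ} (x y : Fin d → RExp) : RExp :=
  (List.finRange d).foldr (fun c z => RExp.add (.mul (x c) (y c)) z) (.lit 0)

theorem eval_dotExp {d : ℕ} {x y : Fin d → RExp} {u v : Pt d}
    (hx : ∀ c, (x c).eval M σ = some (u c)) (hy : ∀ c, (y c).eval M σ = some (v c)) :
    (dotExp x y).eval M σ = some ⟪u, v⟫ := by
  have h : ∀ l : List (Fin d), (l.foldr (fun c z => RExp.add (.mul (x c) (y c)) z) (.lit 0)).eval M σ =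
      some (l.map fun c => u c * v c).sum := by
    intro l
    induction l with
    | nil => simp [RExp.eval_lit]
    | cons c l ih => exact RExp.eval_add (RExp.eval_mul (hx c) (hy c)) ih
  rw [dotExp, h, ← Fin.sum_univ_def]
  simp [PiLp.inner_apply, mul_comm]

/-- A multiple of an integer expression. -/
def IExp.nsmul (a : IExp) : ℕ → IExp
  | 0 => .lit 0
  | n + 1 => .add (a.nsmul n) a

/-- The machine cannot multiply natural numbers, but address computations only need fixed factors
such as `d`, for which repeated addition has constant cost. -/
theorem IExp.eval_nsmul {a : IExp} {i : ℕ} (ha : a.eval M σ = some i) (n : ℕ) :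
    (a.nsmul n).eval M σ = some (i * n) := by
  induction n with
  | zero => rfl
  | succ n ih => exact IExp.eval_add ih ha

variable {d m : ℕ}

/-- Coordinate `c` of the difference of the vertices `i` and `j`. -/
def diffExp (d : ℕ) (i j : IExp) (c : Fin d) : RExp :=
  .sub (.cell (.add (.add (.lit 1) (i.nsmul d)) (.lit c)))
    (.cell (.add (.add (.lit 1) (j.nsmul d)) (.lit c)))

/-- The first cell after the input. -/
def outBase (d m : ℕ) : ℕ := 1 + (m + 1) * d

/-- The real memory contains the input. -/
def State.HasInput (σ : State) (S : PolyCurve d m) (Δ : ℝ) : Prop :=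
  ∀ x < outBase d m, σ.real x = (inputState S Δ).real x

variable {S : PolyCurve d m} {Δ : ℝ}

theorem eval_coord (hM : outBase d m ≤ M) (hσ : σ.HasInput S Δ) {i : IExp} {j : Fin (m + 1)}
    (hi : i.eval M σ = some (j : ℕ)) (c : Fin d) :
    (RExp.cell (.add (.add (.lit 1) (i.nsmul d)) (.lit c))).eval M σ = some (S.vertex j c) := by
  have h1 : 1 + (j : ℕ) * d + (c : ℕ) < outBase d m := by
    have h2 := Nat.mul_le_mul_right d j.2
    rw [Nat.succ_mul] at h2
    have := c.2
    unfold outBase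
    omega
  have h3 := IExp.eval_add (IExp.eval_add (IExp.eval_lit 1) (IExp.eval_nsmul hi d))
    (IExp.eval_lit (M := M) (σ := σ) (c : ℕ))
  simp only [RExp.eval, h3, Option.bind_some]
  rw [if_pos (h1.trans_le hM), hσ _ h1, inputState_real]

theorem eval_diffExp (hM : outBase d m ≤ M) (hσ : σ.HasInput S Δ) {i i' : IExp}
    {j j' : Fin (m + 1)} (hi : i.eval M σ = some (j : ℕ)) (hi' : i'.eval M σ = some (j' : ℕ))
    (c : Fin d) : (diffExp d i i' c).eval M σ = some (S.diff j j' c) :=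
  RExp.eval_sub (eval_coord hM hσ hi c) (eval_coord hM hσ hi' c)

/-- The expressions for the critical parameters of edge `i` with respect to edge `a`. -/
def critExps (d : ℕ) (i a : IExp) : List (RExp × RExp) :=
  let i' : IExp := .add i (.lit 1)
  let a' : IExp := .add a (.lit 1)
  let r : RExp := .mul (.lit 8) (.cell (.lit 0))
  let ρ : RExp := .mul r r
  let u := diffExp d i a
  let u' := diffExp d i a'
  let v := diffExp d i' i
  let w := diffExp d a' a
  let edge := fun e =>
    edgeCritExp e ρ (dotExp v v) (dotExp u v) (dotExp u u) (dotExp v w) (dotExp u w) (dotExp w w)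
  [(.lit 1, .lit 0), (.lit 1, .lit 1),
    vertexCritExp 1 ρ (dotExp v v) (dotExp u v) (dotExp u u),
    vertexCritExp (-1) ρ (dotExp v v) (dotExp u v) (dotExp u u),
    vertexCritExp 1 ρ (dotExp v v) (dotExp u' v) (dotExp u' u'),
    vertexCritExp (-1) ρ (dotExp v v) (dotExp u' v) (dotExp u' u'),
    edge 1, edge (-1)]

theorem forall₂_critExps (hM : outBase d m ≤ M) (hσ : σ.HasInput S Δ) {i a : IExp} {j b : Fin m}
    (hi : i.eval M σ = some (j : ℕ)) (ha : a.eval M σ = some (b : ℕ)) :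
    List.Forall₂ (fun e (x : unitInterval) => Val M σ e x) (critExps d i a)
      (S.critList Δ j b) := by
  have hi0 : i.eval M σ = some (j.castSucc : ℕ) := hi
  have ha0 : a.eval M σ = some (b.castSucc : ℕ) := ha
  have hi' : (IExp.add i (.lit 1)).eval M σ = some (j.succ : ℕ) :=
    IExp.eval_add hi (IExp.eval_lit 1)
  have ha' : (IExp.add a (.lit 1)).eval M σ = some (b.succ : ℕ) :=
    IExp.eval_add ha (IExp.eval_lit 1)
  have hΔ : (RExp.cell (.lit 0)).eval M σ = some Δ := by
    have h0 : 0 < outBase d m := by unfold outBase; omega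
    simp [RExp.eval, IExp.eval, h0.trans_le hM, hσ 0 h0, inputState]
  have hr : (RExp.mul (.lit 8) (.cell (.lit 0))).eval M σ = some (8 * Δ) := by
    simpa using RExp.eval_mul (RExp.eval_lit 8) hΔ
  have hρ := RExp.eval_mul hr hr
  have hu := eval_diffExp hM hσ hi0 ha0
  have hu' := eval_diffExp hM hσ hi0 ha'
  have hv := eval_diffExp hM hσ hi' hi0
  have hw := eval_diffExp hM hσ ha' ha0
  have hvert : ∀ (e : ℤ) (e' : ℝ), (e : ℝ) = e' → ∀ {x : Fin d → RExp} {u : Pt d},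
      (∀ c, (x c).eval M σ = some (u c)) →
      Val M σ (vertexCritExp e _ _ _ _) (vertexCrit e' _ u _) :=
    fun e e' he x u hx => he ▸ val_vertexCrit hρ (eval_dotExp hv hv) (eval_dotExp hx hv)
      (eval_dotExp hx hx)
  have hedge : ∀ (e : ℤ) (e' : ℝ), (e : ℝ) = e' →
      Val M σ (edgeCritExp e _ _ _ _ _ _ _) (edgeCrit e' _ _ _ _) :=
    fun e e' he => he ▸ val_edgeCrit hρ (eval_dotExp hv hv) (eval_dotExp hu hv)
      (eval_dotExp hu hu) (eval_dotExp hv hw) (eval_dotExp hu hw) (eval_dotExp hw hw)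
  -- The denominator of a literal is `1`, so the default value is never taken.
  have hlit : ∀ (z : ℤ) (x : ℝ), (z : ℝ) = x → Val M σ (.lit 1, .lit z) x := by
    rintro z x rfl
    exact ⟨1, by simp [RExp.eval_lit], fun h => absurd h one_ne_zero, fun _ => rfl⟩
  exact .cons (hlit 0 _ (by simp)) (.cons (hlit 1 _ (by simp)) (.cons (hvert 1 _ (by simp) hu)
    (.cons (hvert (-1) _ (by simp) hu) (.cons (hvert 1 _ (by simp) hu')
    (.cons (hvert (-1) _ (by simp) hu') (.cons (hedge 1 _ (by simp))
    (.cons (hedge (-1) _ (by simp)) .nil)))))))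

/-! The program. -/

/-- Writes one candidate: the counters of the edges are in the cells `3`, `4`, `5`, and the number
of candidates is in cell `6`. -/
def emit (e : (RExp × RExp) × (RExp × RExp)) : Cmd :=
  .seq (.iset (.add (.lit 10) (icell 6)) (icell 3))
    (.seq (writeVal (.add (icell 2) ((icell 6).nsmul 2)) e.1)
      (.seq (writeVal (.add (.add (icell 2) ((icell 6).nsmul 2)) (.lit 1)) e.2)
        (.iset (.lit 6) (.add (icell 6) (.lit 1)))))

/-- A bound on the running time of `emit`. -/
def emitCost (e : (RExp × RExp) × (RExp × RExp)) : ℕ :=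
  7 + (writeCost (.add (icell 2) ((icell 6).nsmul 2)) e.1 +
    (writeCost (.add (.add (icell 2) ((icell 6).nsmul 2)) (.lit 1)) e.2 + 6))

/-- The list `l` has been written so far. -/
structure Emitted (S : PolyCurve d m) (Δ : ℝ) (l : List (Candidate m)) (σ : State) : Prop where
  size : σ.int 0 = m + 1
  base : σ.int 2 = outBase d m
  count : σ.int 6 = l.length
  input : σ.HasInput S Δ
  entry : ∀ (r : ℕ) (h : r < l.length), σ.HoldsAt 10 (outBase d m) r l[r]

theorem Emitted.setInt {l : List (Candidate m)} (h : Emitted S Δ l σ) {x : ℕ} (hx : 3 ≤ x)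
    (hx' : x ≤ 5) (v : ℕ) : Emitted S Δ l (σ.setInt x v) where
  size := by
    rw [← h.size]
    exact Function.update_of_ne (by omega) _ _
  base := by
    rw [← h.base]
    exact Function.update_of_ne (by omega) _ _
  count := by
    rw [← h.count]
    exact Function.update_of_ne (by omega) _ _
  input := h.input
  entry := fun r hr => by
    obtain ⟨h1, h2⟩ := h.entry r hr
    exact ⟨(Function.update_of_ne (by omega) _ _).trans h1, h2⟩

/-- The loop counters. -/
def State.Counters (σ : State) (i a b : ℕ) : Prop := σ.int 3 = i ∧ σ.int 4 = a ∧ σ.int 5 = b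

/-- The values are assumed in every state with the right input and counters, because the second one
is evaluated after the first has been stored. The output lies outside the input and the integer
cells below `10`, so the assumption persists. -/
theorem run_emit {l : List (Candidate m)} {i a b : Fin m} {e : (RExp × RExp) × (RExp × RExp)}
    {s t : unitInterval} (hσ : Emitted S Δ l σ) (hcount : σ.Counters i a b)
    (hM : outBase d m + 2 * l.length + 12 ≤ M)
    (he : ∀ σ : State, σ.HasInput S Δ → σ.Counters i a b → Val M σ e.1 s)
    (he' : ∀ σ : State, σ.HasInput S Δ → σ.Counters i a b → Val M σ e.2 t) :
    Run M (emit e) σ (emitCost e) fun σ' =>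
      Emitted S Δ (l ++ [(i, s, t)]) σ' ∧ σ'.Counters i a b := by
  obtain ⟨h3, h4, h5⟩ := hcount
  have e1 : (IExp.add (.lit 10) (icell 6)).eval M σ = some (10 + l.length) :=
    IExp.eval_add (IExp.eval_lit 10) (eval_icell (by omega) hσ.count)
  refine Run.seq (T₁ := 7) (Run.iset e1 (by omega) (eval_icell (by omega) h3)
    (Q := fun σ' => σ' = σ.setInt (10 + l.length) i) rfl) ?_
  rintro σ₁ rfl
  have c1 : ∀ x < 10, (σ.setInt (10 + l.length) i).int x = σ.int x := fun x hx =>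
    Function.update_of_ne (by omega) _ _
  have e2 : (IExp.add (icell 2) ((icell 6).nsmul 2)).eval M (σ.setInt (10 + l.length) i) =
      some (outBase d m + l.length * 2) :=
    IExp.eval_add (eval_icell (by omega) ((c1 2 (by omega)).trans hσ.base))
      (IExp.eval_nsmul (eval_icell (by omega) ((c1 6 (by omega)).trans hσ.count)) 2)
  have k1 : (σ.setInt (10 + l.length) i).Counters i a b :=
    ⟨(c1 3 (by omega)).trans h3, (c1 4 (by omega)).trans h4, (c1 5 (by omega)).trans h5⟩
  refine Run.seq (run_writeVal e2 (by omega) (he _ hσ.input k1)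
    (Q := fun σ' => σ'.int = (σ.setInt (10 + l.length) i).int ∧
      σ'.real = Function.update σ.real (outBase d m + l.length * 2) s) ⟨rfl, rfl⟩) ?_
  rintro σ₂ ⟨hi2, hr2⟩
  have e3 : (IExp.add (.add (icell 2) ((icell 6).nsmul 2)) (.lit 1)).eval M σ₂ =
      some (outBase d m + l.length * 2 + 1) :=
    IExp.eval_add (IExp.eval_add (eval_icell (by omega) (by rw [hi2, c1 2 (by omega), hσ.base]))
      (IExp.eval_nsmul (eval_icell (by omega) (by rw [hi2, c1 6 (by omega), hσ.count])) 2))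
      (IExp.eval_lit 1)
  have k2 : σ₂.Counters i a b := by
    unfold State.Counters
    rw [hi2]
    exact k1
  have n2 : σ₂.HasInput S Δ := fun x hx => by
    rw [hr2, Function.update_of_ne (by omega), hσ.input x hx]
  refine Run.seq (run_writeVal e3 (by omega) (he' _ n2 k2)
    (Q := fun σ' => σ'.int = (σ.setInt (10 + l.length) i).int ∧
      σ'.real = Function.update (Function.update σ.real (outBase d m + l.length * 2) s)
        (outBase d m + l.length * 2 + 1) t) ⟨hi2, by rw [hr2]⟩) ?_
  rintro σ₃ ⟨hi3, hr3⟩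
  have hc6 : σ₃.int 6 = l.length := by rw [hi3, c1 6 (by omega), hσ.count]
  have c4 : ∀ x < 10, x ≠ 6 → Function.update σ₃.int 6 (l.length + 1) x = σ.int x := by
    intro x hx hx6
    rw [Function.update_of_ne hx6, hi3, c1 x hx]
  refine (Run.iset (IExp.eval_lit 6) (by omega)
    (IExp.eval_add (eval_icell (by omega) hc6) (IExp.eval_lit 1))
    ⟨⟨?_, ?_, ?_, ?_, ?_⟩, ?_, ?_, ?_⟩).mono (by simp [IExp.cost, icell]) fun _ h => h
  · exact (c4 0 (by omega) (by omega)).trans hσ.size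
  · exact (c4 2 (by omega) (by omega)).trans hσ.base
  · simp
  · intro x hx
    change σ₃.real x = _
    rw [hr3, Function.update_of_ne (by omega), Function.update_of_ne (by omega), hσ.input x hx]
  · intro r hr
    unfold State.HoldsAt
    dsimp only
    rw [Function.update_of_ne (by omega), hi3, hr3]
    rw [List.length_append, List.length_singleton] at hr
    rcases Nat.lt_succ_iff_lt_or_eq.1 hr with h | rfl
    · obtain ⟨g1, g2, g3⟩ := hσ.entry r h
      rw [List.getElem_append_left h, ← g1, ← g2, ← g3]
      refine ⟨Function.update_of_ne (by omega) _ _, ?_, ?_⟩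
      · rw [Function.update_of_ne (by omega), Function.update_of_ne (by omega)]
      · rw [Function.update_of_ne (by omega), Function.update_of_ne (by omega)]
    · rw [List.getElem_concat_length rfl, mul_comm 2 l.length]
      refine ⟨Function.update_self _ _ _, ?_, Function.update_self _ _ _⟩
      rw [Function.update_of_ne (by omega), Function.update_self]
  · exact (c4 3 (by omega) (by omega)).trans h3
  · exact (c4 4 (by omega) (by omega)).trans h4
  · exact (c4 5 (by omega) (by omega)).trans h5

/-- Writes a list of candidates. -/
def emitAll : List ((RExp × RExp) × (RExp × RExp)) → Cmd
  | [] => .skip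
  | e :: l => .seq (emit e) (emitAll l)

/-- A bound on the running time of `emitAll`. -/
def emitAllCost : List ((RExp × RExp) × (RExp × RExp)) → ℕ
  | [] => 1
  | e :: l => emitCost e + emitAllCost l

theorem run_emitAll {i a b : Fin m} {es : List ((RExp × RExp) × (RExp × RExp))}
    {st : List (unitInterval × unitInterval)}
    (h : List.Forall₂ (fun e x => ∀ σ : State, σ.HasInput S Δ → σ.Counters i a b →
      Val M σ e.1 x.1 ∧ Val M σ e.2 x.2) es st) :
    ∀ {l : List (Candidate m)} {σ : State}, Emitted S Δ l σ → σ.Counters i a b →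
      outBase d m + 2 * (l.length + st.length) + 12 ≤ M →
      Run M (emitAll es) σ (emitAllCost es) fun σ' =>
        Emitted S Δ (l ++ st.map fun x => (i, x)) σ' ∧ σ'.Counters i a b := by
  induction h with
  | nil =>
    intro l σ h1 h2 _
    exact Run.skip ⟨by simpa using h1, h2⟩
  | cons h _ ih =>
    intro l σ h1 h2 hM
    rw [List.length_cons] at hM
    refine Run.seq (run_emit h1 h2 (by omega) (fun σ hσ hσ' => (h σ hσ hσ').1)
      fun σ hσ hσ' => (h σ hσ hσ').2) fun σ' hσ' => ?_
    have h3 := ih hσ'.1 hσ'.2 (by rw [List.length_append, List.length_singleton]; omega)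
    simpa using h3

/-- The pairs of expressions for the candidates of one pass through the innermost loop. -/
def pairExps (d : ℕ) : List ((RExp × RExp) × (RExp × RExp)) :=
  (critExps d (icell 3) (icell 4)).flatMap fun e =>
    (critExps d (icell 3) (icell 5)).map fun f => (e, f)

/-- The program that computes the candidates. -/
def candidateProg (d : ℕ) : Cmd :=
  .seq (.iset (.lit 2) (.add (.lit 1) ((icell 0).nsmul d)))
    (.seq (forLoop 3 (forLoop 4 (forLoop 5 (emitAll (pairExps d)))))
      (.seq (.iset (.lit 1) (.lit 10)) (.iset (.lit 0) (icell 6))))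

/-- The candidates of one pass through the innermost loop. -/
noncomputable def PolyCurve.passCandidates (S : PolyCurve d m) (Δ : ℝ) (i a b : Fin m) :
    List (Candidate m) :=
  (S.critList Δ i a).flatMap fun s => (S.critList Δ i b).map fun t => (i, s, t)

theorem length_passCandidates (i a b : Fin m) : (S.passCandidates Δ i a b).length = 64 := by
  have h1 : ∀ i a, (S.critList Δ i a).length = 8 := fun _ _ => rfl
  simp [PolyCurve.passCandidates, List.length_flatMap, h1]

/-- The loop body is straight-line in the candidates: all `8 · 8` pairs are unrolled into the
program text, so its cost depends on `d` only. -/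
theorem run_pass {i a b : Fin m} {l : List (Candidate m)} (hσ : Emitted S Δ l σ)
    (hcount : σ.Counters i a b) (hM : outBase d m + 2 * (l.length + 64) + 12 ≤ M) :
    Run M (emitAll (pairExps d)) σ (emitAllCost (pairExps d)) fun σ' =>
      Emitted S Δ (l ++ S.passCandidates Δ i a b) σ' ∧ σ'.Counters i a b := by
  let st : List (unitInterval × unitInterval) :=
    (S.critList Δ i a).flatMap fun s => (S.critList Δ i b).map fun t => (s, t)
  have hst : (st.map fun x => ((i, x) : Candidate m)) = S.passCandidates Δ i a b := by
    simp [st, PolyCurve.passCandidates, List.map_flatMap, Function.comp_def]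
  have hlen : st.length = 64 := by
    rw [← length_passCandidates (S := S) (Δ := Δ) i a b, ← hst, List.length_map]
  have hcrit : ∀ (x : ℕ) (c : Fin m), x < 10 →
      (∀ σ : State, σ.Counters i a b → σ.int x = c) →
      List.Forall₂ (fun e (x : unitInterval) => ∀ σ : State, σ.HasInput S Δ →
        σ.Counters i a b → Val M σ e x) (critExps d (icell 3) (icell x)) (S.critList Δ i c) := by
    intro x c hx hxc
    -- The quantifier over states has to move inside `Forall₂`, hence the comparison index by index.
    rw [List.forall₂_iff_get]
    refine ⟨rfl, fun n h1 h2 σ hσ hσ' => ?_⟩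
    have h3 := forall₂_critExps (by omega) hσ (eval_icell (by omega) hσ'.1)
      (eval_icell (n := x) (by omega) (hxc σ hσ')) (M := M)
    exact (List.forall₂_iff_get.1 h3).2 n h1 h2
  have h1 : List.Forall₂ (fun e (x : unitInterval × unitInterval) => ∀ σ : State,
      σ.HasInput S Δ → σ.Counters i a b → Val M σ e.1 x.1 ∧ Val M σ e.2 x.2)
      (pairExps d) st := by
    refine List.rel_flatMap (hcrit 4 a (by omega) fun σ h => h.2.1) ?_
    intro e s hes
    refine List.rel_map ?_ (hcrit 5 b (by omega) fun σ h => h.2.2)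
    exact fun f t hft σ hσ hσ' => ⟨hes σ hσ hσ', hft σ hσ hσ'⟩
  have h2 := run_emitAll h1 hσ hcount (by rw [hlen]; omega)
  rwa [hst] at h2

theorem flatMap_take_succ {α : Type*} (f : Fin m → List α) {j : ℕ} (hj : j < m) :
    ((List.finRange m).take (j + 1)).flatMap f =
      ((List.finRange m).take j).flatMap f ++ f ⟨j, hj⟩ := by
  rw [List.take_succ_eq_append_getElem (by simpa using hj)]
  simp

theorem flatMap_take_self {α : Type*} (f : Fin m → List α) :
    ((List.finRange m).take m).flatMap f = (List.finRange m).flatMap f := by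
  rw [List.take_of_length_le (by simp)]

theorem length_flatMap_take_le {α : Type*} (f : Fin m → List α) {n : ℕ}
    (hf : ∀ i, (f i).length = n) {j : ℕ} (hj : j ≤ m) :
    (((List.finRange m).take j).flatMap f).length = j * n := by
  simp [List.length_flatMap, hf, hj]

end Programs

/-! ### The three nested loops and the total cost. -/

section Loops

variable {M d m : ℕ} {S : PolyCurve d m} {Δ : ℝ} {σ : State}

theorem State.setInt_of_ne (σ : State) {x y : ℕ} (v : ℕ) (h : y ≠ x) :
    (σ.setInt x v).int y = σ.int y :=
  Function.update_of_ne h _ _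

/-- The prefix `l` is what the enclosing loops have already written; the invariant appends the
passes completed so far. -/
theorem run_innerLoop {i a : Fin m} {l : List (Candidate m)} (hσ : Emitted S Δ l σ)
    (h3 : σ.int 3 = i) (h4 : σ.int 4 = a) (hM : outBase d m + 2 * (l.length + m * 64) + 12 ≤ M) :
    Run M (forLoop 5 (emitAll (pairExps d))) σ (m * (emitAllCost (pairExps d) + 14) + 11)
      fun σ' => Emitted S Δ (l ++ (List.finRange m).flatMap (S.passCandidates Δ i a)) σ' ∧
        σ'.int 3 = i ∧ σ'.int 4 = a := by
  have h := run_forLoop (M := M) (m := m) (x := 5) (σ := σ) (c := emitAll (pairExps d))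
    (Tc := emitAllCost (pairExps d)) (by omega) (by omega)
    (fun j σ => Emitted S Δ (l ++ ((List.finRange m).take j).flatMap (S.passCandidates Δ i a)) σ ∧
      σ.int 3 = i ∧ σ.int 4 = a)
    (fun j σ h => h.1.size)
    (fun j σ v h => ⟨h.1.setInt (by omega) (by omega) v,
      (σ.setInt_of_ne v (by decide)).trans h.2.1,
      (σ.setInt_of_ne v (by decide)).trans h.2.2⟩)
    (fun j σ hj h h5 => by
      have h6 : ((l ++ ((List.finRange m).take j).flatMap
          (S.passCandidates Δ i a)).length + 64) ≤ l.length + m * 64 := by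
        rw [List.length_append, length_flatMap_take_le _ (length_passCandidates i a) hj.le]
        omega
      refine (run_pass (b := ⟨j, hj⟩) h.1 ⟨h.2.1, h.2.2, h5⟩ (by omega)).mono le_rfl ?_
      rintro σ' ⟨h7, h8, h9, h10⟩
      rw [flatMap_take_succ _ hj, ← List.append_assoc]
      exact ⟨⟨h7, h8, h9⟩, h10⟩)
    ⟨by simpa using hσ, h3, h4⟩
  rwa [flatMap_take_self] at h

theorem run_middleLoop {i : Fin m} {l : List (Candidate m)} (hσ : Emitted S Δ l σ)
    (h3 : σ.int 3 = i) (hM : outBase d m + 2 * (l.length + m * (m * 64)) + 12 ≤ M) :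
    Run M (forLoop 4 (forLoop 5 (emitAll (pairExps d)))) σ
      (m * ((m * (emitAllCost (pairExps d) + 14) + 11) + 14) + 11)
      fun σ' => Emitted S Δ (l ++ (List.finRange m).flatMap fun a =>
        (List.finRange m).flatMap (S.passCandidates Δ i a)) σ' ∧ σ'.int 3 = i := by
  have hlen : ∀ a, ((List.finRange m).flatMap (S.passCandidates Δ i a)).length = m * 64 :=
    fun a => by simp [List.length_flatMap, length_passCandidates]
  have h := run_forLoop (M := M) (m := m) (x := 4) (σ := σ)
    (c := forLoop 5 (emitAll (pairExps d)))
    (Tc := m * (emitAllCost (pairExps d) + 14) + 11) (by omega) (by omega)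
    (fun j σ => Emitted S Δ (l ++ ((List.finRange m).take j).flatMap fun a =>
        (List.finRange m).flatMap (S.passCandidates Δ i a)) σ ∧ σ.int 3 = i)
    (fun j σ h => h.1.size)
    (fun j σ v h => ⟨h.1.setInt (by omega) (by omega) v,
      (σ.setInt_of_ne v (by decide)).trans h.2⟩)
    (fun j σ hj h h5 => by
      have h6 : ((l ++ ((List.finRange m).take j).flatMap fun a =>
          (List.finRange m).flatMap (S.passCandidates Δ i a)).length + m * 64) ≤
          l.length + m * (m * 64) := by
        rw [List.length_append, length_flatMap_take_le _ hlen hj.le, add_assoc, ← Nat.succ_mul]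
        exact Nat.add_le_add_left (Nat.mul_le_mul_right _ hj) _
      refine (run_innerLoop (a := ⟨j, hj⟩) h.1 h.2 h5 (by omega)).mono le_rfl ?_
      rintro σ' ⟨h7, h8, h9⟩
      rw [flatMap_take_succ _ hj, ← List.append_assoc]
      exact ⟨⟨h7, h8⟩, h9⟩)
    ⟨by simpa using hσ, h3⟩
  rwa [flatMap_take_self] at h

theorem run_outerLoop (hσ : Emitted S Δ [] σ) (hM : outBase d m + 2 * (m * (m * (m * 64))) + 12 ≤ M) :
    Run M (forLoop 3 (forLoop 4 (forLoop 5 (emitAll (pairExps d))))) σ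
      (m * ((m * ((m * (emitAllCost (pairExps d) + 14) + 11) + 14) + 11) + 14) + 11)
      (Emitted S Δ (S.candidates Δ)) := by
  have hlen : ∀ i, ((List.finRange m).flatMap fun a =>
      (List.finRange m).flatMap (S.passCandidates Δ i a)).length = m * (m * 64) :=
    fun a => by simp [List.length_flatMap, length_passCandidates]
  have h := run_forLoop (M := M) (m := m) (x := 3) (σ := σ)
    (c := forLoop 4 (forLoop 5 (emitAll (pairExps d))))
    (Tc := m * ((m * (emitAllCost (pairExps d) + 14) + 11) + 14) + 11) (by omega) (by omega)
    (fun j σ => Emitted S Δ (((List.finRange m).take j).flatMap fun i =>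
      (List.finRange m).flatMap fun a => (List.finRange m).flatMap (S.passCandidates Δ i a)) σ)
    (fun j σ h => h.size)
    (fun j σ v h => h.setInt (by omega) (by omega) v)
    (fun j σ hj h h5 => by
      have h6 : (((List.finRange m).take j).flatMap fun i => (List.finRange m).flatMap fun a =>
          (List.finRange m).flatMap (S.passCandidates Δ i a)).length + m * (m * 64) ≤
          m * (m * (m * 64)) := by
        rw [length_flatMap_take_le _ hlen hj.le, ← Nat.succ_mul]
        exact Nat.mul_le_mul_right _ hj
      refine (run_middleLoop (i := ⟨j, hj⟩) h h5 (by omega)).mono le_rfl ?_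
      rintro σ' ⟨h7, h8⟩
      rw [flatMap_take_succ _ hj]
      exact ⟨h7, h8⟩)
    (by simpa using hσ)
  rw [flatMap_take_self] at h
  exact h

theorem IExp.cost_nsmul (a : IExp) (n : ℕ) : (a.nsmul n).cost = 1 + n * (a.cost + 1) := by
  induction n with
  | zero => simp [IExp.nsmul, IExp.cost]
  | succ n ih =>
    rw [IExp.nsmul, IExp.cost, ih]
    ring

open Classical in
/-- The program computes the candidates. -/
theorem run_candidateProg (S : PolyCurve d m) (Δ : ℝ)
    (hM : outBase d m + 2 * (m * (m * (m * 64))) + 12 ≤ M) :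
    ∃ T ≤ m * ((m * ((m * (emitAllCost (pairExps d) + 14) + 11) + 14) + 11) + 14) + 25 + 3 * d,
      Computes (candidateProg d) S Δ T M (S.candidates Δ).toFinset := by
  have h0 : (IExp.add (.lit 1) ((icell 0).nsmul d)).eval M (inputState S Δ) =
      some (outBase d m) :=
    IExp.eval_add (IExp.eval_lit 1) (IExp.eval_nsmul (eval_icell (by omega) rfl) d)
  have hstart : Emitted S Δ [] ((inputState S Δ).setInt 2 (outBase d m)) :=
    ⟨rfl, rfl, rfl, fun _ _ => rfl, fun r hr => absurd hr (Nat.not_lt_zero r)⟩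
  have hlen : (S.candidates Δ).length = m * (m * (m * 64)) := by
    rw [S.length_candidates]
    ring
  have h1 : Run M (candidateProg d) (inputState S Δ)
      (((IExp.lit 2).cost + (IExp.add (.lit 1) ((icell 0).nsmul d)).cost + 1) +
        ((m * ((m * ((m * (emitAllCost (pairExps d) + 14) + 11) + 14) + 11) + 14) + 11) + (3 + 4)))
      fun σ => σ.Outputs M (S.candidates Δ).toFinset := by
    refine Run.seq (Run.iset (IExp.eval_lit 2) (by omega) h0
      (Q := fun σ' => σ' = (inputState S Δ).setInt 2 (outBase d m)) rfl) ?_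
    rintro σ₁ rfl
    refine Run.seq (run_outerLoop hstart hM) fun σ₂ hσ => ?_
    refine Run.seq (Run.iset (IExp.eval_lit 1) (by omega) (IExp.eval_lit 10)
      (Q := fun σ' => σ' = σ₂.setInt 1 10) rfl) ?_
    rintro σ₃ rfl
    have h6 : (σ₂.setInt 1 10).int 6 = (S.candidates Δ).length := hσ.count
    -- The loops read the number of vertices from cell `0`, so the count replaces it only now.
    refine Run.iset (IExp.eval_lit 0) (by omega) (eval_icell (by omega) h6) ?_
    have hh : ∀ (r : ℕ) (h : r < (S.candidates Δ).length),
        State.HoldsAt { σ₂.setInt 1 10 with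
          int := Function.update (σ₂.setInt 1 10).int 0 (S.candidates Δ).length }
          10 (outBase d m) r (S.candidates Δ)[r] := by
      intro r hr
      obtain ⟨e1, e2⟩ := hσ.entry r hr
      refine ⟨?_, e2⟩
      rw [← e1]
      exact (Function.update_of_ne (by omega) _ _).trans (Function.update_of_ne (by omega) _ _)
    have g0 : Function.update (σ₂.setInt 1 10).int 0 (S.candidates Δ).length 0 =
      (S.candidates Δ).length := Function.update_self _ _ _
    have g1 : Function.update (σ₂.setInt 1 10).int 0 (S.candidates Δ).length 1 = 10 :=
      (Function.update_of_ne (by decide) _ _).trans (Function.update_self 1 10 σ₂.int)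
    have g2 : Function.update (σ₂.setInt 1 10).int 0 (S.candidates Δ).length 2 = outBase d m :=
      (Function.update_of_ne (by decide) _ _).trans
        ((σ₂.setInt_of_ne 10 (by decide)).trans hσ.base)
    unfold State.Outputs
    dsimp only
    rw [g0, g1, g2]
    refine ⟨by omega, by omega, fun r hr => ⟨_, ?_, hh r hr⟩, fun c hc => ?_⟩
    · exact List.mem_toFinset.2 (List.getElem_mem hr)
    · obtain ⟨r, hr, rfl⟩ := List.mem_iff_getElem.1 (List.mem_toFinset.1 hc)
      exact ⟨r, hr, hh r hr⟩
  obtain ⟨T, hT, σ', h2, h3⟩ := h1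
  refine ⟨T, hT.trans ?_, σ', h2, h3⟩
  simp only [IExp.cost, IExp.cost_nsmul, icell]
  omega

end Loops

/-- Injectivity of `idx` gives `k ≤ p`; the degenerate edge for `k = 0` is covered by `1 ≤ p`. -/
theorem IsSimplification.edges_le {d p m k : ℕ} {P : PolyCurve d p} {S : PolyCurve d m}
    {idx : Fin (k + 1) → Fin (p + 1)} (h : IsSimplification P S idx) : m ≤ p := by
  have h1 := Fintype.card_le_of_injective idx h.1.injective
  simp only [Fintype.card_fin] at h1
  have h2 := P.pos
  have h3 := h.2.1
  omega

end TrajCover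

open TrajCover in
theorem mainTheorem4 (d : ℕ) :
    ∃ (prog : TrajCover.Cmd) (K : ℕ),
      ∀ (p m : ℕ) (P : TrajCover.PolyCurve d p) (S : TrajCover.PolyCurve d m) (Δ : ℝ),
        0 < Δ → TrajCover.IsGoodSimplification Δ P S →
        ∃ (B : Finset (TrajCover.Candidate m)) (T M : ℕ),
          TrajCover.Computes prog S Δ T M B ∧
          T ≤ K * P.complexity ^ 3 ∧
          M ≤ K * P.complexity ^ 3 ∧
          B.card ≤ K * P.complexity ^ 3 ∧
          ∀ (k : ℕ) (C : Finset (TrajCover.Pt d × TrajCover.Pt d)),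
            C.card = k → TrajCover.IsCovering Δ P (C : Set (TrajCover.Pt d × TrajCover.Pt d)) →
            ∃ CB : Finset (TrajCover.Candidate m),
              CB ⊆ B ∧ CB.card ≤ 12 * k ∧
              TrajCover.IsStructuredCovering (8 * Δ) S
                (S.subedge '' (CB : Set (TrajCover.Candidate m))) ∧
              TrajCover.IsCovering (11 * Δ) P
                (S.subedge '' (CB : Set (TrajCover.Candidate m))) := by
  classical
  -- Relative to `n³`, the time needs `emitAllCost (pairExps d) + 89 + 3 d`, the space `141 + d` and
  -- the number of candidates `64`.
  refine ⟨candidateProg d, emitAllCost (pairExps d) + 4 * d + 300, ?_⟩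
  intro p m P S Δ hΔ hS
  obtain ⟨T, hT, hcomp⟩ := run_candidateProg S Δ le_rfl
  have hmp : m ≤ p := by
    obtain ⟨k, idx, h, -⟩ := hS
    exact h.edges_le
  have hn : P.complexity = p + 1 := rfl
  have hmn : m ≤ P.complexity := by omega
  have hn1 : 1 ≤ P.complexity := by omega
  have hm1 : m + 1 ≤ P.complexity := by omega
  generalize P.complexity = n at hmn hn1 hm1 ⊢
  have p3 : m ^ 3 ≤ n ^ 3 := Nat.pow_le_pow_left hmn 3
  have p2 : m ^ 2 ≤ n ^ 3 :=
    (Nat.pow_le_pow_left hmn 2).trans (Nat.pow_le_pow_right hn1 (by omega))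
  have p1 : n ≤ n ^ 3 := Nat.le_self_pow (by omega) n
  have q1 : emitAllCost (pairExps d) * m ^ 3 ≤ emitAllCost (pairExps d) * n ^ 3 :=
    Nat.mul_le_mul_left _ p3
  have q2 : d * 1 ≤ d * n ^ 3 := Nat.mul_le_mul_left _ (hn1.trans p1)
  have q3 : d * (m + 1) ≤ d * n ^ 3 := Nat.mul_le_mul_left _ (hm1.trans p1)
  refine ⟨(S.candidates Δ).toFinset, T, _, hcomp, hT.trans ?_, ?_, ?_, ?_⟩
  · nlinarith
  · unfold outBase
    nlinarith
  · refine (List.toFinset_card_le _).trans ?_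
    rw [S.length_candidates]
    nlinarith
  · rintro k C rfl hC
    obtain ⟨CB, h1, h2, h3, h4⟩ := hS.exists_covering hΔ C hC
    exact ⟨CB, fun c hc => List.mem_toFinset.2 (h1 c hc), h2, h3, h4⟩
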